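/- Let $Q$ be a smooth manifold of dimension $n\ge 1$ with a smooth pseudo-Riemannian metric of any signature, with contravariant form $\mathbf G=(g^{ij})$ and Laplace--Beltrami operator $\Delta$; let $V$ be a real function on $Q$ and $\hbar>0$. Let $(q^i)$ be local coordinates on an open set $U\subseteq Q$ (a chart of the smooth atlas) with $g^{ii}\neq 0$ on $U$ for all $i$. Assume that $(q^i)$ are FER-separable coordinates for the Schrödinger equation $$-\tfrac{\hbar^2}{2}\Delta\psi+(V-E)\psi=0,$$ that is: there are a constant $E\in\mathbb R$ and a smooth nowhere vanishing real function $R$ on $U$ such that the equation with this value of $E$ is solved on $U$ by $$\psi=R\prod_{i=1}^n\phi_i(q^i,c)\qquad\text{for all } c=(c_\alpha)\in C,$$ where $C\subseteq\mathbb R^{2n-1}$ is open and nonempty, the (real or complex valued) functions $\phi_i$ are smooth in $(q^i,c)$ and nowhere zero, and, with $u_i=\phi_i'/\phi_i$, $v_i=\phi_i''/\phi_i$ (derivatives with respect to $q^i$), the completeness condition $$\mathrm{rank}\begin{bmatrix}\partial u_i/\partial c_\alpha\\ \partial v_i/\partial c_\alpha\end{bmatrix}=2n-1$$ holds at all points of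 $U$ and all $c\in C$. For a contravariant symmetric $2$-tensor $\mathbf K$ put $P_{\mathbf K}=K^{ij}p_ip_j$ on $T^*Q$, and let $\{A,B\}=\sum_i\left(\frac{\partial A}{\partial p_i}\frac{\partial B}{\partial q^i}-\frac{\partial A}{\partial q^i}\frac{\partial B}{\partial p_i}\right)$ be the Poisson bracket. $\mathbf K$ is a conformal Killing tensor of $\mathbf G$ if it is smooth and $\{P_{\mathbf K},P_{\mathbf G}\}=(X^ip_i)\,P_{\mathbf G}$ for some vector field $X$. Then there exist on $U$ conformal Killing tensors $\mathbf K_1,\dots,\mathbf K_{n-1}$ of $\mathbf G$ such that (i) $\mathbf K_1,\dots,\mathbf K_{n-1},\mathbf G$ are linearly independent at each point of $U$; (ii) $\mathbf K_1,\dots,\mathbf K_{n-1}$ have common eigenvectors with respect to $\mathbf G$: the coordinate vectors $\partial/\partial q^1,\dots,\partial/\partial q^n$, which form a basis of the tangent space at each point of $U$, are eigenvectors of every $\mathbf K_h$; (iii) there is a nowhere vanishing function $\sigma$ on $U$ such that $\mathbf K_n:=\mathbf G/\sigma$ is smooth and $$\{P_{\mathbf K_h},P_{\mathbf K_j}\}=0\qquad\text{on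 } T^*U\text{ for all } h,j=1,\dots,n .$$ If the function $\frac{2}{\hbar^2}E-\mathcal U$, with $\mathcal U=-\left(\frac{\Delta R}{R}-\frac{2}{\hbar^2}V\right)$, vanishes nowhere on $U$, then $\mathbf K_1,\dots,\mathbf K_{n-1}$ can be chosen so that (i), (ii) and (iii) hold with $\sigma=\frac{2}{\hbar^2}E-\mathcal U$. -/

import Mathlib

open scoped Manifold ContDiff

noncomputable section

namespace FER

/-- The coordinate space `ℝⁿ` in which the charts of an `n`-dimensional manifold take values. -/
abbrev Coord (n : ℕ) : Type := EuclideanSpace ℝ (Fin n)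

section Partial

variable {n : ℕ} {F : Type*} [NormedAddCommGroup F] [NormedSpace ℝ F]

/-- The partial derivative `∂f/∂yⁱ` at `y` of a function `f` on `ℝⁿ`. -/
def partialD (i : Fin n) (f : Coord n → F) (y : Coord n) : F :=
  fderiv ℝ f y (EuclideanSpace.single i 1)

end Partial

section Manifold

variable {n : ℕ} {Q : Type*} [TopologicalSpace Q] [ChartedSpace (Coord n) Q]

/-- The cotangent space `T*ₓQ`. -/
abbrev Cotangent (n : ℕ) {Q : Type*} [TopologicalSpace Q] [ChartedSpace (Coord n) Q] (x : Q) :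
    Type :=
  TangentSpace (𝓡 n) x →L[ℝ] ℝ

/-- (Not necessarily smooth) contravariant 2-tensor fields: a bilinear form on each cotangent
space. -/
abbrev TensorField (n : ℕ) (Q : Type*) [TopologicalSpace Q] [ChartedSpace (Coord n) Q] :=
  (x : Q) → LinearMap.BilinForm ℝ (Cotangent n x)

/-- Real functions on the cotangent bundle `T*Q`. -/
abbrev CotangentFunction (n : ℕ) (Q : Type*) [TopologicalSpace Q] [ChartedSpace (Coord n) Q] :=
  (x : Q) → Cotangent n x → ℝ

/-- The local coordinate systems `(q¹, …, qⁿ)` of the smooth manifold `Q`: a coordinate system is a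
chart of the maximal smooth atlas; its domain is the open set `q.source`, and its range is the open
set `q.target` of `ℝⁿ`. -/
def IsCoordinateSystem (q : OpenPartialHomeomorph Q (Coord n)) : Prop :=
  q ∈ IsManifold.maximalAtlas (𝓡 n) ∞ Q

/-- The coordinate 1-form `dqⁱ` at `x`. -/
def coordForm (q : OpenPartialHomeomorph Q (Coord n)) (i : Fin n) (x : Q) : Cotangent n x :=
  mfderiv (𝓡 n) 𝓘(ℝ, ℝ) (fun z : Q => q z i) x

/-- The contravariant components `K^{ij} = K(dqⁱ, dqʲ)` in the coordinates `q`, as functions of the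
coordinate values `y`. -/
def comp (q : OpenPartialHomeomorph Q (Coord n)) (K : TensorField n Q) (y : Coord n) :
    Matrix (Fin n) (Fin n) ℝ :=
  Matrix.of fun i j => K (q.symm y) (coordForm q i (q.symm y)) (coordForm q j (q.symm y))

/-- Smoothness of a tensor field on the open set `U`: in all local coordinates, its components
are smooth functions of the coordinates. -/
def IsSmoothOn (K : TensorField n Q) (U : Set Q) : Prop :=
  ∀ q : OpenPartialHomeomorph Q (Coord n), IsCoordinateSystem q → ∀ i j : Fin n,
    ContDiffOn ℝ ∞ (fun y => comp q K y i j) (q.target ∩ q.symm ⁻¹' U)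

/-- `G` is a (contravariant) pseudo-Riemannian metric, of any signature: smooth, symmetric and
nondegenerate. -/
structure IsMetric (G : TensorField n Q) : Prop where
  smooth : IsSmoothOn G Set.univ
  symm : ∀ (x : Q) (α β : Cotangent n x), G x α β = G x β α
  nondegenerate : ∀ (x : Q) (α : Cotangent n x), (∀ β : Cotangent n x, G x α β = 0) → α = 0

/-- The covariant components `g_{ij}` of the metric: the inverse matrix of `(g^{ij})`. -/
def compDown (q : OpenPartialHomeomorph Q (Coord n)) (G : TensorField n Q) (y : Coord n) :
    Matrix (Fin n) (Fin n) ℝ :=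
  (comp q G y)⁻¹

/-- The Christoffel symbols `Γ^h_{ij} = ½ g^{hk} (∂ᵢ g_{kj} + ∂ⱼ g_{ki} - ∂ₖ g_{ij})`. -/
def christoffel (q : OpenPartialHomeomorph Q (Coord n)) (G : TensorField n Q) (h i j : Fin n)
    (y : Coord n) : ℝ :=
  (1 / 2) * ∑ k, comp q G y h k *
    (partialD i (fun z => compDown q G z k j) y + partialD j (fun z => compDown q G z k i) y
      - partialD k (fun z => compDown q G z i j) y)

/-- The contracted Christoffel symbols `Γ^h = g^{ij} Γ^h_{ij}`. -/
def contractedChristoffel (q : OpenPartialHomeomorph Q (Coord n)) (G : TensorField n Q)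
    (h : Fin n) (y : Coord n) : ℝ :=
  ∑ i, ∑ j, comp q G y i j * christoffel q G h i j y

/-- The Laplace-Beltrami operator in the coordinates `q`, `Δf = g^{ij} ∂ᵢ∂ⱼ f - Γ^h ∂ₕ f`, applied to
a function `f` of the coordinate values. -/
def laplacian {F : Type*} [NormedAddCommGroup F] [NormedSpace ℝ F]
    (q : OpenPartialHomeomorph Q (Coord n)) (G : TensorField n Q) (f : Coord n → F)
    (y : Coord n) : F :=
  (∑ i, ∑ j, comp q G y i j • partialD i (partialD j f) y)
    - ∑ h, contractedChristoffel q G h y • partialD h f y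

/-- The Schrödinger equation `-(ħ²/2) Δψ + (V - E) ψ = 0` at all points of the coordinate domain, for
a function `ψ` of the coordinate values. -/
def SolvesSchrodinger {𝕜 : Type*} [RCLike 𝕜] (G : TensorField n Q) (V : Q → ℝ) (hbar E : ℝ)
    (q : OpenPartialHomeomorph Q (Coord n)) (ψ : Coord n → 𝕜) : Prop :=
  ∀ y ∈ q.target,
    (-(hbar ^ 2 / 2)) • laplacian q G ψ y + (V (q.symm y) - E) • ψ y = 0

/-- The values taken by the single coordinate `qⁱ` on the coordinate domain. -/
def coordRange (q : OpenPartialHomeomorph Q (Coord n)) (i : Fin n) : Set ℝ :=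
  (fun y : Coord n => y i) '' q.target

/-- For `2n - 1` parameters `c` and one function `φ i t c` for each coordinate (with `t` a value of
`qⁱ`), the matrix with rows `∂uᵢ/∂c_α` (first block) and `∂vᵢ/∂c_α` (second block), where
`uᵢ = φᵢ'/φᵢ` and `vᵢ = φᵢ''/φᵢ`, at the point with coordinates `y`. -/
def completenessMatrix {𝕜 : Type*} [RCLike 𝕜] (φ : Fin n → ℝ → (Fin (2 * n - 1) → ℝ) → 𝕜)
    (y : Coord n) (c : Fin (2 * n - 1) → ℝ) : Matrix (Fin n ⊕ Fin n) (Fin (2 * n - 1)) 𝕜 :=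
  Matrix.of fun a α => match a with
    | Sum.inl i => fderiv ℝ
        (fun c' => deriv (fun t => φ i t c') (y i) / φ i (y i) c') c (Pi.single α 1)
    | Sum.inr i => fderiv ℝ
        (fun c' => deriv (deriv (fun t => φ i t c')) (y i) / φ i (y i) c') c (Pi.single α 1)

/-- The coordinates `q` are FER-separable for the Schrödinger equation, with the fixed value `E` of
the energy and the function `R`: the equation with this `E` has solutions `R ∏ᵢ φᵢ(qⁱ, c)`, with
`c` in a nonempty open set of `ℝ^{2n-1}`, that satisfy the completeness condition
`rank [∂uᵢ/∂c_α ; ∂vᵢ/∂c_α] = 2n - 1`. The factors `φᵢ` may be real (`𝕜 = ℝ`) or complex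
(`𝕜 = ℂ`). -/
structure IsFERSeparableWith (𝕜 : Type*) [RCLike 𝕜] (G : TensorField n Q) (V : Q → ℝ) (hbar : ℝ)
    (q : OpenPartialHomeomorph Q (Coord n)) (E : ℝ) (R : Q → ℝ) : Prop where
  smooth_R : ContDiffOn ℝ ∞ (fun y => R (q.symm y)) q.target
  R_ne_zero : ∀ x ∈ q.source, R x ≠ 0
  complete : ∃ (C : Set (Fin (2 * n - 1) → ℝ)) (φ : Fin n → ℝ → (Fin (2 * n - 1) → ℝ) → 𝕜),
    IsOpen C ∧ C.Nonempty ∧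
    (∀ i, ContDiffOn ℝ ∞ (fun z : ℝ × (Fin (2 * n - 1) → ℝ) => φ i z.1 z.2)
      (coordRange q i ×ˢ C)) ∧
    (∀ i, ∀ t ∈ coordRange q i, ∀ c ∈ C, φ i t c ≠ 0) ∧
    (∀ c ∈ C, SolvesSchrodinger G V hbar E q
      (fun y => R (q.symm y) • ∏ i, φ i (y i) c)) ∧
    (∀ y ∈ q.target, ∀ c ∈ C, (completenessMatrix φ y c).rank = 2 * n - 1)

/-- The function `(2/ħ²) E - U`, where `U = -(ΔR/R - (2/ħ²) V)` is the modified potential, on the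
domain of the coordinates `q`. -/
def modifiedFactor (G : TensorField n Q) (V : Q → ℝ) (hbar : ℝ)
    (q : OpenPartialHomeomorph Q (Coord n)) (E : ℝ) (R : Q → ℝ) (x : Q) : ℝ :=
  2 / hbar ^ 2 * E
    - (-(laplacian q G (fun y => R (q.symm y)) (q x) / R x - 2 / hbar ^ 2 * V x))

/-- A function on `T*Q` in the canonical coordinates `(qⁱ, pᵢ)` associated with the coordinates `q`:
its value at the covector `∑ pᵢ dqⁱ` over the point with coordinates `y`. -/
def inCanonical (q : OpenPartialHomeomorph Q (Coord n)) (A : CotangentFunction n Q)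
    (y p : Coord n) : ℝ :=
  A (q.symm y) (∑ i, p i • coordForm q i (q.symm y))

/-- The Poisson bracket
`{A, B} = ∑ᵢ (∂A/∂pᵢ ∂B/∂qⁱ - ∂A/∂qⁱ ∂B/∂pᵢ)` computed in the canonical coordinates associated with
`q`, at coordinates `(y, p)`. -/
def poissonBracket (q : OpenPartialHomeomorph Q (Coord n)) (A B : CotangentFunction n Q)
    (y p : Coord n) : ℝ :=
  ∑ i, (partialD i (fun p' => inCanonical q A y p') p *
          partialD i (fun y' => inCanonical q B y' p) y
        - partialD i (fun y' => inCanonical q A y' p) y *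
          partialD i (fun p' => inCanonical q B y p') p)

/-- The quadratic polynomial in the momenta `P_K = K^{ij} pᵢ pⱼ`. -/
def momentumPoly (K : TensorField n Q) : CotangentFunction n Q :=
  fun x α => K x α α

/-- `{A, B} = 0` over the open set `U`, in all canonical coordinates of `T*Q`. -/
def PoissonCommuteOn (U : Set Q) (A B : CotangentFunction n Q) : Prop :=
  ∀ q : OpenPartialHomeomorph Q (Coord n), IsCoordinateSystem q →
    ∀ y ∈ q.target, q.symm y ∈ U → ∀ p : Coord n, poissonBracket q A B y p = 0

/-- `K` is a conformal Killing tensor of the metric `G` on the open set `U`: a smooth symmetric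
2-tensor with `{P_K, P_G} = P_X P_G` for a vector field `X`, where `P_X = Xⁱ pᵢ`; equivalently,
`∇_{(i} K_{jk)}` is a symmetrized product of the metric with a 1-form. (The smoothness of
`X` is automatic.) -/
structure IsConformalKillingOn (G : TensorField n Q) (U : Set Q) (K : TensorField n Q) : Prop where
  smooth : IsSmoothOn K U
  symm : ∀ x ∈ U, ∀ α β : Cotangent n x, K x α β = K x β α
  conformal : ∃ X : (x : Q) → TangentSpace (𝓡 n) x,
    ∀ q : OpenPartialHomeomorph Q (Coord n), IsCoordinateSystem q →
      ∀ y ∈ q.target, q.symm y ∈ U → ∀ p : Coord n,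
        poissonBracket q (momentumPoly K) (momentumPoly G) y p =
          inCanonical q (fun x α => α (X x)) y p * inCanonical q (momentumPoly G) y p

/-- `v` is an eigenvector of the tensor `K` with respect to the metric `G` at `x`, that is an
eigenvector of the endomorphism `Kⁱⱼ = K^{ik} g_{kj}`: if `α` is the 1-form with
`v = G(α, ·)`, then `K(α, ·) = l v`. -/
def IsEigenvectorAt (G K : TensorField n Q) (x : Q) (v : TangentSpace (𝓡 n) x) : Prop :=
  v ≠ 0 ∧ ∃ (α : Cotangent n x) (l : ℝ),
    (∀ β : Cotangent n x, G x α β = β v) ∧ ∀ β : Cotangent n x, K x α β = l * β v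

/-- `b = (∂/∂q¹, …, ∂/∂qⁿ)` is the coordinate basis of `TₓQ`: the basis dual to the `dqⁱ`. -/
def IsCoordBasis (q : OpenPartialHomeomorph Q (Coord n)) (x : Q)
    (b : Module.Basis (Fin n) ℝ (TangentSpace (𝓡 n) x)) : Prop :=
  ∀ i j : Fin n, coordForm q i x (b j) = if i = j then 1 else 0

/-- The `n` tensors `K₁, …, K_{n-1}, T`; the last one has the index `none`. -/
def extendFamily (K : Fin (n - 1) → TensorField n Q) (T : TensorField n Q) :
    Option (Fin (n - 1)) → TensorField n Q
  | some h => K h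
  | none => T

end Manifold

end FER

end

/-! Put h_i = 2 g^{ij} ∂_j R / R − Γ^i and w = (2/ħ²)E − 𝒰. Dividing the Schrödinger equation by ψ
turns it into F = 0, where F = ∑ g^{ii} v_i + ∑_{i≠j} g^{ij} u_i u_j + ∑ h_i u_i + w (`sepForm`),
with u_i' = v_i − u_i². Completeness says that, at each point of the domain, the values (u, v)(c)
sweep out to first order a full hypersurface of F = 0: the differential of any other function that
vanishes on them is proportional to that of F (`fderiv_apply_eq_zero_of_rank`).

Differentiating F = 0 along q^k and q^l with k ≠ l and eliminating v_k' and v_l' gives a second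
polynomial relation in u and v (`compatForm_eq_zero`). If F is constant along a direction in which
this relation is quadratic, the quadratic coefficient must vanish (`quadratic_coeff_eq_zero`). Two
choices of direction give g^{kl} = 0, and then that h_k / g^{kk} depends on q^k alone.

Hence differentiating F = 0 in the parameters produces rows s_i = ∂v_i/∂c_α + (h_i/g^{ii}) ∂u_i/∂c_α
whose i-th entry depends on q^i only and which satisfy ∑ g^{ii} s_i = 0; by the rank condition they
span the annihilator of (g^{ii}) (`isStaeckelFamily`). Such a row solves a closed linear first-order
system, so n − 1 rows that are independent at one point stay independent on its connected component.

Adjoining one more row θ of the same type with σ = ∑ g^{ii} θ_i ≠ 0 gives an invertible Stäckel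
matrix S. Since ∂_k S has only its k-th row non-zero, the rows of S⁻¹ are the components of diagonal
tensors in involution, and one of them is G/σ (`exists_involutive_family`). Involution with G/σ
makes the others conformal Killing tensors of G. The equation F = 0 at a fixed c supplies a θ with σ
= w; if w has a zero, a constant row with σ = g^{11} serves instead. -/

noncomputable section

namespace FER

/-! ### Calculus of partial derivatives on coordinate space. -/

section PartialDerivatives

variable {n : ℕ} {F : Type*} [NormedAddCommGroup F] [NormedSpace ℝ F]

/-- `f` is differentiable at `y` and its `k`-th partial derivative there is `f'`. -/
def HasPartialAt (k : Fin n) (f : Coord n → F) (f' : F) (y : Coord n) : Prop :=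
  DifferentiableAt ℝ f y ∧ partialD k f y = f'

theorem hasPartialAt_partialD {k : Fin n} {f : Coord n → F} {y : Coord n}
    (hf : DifferentiableAt ℝ f y) : HasPartialAt k f (partialD k f y) y :=
  ⟨hf, rfl⟩

theorem HasPartialAt.congr_deriv {k : Fin n} {f : Coord n → F} {a b : F} {y : Coord n}
    (hf : HasPartialAt k f a y) (h : a = b) : HasPartialAt k f b y :=
  h ▸ hf

theorem partialD_congr {k : Fin n} {f g : Coord n → F} {y : Coord n} (h : f =ᶠ[nhds y] g) :
    partialD k f y = partialD k g y := by
  unfold partialD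
  rw [h.fderiv_eq]

theorem partialD_congr_of_eqOn {k : Fin n} {f g : Coord n → F} {Ω : Set (Coord n)}
    (hΩ : IsOpen Ω) (h : Set.EqOn f g Ω) {y : Coord n} (hy : y ∈ Ω) :
    partialD k f y = partialD k g y :=
  partialD_congr (h.eventuallyEq_of_mem (hΩ.mem_nhds hy))

theorem partialD_const (k : Fin n) (a : F) (y : Coord n) : partialD k (fun _ => a) y = 0 := by
  simp [partialD]

theorem hasPartialAt_const (k : Fin n) (a : F) (y : Coord n) :
    HasPartialAt k (fun _ => a) 0 y :=
  ⟨differentiableAt_const _, partialD_const k a y⟩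

theorem HasPartialAt.add {k : Fin n} {f g : Coord n → F} {a b : F} {y : Coord n}
    (hf : HasPartialAt k f a y) (hg : HasPartialAt k g b y) :
    HasPartialAt k (fun y => f y + g y) (a + b) y :=
  ⟨hf.1.add hg.1, by
    unfold partialD; rw [fderiv_fun_add hf.1 hg.1, ← hf.2, ← hg.2]; rfl⟩

theorem HasPartialAt.neg {k : Fin n} {f : Coord n → F} {a : F} {y : Coord n}
    (hf : HasPartialAt k f a y) : HasPartialAt k (fun y => -f y) (-a) y :=
  ⟨hf.1.neg, by unfold partialD; rw [fderiv_fun_neg, ← hf.2]; rfl⟩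

theorem HasPartialAt.sum {ι : Type*} {s : Finset ι} {k : Fin n} {f : ι → Coord n → F} {a : ι → F}
    {y : Coord n} (hf : ∀ i ∈ s, HasPartialAt k (f i) (a i) y) :
    HasPartialAt k (fun y => ∑ i ∈ s, f i y) (∑ i ∈ s, a i) y :=
  ⟨DifferentiableAt.fun_sum fun i hi => (hf i hi).1, by
    unfold partialD
    rw [fderiv_fun_sum fun i hi => (hf i hi).1, sum_apply]
    exact Finset.sum_congr rfl fun i hi => (hf i hi).2⟩

theorem HasPartialAt.mul {A : Type*} [NormedCommRing A] [NormedAlgebra ℝ A] {k : Fin n}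
    {f g : Coord n → A} {a b : A} {y : Coord n}
    (hf : HasPartialAt k f a y) (hg : HasPartialAt k g b y) :
    HasPartialAt k (fun y => f y * g y) (a * g y + f y * b) y :=
  ⟨hf.1.mul hg.1, by
    unfold partialD; rw [fderiv_fun_mul hf.1 hg.1, ← hf.2, ← hg.2]
    simp [partialD, mul_comm, add_comm]⟩

theorem HasPartialAt.smul {k : Fin n} {f : Coord n → ℝ} {g : Coord n → F} {a : ℝ} {b : F}
    {y : Coord n} (hf : HasPartialAt k f a y) (hg : HasPartialAt k g b y) :
    HasPartialAt k (fun y => f y • g y) (a • g y + f y • b) y :=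
  ⟨hf.1.smul hg.1, by
    unfold partialD; rw [fderiv_fun_smul hf.1 hg.1, ← hf.2, ← hg.2]
    simp [partialD, add_comm]⟩

theorem HasPartialAt.clm {F' : Type*} [NormedAddCommGroup F'] [NormedSpace ℝ F'] {k : Fin n}
    {f : Coord n → F} {a : F} {y : Coord n} (L : F →L[ℝ] F') (hf : HasPartialAt k f a y) :
    HasPartialAt k (fun y => L (f y)) (L a) y :=
  ⟨L.differentiableAt.comp y hf.1, by
    have h : HasFDerivAt (fun y => L (f y)) (L.comp (fderiv ℝ f y)) y :=
      L.hasFDerivAt.comp y hf.1.hasFDerivAt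
    unfold partialD; rw [h.fderiv, ← hf.2]; rfl⟩

theorem hasPartialAt_coord {f : ℝ → F} {f' : F} {y : Coord n} (k j : Fin n)
    (hf : HasDerivAt f f' (y j)) :
    HasPartialAt k (fun y => f (y j)) (if j = k then f' else 0) y := by
  have h : HasFDerivAt (fun y : Coord n => f (y j)) _ y :=
    hf.hasFDerivAt.comp y (EuclideanSpace.proj (𝕜 := ℝ) j).hasFDerivAt
  refine ⟨h.differentiableAt, ?_⟩
  unfold partialD
  rw [h.fderiv]
  by_cases hjk : j = k <;> simp [hjk]

theorem fderiv_apply_eq_sum_partialD (f : Coord n → F) (y v : Coord n) :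
    fderiv ℝ f y v = ∑ k, v k • partialD k f y := by
  conv_lhs => rw [← (EuclideanSpace.basisFun (Fin n) ℝ).sum_repr v]
  simp [partialD]

theorem contDiffOn_partialD {f : Coord n → F} {Ω : Set (Coord n)} (hΩ : IsOpen Ω)
    (hf : ContDiffOn ℝ ∞ f Ω) (k : Fin n) : ContDiffOn ℝ ∞ (partialD k f) Ω :=
  (hf.fderiv_of_isOpen hΩ (by simp)).clm_apply contDiffOn_const

theorem partialD_comm {f : Coord n → F} {Ω : Set (Coord n)} (hΩ : IsOpen Ω)
    (hf : ContDiffOn ℝ ∞ f Ω) (k l : Fin n) {y : Coord n} (hy : y ∈ Ω) :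
    partialD k (partialD l f) y = partialD l (partialD k f) y := by
  have hd : DifferentiableAt ℝ (fderiv ℝ f) y :=
    ((hf.fderiv_of_isOpen (m := ∞) hΩ (by simp)).contDiffAt (hΩ.mem_nhds hy)).differentiableAt
      (by simp)
  have hs : IsSymmSndFDerivAt ℝ f y :=
    (hf.contDiffAt (hΩ.mem_nhds hy)).isSymmSndFDerivAt (by
      simp only [minSmoothness_of_isRCLikeNormedField]
      exact WithTop.coe_le_coe.2 (le_top : (2 : ℕ∞) ≤ ⊤))
  have key : ∀ a b : Fin n, partialD a (partialD b f) y =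
      fderiv ℝ (fderiv ℝ f) y (EuclideanSpace.single a 1) (EuclideanSpace.single b 1) := by
    intro a b
    have h := (hd.hasFDerivAt.clm_apply
      (hasFDerivAt_const (EuclideanSpace.single b (1 : ℝ)) y)).fderiv
    have h2 : partialD b f = fun y => (fderiv ℝ f y) (EuclideanSpace.single b 1) := rfl
    rw [h2]
    unfold partialD
    rw [h]
    simp
  rw [key, key, hs]

theorem differentiableAt_of_contDiffOn {E' : Type*} [NormedAddCommGroup E'] [NormedSpace ℝ E']
    {f : E' → F} {Ω : Set E'} (hΩ : IsOpen Ω) (hf : ContDiffOn ℝ ∞ f Ω) {y : E'} (hy : y ∈ Ω) :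
    DifferentiableAt ℝ f y :=
  (hf.contDiffAt (hΩ.mem_nhds hy)).differentiableAt (by simp)

end PartialDerivatives

/-! ### Linear algebra: smooth inverses and one-dimensional left kernels. -/

section MatrixSmoothness

variable {E : Type*} [NormedAddCommGroup E] [NormedSpace ℝ E] {m : Type*} [Fintype m]
  [DecidableEq m]

theorem contDiffOn_det {M : E → Matrix m m ℝ} {Ω : Set E}
    (hM : ∀ i j, ContDiffOn ℝ ∞ (fun y => M y i j) Ω) :
    ContDiffOn ℝ ∞ (fun y => (M y).det) Ω := by
  simp only [Matrix.det_apply]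
  exact ContDiffOn.sum fun σ _ => (contDiffOn_prod fun i _ => hM _ _).const_smul _

theorem contDiffOn_inv_apply {M : E → Matrix m m ℝ} {Ω : Set E}
    (hM : ∀ i j, ContDiffOn ℝ ∞ (fun y => M y i j) Ω) (hdet : ∀ y ∈ Ω, (M y).det ≠ 0) (i j : m) :
    ContDiffOn ℝ ∞ (fun y => (M y)⁻¹ i j) Ω := by
  simp only [Matrix.inv_def, Matrix.smul_apply, Ring.inverse_eq_inv', smul_eq_mul,
    Matrix.adjugate_apply]
  refine ((contDiffOn_det hM).inv hdet).mul (contDiffOn_det fun a b => ?_)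
  by_cases h : a = j
  · subst h
    simpa using contDiffOn_const
  · simpa [Matrix.updateRow_ne h] using hM a b

end MatrixSmoothness

section LeftKernel

variable {K : Type*} [Field K] {ι κ : Type*} [Fintype ι] [Fintype κ]

/-- Rank one less than the number of rows leaves a left kernel of dimension one. This is how the
completeness condition is used throughout. -/
theorem exists_smul_eq_of_vecMul_eq_zero (M : Matrix ι κ K) (hM : M.rank + 1 = Fintype.card ι)
    {a b : ι → K} (ha : Matrix.vecMul a M = 0) (hb : Matrix.vecMul b M = 0) (hb0 : b ≠ 0) :
    ∃ t : K, a = t • b := by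
  classical
  have hr := M.vecMulLinear.finrank_range_add_finrank_ker
  have h1 : Module.finrank K (LinearMap.range M.vecMulLinear) = M.rank := by
    rw [← Matrix.rank_transpose, Matrix.rank, Matrix.mulVecLin_transpose]
  rw [h1, Module.finrank_fintype_fun_eq_card, ← hM] at hr
  have hk : Module.finrank K (LinearMap.ker M.vecMulLinear) = 1 := by omega
  obtain ⟨t, ht⟩ := (finrank_eq_one_iff_of_nonzero' (⟨b, by simpa using hb⟩ :
    LinearMap.ker M.vecMulLinear) (by simpa using hb0)).1 hk ⟨a, by simpa using ha⟩
  exact ⟨t, by simpa using (congrArg Subtype.val ht).symm⟩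

end LeftKernel

end FER

namespace FER

/-! ### Functions vanishing on a parametrized hypersurface. -/

section IdealDerivative

variable {𝕜 : Type*} [RCLike 𝕜] {ι : Type*} [Fintype ι] {N : ℕ}

/-- The Jacobian matrix of a function of real parameters with values in `𝕜^ι`. -/
def paramJacobian (X : (Fin N → ℝ) → ι → 𝕜) (c : Fin N → ℝ) : Matrix ι (Fin N) 𝕜 :=
  Matrix.of fun a α => fderiv ℝ (fun c' => X c' a) c (Pi.single α 1)

/-- Chain rule for the function Φ ∘ X, which is zero on the open set `C`. The parameters are real
while Φ is differentiable over `𝕜`, hence the restriction of scalars. -/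
theorem vecMul_paramJacobian_eq_zero [DecidableEq ι] {X : (Fin N → ℝ) → ι → 𝕜} {C : Set (Fin N → ℝ)}
    (hC : IsOpen C) {c : Fin N → ℝ} (hc : c ∈ C) (hX : DifferentiableAt ℝ X c)
    {Φ : (ι → 𝕜) → 𝕜} (hΦ : DifferentiableAt 𝕜 Φ (X c)) (h0 : ∀ c ∈ C, Φ (X c) = 0) :
    Matrix.vecMul (fun a => fderiv 𝕜 Φ (X c) (Pi.single a 1)) (paramJacobian X c) = 0 := by
  ext α
  have h1 : HasFDerivAt (fun c => Φ (X c))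
      (((fderiv 𝕜 Φ (X c)).restrictScalars ℝ).comp (fderiv ℝ X c)) c :=
    (hΦ.hasFDerivAt.restrictScalars ℝ).comp c hX.hasFDerivAt
  have h2 : (fun c => Φ (X c)) =ᶠ[nhds c] fun _ => 0 :=
    Filter.eventually_of_mem (hC.mem_nhds hc) h0
  have h3 : fderiv 𝕜 Φ (X c) (fderiv ℝ X c (Pi.single α 1)) = 0 := by
    have h4 : fderiv ℝ (fun c => Φ (X c)) c = 0 := by
      rw [h2.fderiv_eq]; simp
    rw [h1.fderiv] at h4
    simpa using congrArg (fun L => L (Pi.single α 1)) h4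
  have h5 : ∀ a, fderiv ℝ X c (Pi.single α 1) a = paramJacobian X c a α := by
    intro a
    have := (hasFDerivAt_pi'.1 hX.hasFDerivAt a).fderiv
    simp [paramJacobian, this]
  rw [pi_eq_sum_univ' (fderiv ℝ X c (Pi.single α 1))] at h3
  simp only [map_sum, map_smul, smul_eq_mul, h5] at h3
  simp only [Matrix.vecMul, dotProduct, Pi.zero_apply]
  rw [← h3]
  exact Finset.sum_congr rfl fun a _ => by
    rw [mul_comm]

/-- If a parametrized set of codimension one satisfies `Φ = 0` and `F = 0`, then the derivative of
`Φ` vanishes in the directions in which the derivative of `F` does. -/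
theorem fderiv_apply_eq_zero_of_rank {X : (Fin N → ℝ) → ι → 𝕜} {C : Set (Fin N → ℝ)}
    (hC : IsOpen C) {c : Fin N → ℝ} (hc : c ∈ C) (hX : DifferentiableAt ℝ X c)
    (hrank : (paramJacobian X c).rank + 1 = Fintype.card ι)
    {Φ F : (ι → 𝕜) → 𝕜} (hΦ : DifferentiableAt 𝕜 Φ (X c)) (h0 : ∀ c ∈ C, Φ (X c) = 0)
    (hF : DifferentiableAt 𝕜 F (X c)) (hF0 : ∀ c ∈ C, F (X c) = 0)
    (hdF : fderiv 𝕜 F (X c) ≠ 0) {e : ι → 𝕜} (he : fderiv 𝕜 F (X c) e = 0) :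
    fderiv 𝕜 Φ (X c) e = 0 := by
  classical
  have expand : ∀ L : (ι → 𝕜) →L[𝕜] 𝕜, ∀ w : ι → 𝕜, L w = ∑ a, w a * L (Pi.single a 1) := by
    intro L w
    conv_lhs => rw [pi_eq_sum_univ' w]
    simp only [map_sum, map_smul, smul_eq_mul]
  -- Both differentials lie in the left kernel of the Jacobian, which is a line, so that of Φ is a
  -- multiple of that of F.
  obtain ⟨t, ht⟩ := exists_smul_eq_of_vecMul_eq_zero _ hrank
    (vecMul_paramJacobian_eq_zero hC hc hX hΦ h0) (vecMul_paramJacobian_eq_zero hC hc hX hF hF0)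
    (fun h => hdF (by
      ext w
      rw [expand]
      simp [fun a => congrFun h a]))
  rw [expand] at he ⊢
  have : ∀ a, fderiv 𝕜 Φ (X c) (Pi.single a 1) = t * fderiv 𝕜 F (X c) (Pi.single a 1) :=
    fun a => congrFun ht a
  simp only [this, mul_left_comm _ t, ← Finset.mul_sum, he, mul_zero]

theorem fderiv_apply_of_quadratic {f : (ι → 𝕜) → 𝕜} (hf : Differentiable 𝕜 f) {x e : ι → 𝕜}
    {a b : 𝕜} (h : ∀ s : 𝕜, f (x + s • e) = f x + s * a + s ^ 2 * b) : fderiv 𝕜 f x e = a := by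
  have h1 : HasDerivAt (fun s : 𝕜 => f (x + s • e)) (fderiv 𝕜 f x e) 0 := by
    have h2 : HasDerivAt (fun s : 𝕜 => x + s • e) e 0 := by
      simpa using ((hasDerivAt_id (0 : 𝕜)).smul_const e).const_add x
    have h3 : HasDerivAt (fun s : 𝕜 => f (x + s • e)) (fderiv 𝕜 f (x + (0 : 𝕜) • e) e) 0 :=
      (hf (x + (0 : 𝕜) • e)).hasFDerivAt.comp_hasDerivAt (0 : 𝕜) h2
    exact h3.congr_deriv (by rw [zero_smul, add_zero])
  have h2 : HasDerivAt (fun s : 𝕜 => f x + s * a + s ^ 2 * b) a 0 := by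
    have h3 : HasDerivAt (fun s : 𝕜 => f x + s * a + s ^ 2 * b) _ 0 :=
      (((hasDerivAt_id (0 : 𝕜)).mul_const a).const_add (f x)).add
        (((hasDerivAt_id (0 : 𝕜)).pow 2).mul_const b)
    exact h3.congr_deriv (by simp)
  simp only [h] at h1
  exact h1.unique h2

/-- A function that vanishes on a parametrized set of codimension one and is quadratic along a
direction tangent to this set has no quadratic term. -/
theorem quadratic_coeff_eq_zero {X : (Fin N → ℝ) → ι → 𝕜} {C : Set (Fin N → ℝ)}
    (hC : IsOpen C) (hne : C.Nonempty) (hX : ∀ c ∈ C, DifferentiableAt ℝ X c)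
    (hrank : ∀ c ∈ C, (paramJacobian X c).rank + 1 = Fintype.card ι)
    {Φ F Ψ : (ι → 𝕜) → 𝕜} {κ : 𝕜} {e : ι → 𝕜}
    (hΦ : Differentiable 𝕜 Φ) (h0 : ∀ c ∈ C, Φ (X c) = 0)
    (hF : Differentiable 𝕜 F) (hF0 : ∀ c ∈ C, F (X c) = 0)
    (hdF : ∀ c ∈ C, fderiv 𝕜 F (X c) ≠ 0) (he : ∀ x, ∀ s : 𝕜, F (x + s • e) = F x)
    (hquad : ∀ x, ∀ s : 𝕜, Φ (x + s • e) = Φ x + s * Ψ x + s ^ 2 * κ) : κ = 0 := by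
  have hFe : ∀ x, fderiv 𝕜 F x e = 0 := fun x => fderiv_apply_of_quadratic hF (b := 0) (by simp [he])
  -- Expressing Ψ by values of Φ shows that Ψ is differentiable, which is not assumed.
  have hΨe : ∀ x, Ψ x = Φ (x + e) - Φ x - κ := by
    intro x
    have := hquad x 1
    simp only [one_smul] at this
    rw [this]; ring
  have hΨd : Differentiable 𝕜 Ψ := by
    rw [show Ψ = fun x => Φ (x + e) - Φ x - κ from funext hΨe]
    fun_prop
  -- Ψ is the derivative of Φ along the tangent direction `e`, so it vanishes on the same set as Φ
  -- and the argument can be repeated with Ψ in place of Φ.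
  have hΨ0 : ∀ c ∈ C, Ψ (X c) = 0 := fun c hc => by
    rw [← fderiv_apply_of_quadratic hΦ (hquad _)]
    exact fderiv_apply_eq_zero_of_rank hC hc (hX c hc) (hrank c hc) (hΦ _) h0 (hF _) hF0
      (hdF c hc) (hFe _)
  -- Along `e`, Ψ is affine with slope 2κ; the second application of the tangency argument kills
  -- this slope.
  have hΨline : ∀ x, ∀ s : 𝕜, Ψ (x + s • e) = Ψ x + s * (2 * κ) + s ^ 2 * 0 := by
    intro x s
    have h1 := hquad x (s + 1)
    have h2 := hquad x s
    have h3 := hΨe (x + s • e)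
    rw [show x + s • e + e = x + (s + 1) • e by rw [add_smul, one_smul, add_assoc], h1, h2] at h3
    rw [h3]; ring
  obtain ⟨c, hc⟩ := hne
  have h2 := fderiv_apply_eq_zero_of_rank hC hc (hX c hc) (hrank c hc) (hΨd _) hΨ0 (hF _) hF0
      (hdF c hc) (hFe _)
  rw [fderiv_apply_of_quadratic hΨd (hΨline _)] at h2
  simpa using h2

end IdealDerivative

/-! ### The separated equation as a polynomial in u and v, and its coordinate derivatives. -/

section SeparationForm

variable {n : ℕ} {𝕜 : Type*} [RCLike 𝕜]

/-- The expression `∑ mᵢᵢ vᵢ + ∑_{i ≠ j} mᵢⱼ uᵢ uⱼ + ∑ hᵢ uᵢ + w`. -/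
def sepForm (m : Fin n → Fin n → 𝕜) (h : Fin n → 𝕜) (w : 𝕜) (u v : Fin n → 𝕜) : 𝕜 :=
  ∑ i, ∑ j, m i j * (if i = j then v i else u i * u j) + ∑ i, h i * u i + w

/-- The derivative of `sepForm` with respect to `uₖ`. -/
def sepSlope (k : Fin n) (m : Fin n → Fin n → 𝕜) (h : Fin n → 𝕜) (u : Fin n → 𝕜) : 𝕜 :=
  2 * ∑ j, (if j = k then 0 else m k j * u j) + h k

/-- Only the terms with i = k or j = k survive, and the symmetry of `m` makes the two off-diagonal
families equal, whence the factor 2. -/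
theorem sum_sum_deriv_sepForm (m : Fin n → Fin n → 𝕜) (hm : ∀ i j, m i j = m j i) (k : Fin n)
    (u : Fin n → 𝕜) (u' v' : Fin n → 𝕜) :
    ∑ i, ∑ j, m i j * (if i = j then (if i = k then v' i else 0)
      else (if i = k then u' i else 0) * u j + u i * (if j = k then u' j else 0)) =
    m k k * v' k + u' k * (2 * ∑ j, (if j = k then 0 else m k j * u j)) := by
  have key : ∀ i j, m i j * (if i = j then (if i = k then v' i else 0)
      else (if i = k then u' i else 0) * u j + u i * (if j = k then u' j else 0)) =
      (if i = k then (if j = k then m k k * v' k else 0) else 0) +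
      (if i = k then u' k * (if j = k then 0 else m k j * u j) else 0) +
      (if j = k then u' k * (if i = k then 0 else m k i * u i) else 0) := by
    intro i j
    by_cases hi : i = k <;> by_cases hj : j = k
    · subst hi; subst hj; simp
    · subst hi; simp [Ne.symm hj, hj]; ring
    · subst hj; simp [hi, hm i j]; ring
    · simp [hi, hj]
  simp only [key, Finset.sum_add_distrib, Finset.sum_ite_eq', Finset.mem_univ, if_true,
    ← Finset.mul_sum]
  have : ∀ i : Fin n, ∑ j : Fin n, (if i = k then (if j = k then m k k * v' k else 0) else 0) =
      if i = k then m k k * v' k else 0 := by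
    intro i; split_ifs <;> simp
  have h2 : ∀ i : Fin n, ∑ j : Fin n, (if i = k then u' k * (if j = k then 0 else m k j * u j)
      else 0) = if i = k then u' k * ∑ j, (if j = k then 0 else m k j * u j) else 0 := by
    intro i; split_ifs <;> simp [Finset.mul_sum]
  simp only [this, h2, Finset.sum_ite_eq', Finset.mem_univ, if_true]
  ring

/-- Leibniz rule: the coefficients contribute a `sepForm` with differentiated coefficients. Among
the arguments only u_k and v_k vary with the k-th coordinate. -/
theorem hasPartialAt_sepForm {m : Fin n → Fin n → Coord n → 𝕜} {h : Fin n → Coord n → 𝕜}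
    {w : Coord n → 𝕜} {u v : Fin n → ℝ → 𝕜} {y : Coord n} (k : Fin n)
    (hm : ∀ i j, DifferentiableAt ℝ (m i j) y) (hh : ∀ i, DifferentiableAt ℝ (h i) y)
    (hw : DifferentiableAt ℝ w y) (hu : ∀ i, DifferentiableAt ℝ (u i) (y i))
    (hv : ∀ i, DifferentiableAt ℝ (v i) (y i)) (hsymm : ∀ i j, m i j y = m j i y) :
    HasPartialAt k (fun y => sepForm (fun i j => m i j y) (fun i => h i y) (w y)
        (fun i => u i (y i)) (fun i => v i (y i)))
      (sepForm (fun i j => partialD k (m i j) y) (fun i => partialD k (h i) y) (partialD k w y)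
        (fun i => u i (y i)) (fun i => v i (y i)) + (m k k y * deriv (v k) (y k) +
      deriv (u k) (y k) *
        sepSlope k (fun i j => m i j y) (fun i => h i y) (fun i => u i (y i)))) y := by
  have hU : ∀ i j, HasPartialAt k (fun y => if i = j then v i (y i) else u i (y i) * u j (y j))
      (if i = j then (if i = k then deriv (v i) (y i) else 0)
      else (if i = k then deriv (u i) (y i) else 0) * u j (y j) +
        u i (y i) * (if j = k then deriv (u j) (y j) else 0)) y := by
    intro i j
    by_cases hij : i = j
    · simpa [hij] using hasPartialAt_coord k j (hv j).hasDerivAt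
    · simpa [hij] using (hasPartialAt_coord k i (hu i).hasDerivAt).mul
        (hasPartialAt_coord k j (hu j).hasDerivAt)
  have h1 := ((HasPartialAt.sum (s := Finset.univ) fun i _ => HasPartialAt.sum (s := Finset.univ)
    fun j _ => (hasPartialAt_partialD (k := k) (hm i j)).mul (hU i j)).add
    (HasPartialAt.sum (s := Finset.univ) fun i _ => (hasPartialAt_partialD (k := k) (hh i)).mul
      (hasPartialAt_coord k i (hu i).hasDerivAt))).add (hasPartialAt_partialD (k := k) hw)
  refine h1.congr_deriv ?_
  simp only [Finset.sum_add_distrib, sum_sum_deriv_sepForm (fun i j => m i j y) hsymm k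
    (fun i => u i (y i)) (fun i => deriv (u i) (y i)) (fun i => deriv (v i) (y i))]
  simp only [sepForm, sepSlope, mul_ite, mul_zero, Finset.sum_ite_eq', Finset.mem_univ, if_true]
  ring

/-- For k ≠ l the only argument that moves is u_l. The resulting term in m_{kl} is what later makes
the off-diagonal coefficient visible. -/
theorem hasPartialAt_sepSlope {m : Fin n → Fin n → Coord n → 𝕜} {h : Fin n → Coord n → 𝕜}
    {u : Fin n → ℝ → 𝕜} {y : Coord n} {k l : Fin n} (hkl : k ≠ l)
    (hm : ∀ i j, DifferentiableAt ℝ (m i j) y) (hh : ∀ i, DifferentiableAt ℝ (h i) y)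
    (hu : ∀ i, DifferentiableAt ℝ (u i) (y i)) :
    HasPartialAt l (fun y => sepSlope k (fun i j => m i j y) (fun i => h i y)
        (fun i => u i (y i)))
      (sepSlope k (fun i j => partialD l (m i j) y) (fun i => partialD l (h i) y)
        (fun i => u i (y i)) + 2 * (m k l y * deriv (u l) (y l))) y := by
  have hU : ∀ j, HasPartialAt l (fun y => if j = k then 0 else m k j y * u j (y j))
      ((if j = k then 0 else partialD l (m k j) y * u j (y j)) +
        (if j = l then m k l y * deriv (u l) (y l) else 0)) y := by
    intro j
    by_cases hj : j = k
    · subst hj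
      simpa [hkl] using hasPartialAt_const l (0 : 𝕜) y
    · refine HasPartialAt.congr_deriv (a := partialD l (m k j) y * u j (y j) +
        m k j y * (if j = l then deriv (u j) (y j) else 0)) ?_ ?_
      · simpa [hj] using (hasPartialAt_partialD (k := l) (hm k j)).mul
          (hasPartialAt_coord l j (hu j).hasDerivAt)
      · by_cases hjl : j = l
        · subst hjl; simp [hj]
        · simp [hj, hjl]
  have h1 := ((hasPartialAt_const l (2 : 𝕜) y).mul
    (HasPartialAt.sum (s := Finset.univ) fun j _ => hU j)).add (hasPartialAt_partialD (k := l) (hh k))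
  refine h1.congr_deriv ?_
  simp only [sepSlope, Finset.sum_add_distrib, Finset.sum_ite_eq', Finset.mem_univ, if_true]
  ring

end SeparationForm

end FER

/-! ### Integrability conditions: orthogonality and the first-order coefficients. -/

namespace FER

variable {n N : ℕ} {𝕜 : Type*} [RCLike 𝕜]

/-- A complete family of separated solutions `u`, `v` (with `∂u = v - u²`) of the equation
`sepForm m h w u v = 0` on the open set `Ω`. -/
structure IsCompleteSeparation (Ω : Set (Coord n)) (T : Fin n → Set ℝ) (C : Set (Fin N → ℝ))
    (m : Fin n → Fin n → Coord n → 𝕜) (h : Fin n → Coord n → 𝕜) (w : Coord n → 𝕜)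
    (u v : Fin n → ℝ → (Fin N → ℝ) → 𝕜) : Prop where
  isOpen : IsOpen Ω
  isOpen_coord : ∀ i, IsOpen (T i)
  coord_mem : ∀ y ∈ Ω, ∀ i, y i ∈ T i
  isOpen_param : IsOpen C
  param_nonempty : C.Nonempty
  smooth_m : ∀ i j, ContDiffOn ℝ ∞ (m i j) Ω
  smooth_h : ∀ i, ContDiffOn ℝ ∞ (h i) Ω
  smooth_w : ContDiffOn ℝ ∞ w Ω
  symm : ∀ y ∈ Ω, ∀ i j, m i j y = m j i y
  diag_ne_zero : ∀ y ∈ Ω, ∀ i, m i i y ≠ 0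
  smooth_u : ∀ i, ContDiffOn ℝ ∞ (fun z : ℝ × (Fin N → ℝ) => u i z.1 z.2) (T i ×ˢ C)
  smooth_v : ∀ i, ContDiffOn ℝ ∞ (fun z : ℝ × (Fin N → ℝ) => v i z.1 z.2) (T i ×ˢ C)
  deriv_u : ∀ i, ∀ t ∈ T i, ∀ c ∈ C, deriv (fun t => u i t c) t = v i t c - u i t c ^ 2
  eq_zero : ∀ y ∈ Ω, ∀ c ∈ C, sepForm (fun i j => m i j y) (fun i => h i y) (w y)
    (fun i => u i (y i) c) (fun i => v i (y i) c) = 0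
  rank : ∀ y ∈ Ω, ∀ c ∈ C, (paramJacobian
    (fun c => Sum.elim (fun i => u i (y i) c) (fun i => v i (y i) c)) c).rank + 1 = n + n

theorem contDiffOn_slice_left {f : ℝ → (Fin N → ℝ) → 𝕜} {T : Set ℝ} {C : Set (Fin N → ℝ)}
    (hf : ContDiffOn ℝ ∞ (fun z : ℝ × (Fin N → ℝ) => f z.1 z.2) (T ×ˢ C)) {c : Fin N → ℝ}
    (hc : c ∈ C) : ContDiffOn ℝ ∞ (fun t => f t c) T :=
  hf.comp (f := fun t : ℝ => (t, c)) (by fun_prop) fun _ ht => ⟨ht, hc⟩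

theorem contDiffOn_slice_right {f : ℝ → (Fin N → ℝ) → 𝕜} {T : Set ℝ} {C : Set (Fin N → ℝ)}
    (hf : ContDiffOn ℝ ∞ (fun z : ℝ × (Fin N → ℝ) => f z.1 z.2) (T ×ˢ C)) {t : ℝ}
    (ht : t ∈ T) : ContDiffOn ℝ ∞ (fun c => f t c) C :=
  hf.comp (f := fun c : Fin N → ℝ => (t, c)) (by fun_prop) fun _ hc => ⟨ht, hc⟩

section FormAlgebra

theorem differentiable_sepForm (m : Fin n → Fin n → 𝕜) (h : Fin n → 𝕜) (w : 𝕜) :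
    Differentiable 𝕜 fun x : Fin n ⊕ Fin n → 𝕜 =>
      sepForm m h w (fun i => x (Sum.inl i)) (fun i => x (Sum.inr i)) := by
  unfold sepForm
  have : ∀ i j, Differentiable 𝕜 fun x : Fin n ⊕ Fin n → 𝕜 =>
      if i = j then x (Sum.inr i) else x (Sum.inl i) * x (Sum.inl j) := by
    intro i j; split_ifs <;> fun_prop
  fun_prop

theorem differentiable_sepSlope (k : Fin n) (m : Fin n → Fin n → 𝕜) (h : Fin n → 𝕜) :
    Differentiable 𝕜 fun x : Fin n ⊕ Fin n → 𝕜 => sepSlope k m h (fun i => x (Sum.inl i)) := by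
  unfold sepSlope
  have : ∀ j, Differentiable 𝕜 fun x : Fin n ⊕ Fin n → 𝕜 =>
      if j = k then 0 else m k j * x (Sum.inl j) := by
    intro j; split_ifs <;> fun_prop
  fun_prop

theorem sepForm_add_second (m : Fin n → Fin n → 𝕜) (h : Fin n → 𝕜) (w : 𝕜) (u v b : Fin n → 𝕜)
    (s : 𝕜) : sepForm m h w u (fun i => v i + s * b i) =
      sepForm m h w u v + s * ∑ i, m i i * b i := by
  have : ∀ i j, m i j * (if i = j then v i + s * b i else u i * u j) =
      m i j * (if i = j then v i else u i * u j) + if i = j then s * (m i i * b i) else 0 := by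
    intro i j
    by_cases hij : i = j
    · subst hij; simp; ring
    · simp [hij]
  simp only [sepForm, this, Finset.sum_add_distrib, Finset.sum_ite_eq, Finset.mem_univ, if_true,
    Finset.mul_sum]
  ring

theorem sepForm_of_diag {m : Fin n → Fin n → 𝕜} (hm : ∀ i j, i ≠ j → m i j = 0) (h : Fin n → 𝕜)
    (w : 𝕜) (u v : Fin n → 𝕜) :
    sepForm m h w u v = ∑ i, m i i * v i + ∑ i, h i * u i + w := by
  have : ∀ i j, m i j * (if i = j then v i else u i * u j) =
      if i = j then m i i * v i else 0 := by
    intro i j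
    by_cases hij : i = j
    · subst hij; simp
    · simp [hij, hm i j hij]
  simp [sepForm, this]

theorem sepForm_add_of_diag {m : Fin n → Fin n → 𝕜} (hm : ∀ i j, i ≠ j → m i j = 0)
    (h : Fin n → 𝕜) (w : 𝕜) (u v a b : Fin n → 𝕜) (s : 𝕜) :
    sepForm m h w (fun i => u i + s * a i) (fun i => v i + s * b i) =
      sepForm m h w u v + s * (∑ i, m i i * b i + ∑ i, h i * a i) := by
  simp only [sepForm_of_diag hm, mul_add, Finset.sum_add_distrib, Finset.mul_sum,
    mul_left_comm _ s]
  ring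

theorem sepSlope_of_diag {m : Fin n → Fin n → 𝕜} (hm : ∀ i j, i ≠ j → m i j = 0) (k : Fin n)
    (h : Fin n → 𝕜) (u : Fin n → 𝕜) : sepSlope k m h u = h k := by
  have : ∀ j, (if j = k then 0 else m k j * u j) = 0 := by
    intro j
    by_cases hjk : j = k
    · simp [hjk]
    · simp [hjk, hm k j (Ne.symm hjk)]
  simp [sepSlope, this]

end FormAlgebra

namespace IsCompleteSeparation

variable {Ω : Set (Coord n)} {T : Fin n → Set ℝ} {C : Set (Fin N → ℝ)}
  {m : Fin n → Fin n → Coord n → 𝕜} {h : Fin n → Coord n → 𝕜} {w : Coord n → 𝕜}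
  {u v : Fin n → ℝ → (Fin N → ℝ) → 𝕜}

/-- The k-th derivative of the identity `eq_zero`, with u_k' replaced by v_k − u_k². The derivative
of v_k remains as an unknown, to be eliminated. -/
theorem first_derivative (H : IsCompleteSeparation Ω T C m h w u v) {y : Coord n} (hy : y ∈ Ω)
    {c : Fin N → ℝ} (hc : c ∈ C) (k : Fin n) :
    sepForm (fun i j => partialD k (m i j) y) (fun i => partialD k (h i) y) (partialD k w y)
        (fun i => u i (y i) c) (fun i => v i (y i) c) +
      (m k k y * deriv (fun t => v k t c) (y k) + (v k (y k) c - u k (y k) c ^ 2) *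
        sepSlope k (fun i j => m i j y) (fun i => h i y) (fun i => u i (y i) c)) = 0 := by
  have h1 := hasPartialAt_sepForm (m := m) (h := h) (w := w) (u := fun i t => u i t c)
    (v := fun i t => v i t c) k
    (fun i j => differentiableAt_of_contDiffOn H.isOpen (H.smooth_m i j) hy)
    (fun i => differentiableAt_of_contDiffOn H.isOpen (H.smooth_h i) hy)
    (differentiableAt_of_contDiffOn H.isOpen H.smooth_w hy)
    (fun i => differentiableAt_of_contDiffOn (H.isOpen_coord i)
      (contDiffOn_slice_left (H.smooth_u i) hc) (H.coord_mem y hy i))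
    (fun i => differentiableAt_of_contDiffOn (H.isOpen_coord i)
      (contDiffOn_slice_left (H.smooth_v i) hc) (H.coord_mem y hy i)) (H.symm y hy)
  have h2 := h1.2
  rw [partialD_congr_of_eqOn H.isOpen (fun y hy => H.eq_zero y hy c hc) hy, partialD_const,
    H.deriv_u k _ (H.coord_mem y hy k) c hc] at h2
  exact h2.symm

/-- Since v_k depends on the k-th coordinate only, a mixed derivative creates no second derivative
of v: the unknowns are still just v_k' and v_l', which the two first derivatives determine. -/
theorem second_derivative (H : IsCompleteSeparation Ω T C m h w u v) {y : Coord n} (hy : y ∈ Ω)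
    {c : Fin N → ℝ} (hc : c ∈ C) {k l : Fin n} (hkl : k ≠ l) :
    sepForm (fun i j => partialD l (partialD k (m i j)) y) (fun i => partialD l (partialD k (h i)) y)
        (partialD l (partialD k w) y) (fun i => u i (y i) c) (fun i => v i (y i) c) +
      (partialD k (m l l) y * deriv (fun t => v l t c) (y l) + (v l (y l) c - u l (y l) c ^ 2) *
        sepSlope l (fun i j => partialD k (m i j) y) (fun i => partialD k (h i) y)
          (fun i => u i (y i) c)) +
      (partialD l (m k k) y * deriv (fun t => v k t c) (y k) + (v k (y k) c - u k (y k) c ^ 2) *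
        (sepSlope k (fun i j => partialD l (m i j) y) (fun i => partialD l (h i) y)
          (fun i => u i (y i) c) + 2 * (m k l y * (v l (y l) c - u l (y l) c ^ 2)))) = 0 := by
  have hdu : ∀ i, DifferentiableAt ℝ (fun t => u i t c) (y i) := fun i =>
    differentiableAt_of_contDiffOn (H.isOpen_coord i)
      (contDiffOn_slice_left (H.smooth_u i) hc) (H.coord_mem y hy i)
  have hdv : ∀ i, DifferentiableAt ℝ (fun t => v i t c) (y i) := fun i =>
    differentiableAt_of_contDiffOn (H.isOpen_coord i)
      (contDiffOn_slice_left (H.smooth_v i) hc) (H.coord_mem y hy i)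
  have hdw : DifferentiableAt ℝ (deriv fun t => v k t c) (y k) :=
    differentiableAt_of_contDiffOn (H.isOpen_coord k)
      ((contDiffOn_slice_left (H.smooth_v k) hc).deriv_of_isOpen (H.isOpen_coord k) (by simp))
      (H.coord_mem y hy k)
  have hdm : ∀ i j, DifferentiableAt ℝ (m i j) y := fun i j =>
    differentiableAt_of_contDiffOn H.isOpen (H.smooth_m i j) hy
  have h1 := hasPartialAt_sepForm (m := fun i j => partialD k (m i j))
    (h := fun i => partialD k (h i)) (w := partialD k w) (u := fun i t => u i t c)
    (v := fun i t => v i t c) l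
    (fun i j => differentiableAt_of_contDiffOn H.isOpen (contDiffOn_partialD H.isOpen (H.smooth_m i j) k) hy)
    (fun i => differentiableAt_of_contDiffOn H.isOpen (contDiffOn_partialD H.isOpen (H.smooth_h i) k) hy)
    (differentiableAt_of_contDiffOn H.isOpen (contDiffOn_partialD H.isOpen H.smooth_w k) hy)
    hdu hdv (fun i j => partialD_congr_of_eqOn H.isOpen (fun y hy => H.symm y hy i j) hy)
  have h2 := (hasPartialAt_partialD (k := l) (hdm k k)).mul (hasPartialAt_coord l k hdw.hasDerivAt)
  have h3 := ((hasPartialAt_coord l k (hdv k).hasDerivAt).add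
    ((hasPartialAt_coord l k (hdu k).hasDerivAt).mul
      (hasPartialAt_coord l k (hdu k).hasDerivAt)).neg).mul
    (hasPartialAt_sepSlope hkl hdm (fun i => differentiableAt_of_contDiffOn H.isOpen
      (H.smooth_h i) hy) hdu)
  have h4 := (h1.add (h2.add h3)).2
  -- The first-derivative identity holds on all of Ω, so it may be differentiated again.
  rw [partialD_congr_of_eqOn (g := fun _ => 0) H.isOpen (fun y hy => by
    rw [← H.first_derivative hy hc k]
    ring) hy, partialD_const, H.deriv_u l _ (H.coord_mem y hy l) c hc] at h4
  simp only [if_neg hkl] at h4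
  rw [h4]
  ring

/-- The integrability condition of `sepForm m h w u v = 0` as a polynomial in `u` and `v`, at a
point where `m`, `h`, `w` have the values `m₀`, `h₀`, `w₀`, the derivatives `m₁`, `h₁`, `w₁` and
`m₂`, `h₂`, `w₂` with respect to two coordinates `k`, `l`, and the mixed derivatives
`m₃`, `h₃`, `w₃`. -/
def compatForm (k l : Fin n) (m₀ m₁ m₂ m₃ : Fin n → Fin n → 𝕜) (h₀ h₁ h₂ h₃ : Fin n → 𝕜)
    (w₁ w₂ w₃ : 𝕜) (u v : Fin n → 𝕜) : 𝕜 :=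
  m₀ k k * m₀ l l * sepForm m₃ h₃ w₃ u v
    - m₁ l l * m₀ k k * (sepForm m₂ h₂ w₂ u v + (v l - u l ^ 2) * sepSlope l m₀ h₀ u)
    + m₀ k k * m₀ l l * ((v l - u l ^ 2) * sepSlope l m₁ h₁ u)
    - m₂ k k * m₀ l l * (sepForm m₁ h₁ w₁ u v + (v k - u k ^ 2) * sepSlope k m₀ h₀ u)
    + m₀ k k * m₀ l l * ((v k - u k ^ 2) *
        (sepSlope k m₂ h₂ u + 2 * (m₀ k l * (v l - u l ^ 2))))

theorem differentiable_compatForm (k l : Fin n) (m₀ m₁ m₂ m₃ : Fin n → Fin n → 𝕜)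
    (h₀ h₁ h₂ h₃ : Fin n → 𝕜) (w₁ w₂ w₃ : 𝕜) :
    Differentiable 𝕜 fun x : Fin n ⊕ Fin n → 𝕜 => compatForm k l m₀ m₁ m₂ m₃ h₀ h₁ h₂ h₃ w₁ w₂ w₃
      (fun i => x (Sum.inl i)) (fun i => x (Sum.inr i)) := by
  have a1 := differentiable_sepForm m₁ h₁ w₁
  have a2 := differentiable_sepForm m₂ h₂ w₂
  have a3 := differentiable_sepForm m₃ h₃ w₃
  have b1 := differentiable_sepSlope l m₀ h₀
  have b2 := differentiable_sepSlope l m₁ h₁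
  have b3 := differentiable_sepSlope k m₀ h₀
  have b4 := differentiable_sepSlope k m₂ h₂
  unfold compatForm
  fun_prop

/-- The linear combination of the mixed derivative and the two first derivatives in which v_k' and
v_l' cancel. -/
theorem compatForm_eq_zero (H : IsCompleteSeparation Ω T C m h w u v) {y : Coord n} (hy : y ∈ Ω)
    {c : Fin N → ℝ} (hc : c ∈ C) {k l : Fin n} (hkl : k ≠ l) :
    compatForm k l (fun i j => m i j y) (fun i j => partialD k (m i j) y)
      (fun i j => partialD l (m i j) y) (fun i j => partialD l (partialD k (m i j)) y)
      (fun i => h i y) (fun i => partialD k (h i) y) (fun i => partialD l (h i) y)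
      (fun i => partialD l (partialD k (h i)) y) (partialD k w y) (partialD l w y)
      (partialD l (partialD k w) y) (fun i => u i (y i) c) (fun i => v i (y i) c) = 0 := by
  have hk := H.first_derivative hy hc k
  have hl := H.first_derivative hy hc l
  have hh := H.second_derivative hy hc hkl
  unfold compatForm
  linear_combination (m k k y * m l l y) * hh - partialD k (m l l) y * m k k y * hl
    - partialD l (m k k) y * m l l y * hk

theorem differentiableAt_param (H : IsCompleteSeparation Ω T C m h w u v) {y : Coord n}
    (hy : y ∈ Ω) {c : Fin N → ℝ} (hc : c ∈ C) : DifferentiableAt ℝ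
      (fun c => Sum.elim (fun i => u i (y i) c) (fun i => v i (y i) c) :
        (Fin N → ℝ) → Fin n ⊕ Fin n → 𝕜) c := by
  rw [differentiableAt_pi]
  rintro (i | i)
  · exact differentiableAt_of_contDiffOn H.isOpen_param
      (contDiffOn_slice_right (H.smooth_u i) (H.coord_mem y hy i)) hc
  · exact differentiableAt_of_contDiffOn H.isOpen_param
      (contDiffOn_slice_right (H.smooth_v i) (H.coord_mem y hy i)) hc

theorem fderiv_sepForm_single (m : Fin n → Fin n → 𝕜) (h : Fin n → 𝕜) (w : 𝕜) (k : Fin n)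
    (x : Fin n ⊕ Fin n → 𝕜) :
    fderiv 𝕜 (fun x : Fin n ⊕ Fin n → 𝕜 => sepForm m h w
      (fun i => x (Sum.inl i)) (fun i => x (Sum.inr i))) x (Pi.single (Sum.inr k) 1) = m k k := by
  refine fderiv_apply_of_quadratic (differentiable_sepForm m h w) (b := 0) fun s => ?_
  have h3 := sepForm_add_second m h w (fun i => x (Sum.inl i)) (fun i => x (Sum.inr i))
    (Pi.single k 1) s
  have h4 : ∑ i, m i i * (Pi.single k 1 : Fin n → 𝕜) i = m k k := by
    simp [Pi.single_apply]
  rw [h4] at h3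
  rw [mul_zero, add_zero, ← h3]
  congr 1 <;> funext i <;> simp [Pi.single_apply]

theorem fderiv_sepForm_ne_zero (H : IsCompleteSeparation Ω T C m h w u v) {y : Coord n}
    (hy : y ∈ Ω) (k : Fin n) (x : Fin n ⊕ Fin n → 𝕜) :
    fderiv 𝕜 (fun x : Fin n ⊕ Fin n → 𝕜 => sepForm (fun i j => m i j y) (fun i => h i y) (w y)
      (fun i => x (Sum.inl i)) (fun i => x (Sum.inr i))) x ≠ 0 := fun h0 =>
  H.diag_ne_zero y hy k (by
    rw [← fderiv_sepForm_single (fun i j => m i j y) (fun i => h i y) (w y) k x, h0]; rfl)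

/-- `quadratic_coeff_eq_zero` with F the separated equation, Φ its integrability condition, and the
direction with u-part `a` and v-part `b`. -/
theorem eq_zero_of_quadratic (H : IsCompleteSeparation Ω T C m h w u v) {y : Coord n}
    (hy : y ∈ Ω) {k l : Fin n} (hkl : k ≠ l) {a b : Fin n → 𝕜} {κ : 𝕜}
    {Ψ : (Fin n → 𝕜) → (Fin n → 𝕜) → 𝕜}
    (he : ∀ p q : Fin n → 𝕜, ∀ s : 𝕜, sepForm (fun i j => m i j y) (fun i => h i y) (w y)
      (fun i => p i + s * a i) (fun i => q i + s * b i) =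
        sepForm (fun i j => m i j y) (fun i => h i y) (w y) p q)
    (hquad : ∀ p q : Fin n → 𝕜, ∀ s : 𝕜, compatForm k l (fun i j => m i j y)
      (fun i j => partialD k (m i j) y) (fun i j => partialD l (m i j) y)
      (fun i j => partialD l (partialD k (m i j)) y) (fun i => h i y) (fun i => partialD k (h i) y)
      (fun i => partialD l (h i) y) (fun i => partialD l (partialD k (h i)) y) (partialD k w y)
      (partialD l w y) (partialD l (partialD k w) y) (fun i => p i + s * a i)
      (fun i => q i + s * b i) =
      compatForm k l (fun i j => m i j y)
      (fun i j => partialD k (m i j) y) (fun i j => partialD l (m i j) y)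
      (fun i j => partialD l (partialD k (m i j)) y) (fun i => h i y) (fun i => partialD k (h i) y)
      (fun i => partialD l (h i) y) (fun i => partialD l (partialD k (h i)) y) (partialD k w y)
      (partialD l w y) (partialD l (partialD k w) y) p q + s * Ψ p q + s ^ 2 * κ) : κ = 0 :=
  quadratic_coeff_eq_zero H.isOpen_param H.param_nonempty
    (fun c hc => H.differentiableAt_param hy hc)
    (fun c hc => by simpa using H.rank y hy c hc)
    (Ψ := fun x => Ψ (fun i => x (Sum.inl i)) (fun i => x (Sum.inr i))) (e := Sum.elim a b)
    (differentiable_compatForm k l _ _ _ _ _ _ _ _ _ _ _)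
    (fun c hc => H.compatForm_eq_zero hy hc hkl) (differentiable_sepForm _ _ _)
    (fun c hc => H.eq_zero y hy c hc) (fun c hc => H.fderiv_sepForm_ne_zero hy k _)
    (fun x s => he _ _ s) (fun x s => hquad _ _ s)

/-- Separable coordinates are orthogonal. -/
theorem offDiag_eq_zero (H : IsCompleteSeparation Ω T C m h w u v) {y : Coord n}
    (hy : y ∈ Ω) {k l : Fin n} (hkl : k ≠ l) : m k l y = 0 := by
  -- A direction in the (v_k, v_l)-plane that annihilates ∑ m_{ii} v_i. The only term of the
  -- integrability condition that is quadratic in v is the one with 2 m_{kl} v_k v_l, so its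
  -- coefficient along `b` is a non-zero multiple of m_{kl}.
  set b : Fin n → 𝕜 := fun i => if i = k then m l l y else if i = l then -m k k y else 0 with hb
  have hbk : b k = m l l y := by simp [hb]
  have hbl : b l = -m k k y := by simp [hb, Ne.symm hkl]
  have hsum : ∑ i, m i i y * b i = 0 := by
    rw [Finset.sum_eq_add k l hkl]
    · rw [hbk, hbl]; ring
    · rintro i - ⟨hik, hil⟩
      simp [hb, hik, hil]
    · simp
    · simp
  have key := H.eq_zero_of_quadratic hy hkl (a := 0) (b := b)
    (κ := m k k y * m l l y * (2 * m k l y * (m l l y * (-m k k y))))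
    (Ψ := fun p q =>
      m k k y * m l l y * ∑ i, partialD l (partialD k (m i i)) y * b i
      - partialD k (m l l) y * m k k y * (∑ i, partialD l (m i i) y * b i
        + b l * sepSlope l (fun i j => m i j y) (fun i => h i y) p)
      + m k k y * m l l y * (b l * sepSlope l (fun i j => partialD k (m i j) y)
        (fun i => partialD k (h i) y) p)
      - partialD l (m k k) y * m l l y * (∑ i, partialD k (m i i) y * b i
        + b k * sepSlope k (fun i j => m i j y) (fun i => h i y) p)
      + m k k y * m l l y * (b k * sepSlope k (fun i j => partialD l (m i j) y)
        (fun i => partialD l (h i) y) p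
        + 2 * m k l y * (b k * (q l - p l ^ 2) + b l * (q k - p k ^ 2))))
    (fun p q s => by simp [sepForm_add_second, hsum])
    (fun p q s => by
      simp only [compatForm, Pi.zero_apply, mul_zero, add_zero, sepForm_add_second]
      rw [← hbl, ← hbk]
      ring)
  simpa [H.diag_ne_zero y hy] using key

/-- Once `m` is diagonal, F is affine in (u, v) and every `sepSlope` is a constant h_k or a
derivative of it. The u_k² terms of the integrability condition then compare h_k ∂_l m_{kk} with
m_{kk} ∂_l h_k. -/
theorem partialD_first_order (H : IsCompleteSeparation Ω T C m h w u v) {y : Coord n}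
    (hy : y ∈ Ω) {k l : Fin n} (hkl : k ≠ l) :
    m k k y * partialD l (h k) y = h k y * partialD l (m k k) y := by
  have d0 : ∀ i j, i ≠ j → m i j y = 0 := fun i j hij => H.offDiag_eq_zero hy hij
  have d1 : ∀ k i j, i ≠ j → ∀ y ∈ Ω, partialD k (m i j) y = 0 := fun k i j hij y hy => by
    rw [partialD_congr_of_eqOn (g := fun _ => 0) H.isOpen
      (fun y hy => H.offDiag_eq_zero hy hij) hy, partialD_const]
  have d2 : ∀ i j, i ≠ j → partialD l (partialD k (m i j)) y = 0 := fun i j hij => by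
    rw [partialD_congr_of_eqOn (g := fun _ => 0) H.isOpen
      (fun y hy => d1 k i j hij y hy) hy, partialD_const]
  have s1 : ∀ f : Fin n → 𝕜, ∀ t, ∑ i, f i * (Pi.single k t : Fin n → 𝕜) i = f k * t := by
    intro f t; simp [Pi.single_apply]
  have hlk : l ≠ k := Ne.symm hkl
  -- The direction m_{kk} ∂/∂u_k − h_k ∂/∂v_k is in the kernel of the linear part m_{kk} v_k + h_k
  -- u_k of F.
  have key := H.eq_zero_of_quadratic hy hkl (a := Pi.single k (m k k y))
    (b := Pi.single k (-h k y))
    (κ := m k k y ^ 2 * m l l y * (h k y * partialD l (m k k) y - m k k y * partialD l (h k) y))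
    (Ψ := fun p q =>
      m k k y * m l l y * (partialD l (partialD k (m k k)) y * (-h k y)
        + partialD l (partialD k (h k)) y * m k k y)
      - partialD k (m l l) y * m k k y * (partialD l (m k k) y * (-h k y)
        + partialD l (h k) y * m k k y)
      - partialD l (m k k) y * m l l y * (partialD k (m k k) y * (-h k y)
        + partialD k (h k) y * m k k y - (h k y + 2 * p k * m k k y) * h k y)
      - m k k y * m l l y * ((h k y + 2 * p k * m k k y) * partialD l (h k) y))
    (fun p q s => by
      rw [sepForm_add_of_diag d0, s1, s1]
      ring)
    (fun p q s => by
      simp only [compatForm, sepForm_add_of_diag d2,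
        sepForm_add_of_diag (fun i j hij => d1 k i j hij y hy),
        sepForm_add_of_diag (fun i j hij => d1 l i j hij y hy), sepSlope_of_diag d0,
        sepSlope_of_diag (fun i j hij => d1 k i j hij y hy),
        sepSlope_of_diag (fun i j hij => d1 l i j hij y hy), d0 k l hkl, s1,
        Pi.single_eq_same, Pi.single_eq_of_ne hlk]
      ring)
  have h1 : m k k y ^ 2 * m l l y ≠ 0 :=
    mul_ne_zero (pow_ne_zero 2 (H.diag_ne_zero y hy k)) (H.diag_ne_zero y hy l)
  exact (sub_eq_zero.1 ((mul_eq_zero.1 key).resolve_left h1)).symm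

end IsCompleteSeparation

end FER

/-! ### Stäckel rows obtained from the completeness condition. -/

namespace FER

variable {n N : ℕ} {𝕜 : Type*} [RCLike 𝕜]

/-- Rows of Stäckel type (the `i`-th entry depends only on the `i`-th coordinate) that span the
annihilator of the diagonal metric coefficients `g` at each point of `Ω`. -/
structure IsStaeckelFamily {B : Type*} (Ω : Set (Coord n)) (g : Fin n → Coord n → ℝ)
    (s : B → Fin n → Coord n → ℝ) : Prop where
  isOpen : IsOpen Ω
  smooth_g : ∀ i, ContDiffOn ℝ ∞ (g i) Ω
  g_ne_zero : ∀ y ∈ Ω, ∀ i, g i y ≠ 0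
  smooth : ∀ b i, ContDiffOn ℝ ∞ (s b i) Ω
  partialD_eq_zero : ∀ b i k, i ≠ k → ∀ y ∈ Ω, partialD k (s b i) y = 0
  sum_eq_zero : ∀ b, ∀ y ∈ Ω, ∑ i, g i y * s b i y = 0
  annihilator : ∀ y ∈ Ω, ∀ x : Fin n → ℝ, (∀ b, ∑ i, x i * s b i y = 0) →
    ∃ t, ∀ i, x i = t * g i y

theorem contDiffOn_fderiv_slice_right {f : ℝ → (Fin N → ℝ) → 𝕜} {T : Set ℝ}
    {C : Set (Fin N → ℝ)} (hT : IsOpen T) (hC : IsOpen C)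
    (hf : ContDiffOn ℝ ∞ (fun z : ℝ × (Fin N → ℝ) => f z.1 z.2) (T ×ˢ C)) {c : Fin N → ℝ}
    (hc : c ∈ C) (e : Fin N → ℝ) :
    ContDiffOn ℝ ∞ (fun t => fderiv ℝ (fun c => f t c) c e) T := by
  have hTC : IsOpen (T ×ˢ C) := hT.prod hC
  have h1 : ContDiffOn ℝ ∞ (fun z => fderiv ℝ (fun z : ℝ × (Fin N → ℝ) => f z.1 z.2) z (0, e))
      (T ×ˢ C) := (hf.fderiv_of_isOpen hTC (by simp)).clm_apply contDiffOn_const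
  have h2 : ContDiffOn ℝ ∞ (fun t : ℝ =>
      fderiv ℝ (fun z : ℝ × (Fin N → ℝ) => f z.1 z.2) (t, c) (0, e)) T :=
    h1.comp (f := fun t : ℝ => (t, c)) (by fun_prop) fun _ ht => ⟨ht, hc⟩
  refine h2.congr fun t ht => ?_
  have h3 := (differentiableAt_of_contDiffOn hTC hf (y := (t, c)) ⟨ht, hc⟩).hasFDerivAt
  have h4 : HasFDerivAt (fun c => f t c) _ c := h3.comp c (hasFDerivAt_prodMk_right t c)
  rw [h4.fderiv]
  simp

theorem contDiffOn_comp_coord {f : ℝ → 𝕜} {T : Set ℝ} {Ω : Set (Coord n)} {i : Fin n}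
    (hf : ContDiffOn ℝ ∞ f T) (hT : ∀ y ∈ Ω, y i ∈ T) :
    ContDiffOn ℝ ∞ (fun y : Coord n => f (y i)) Ω :=
  hf.comp (f := fun y : Coord n => y i) (by fun_prop) hT

theorem contDiffOn_ofReal {f : Coord n → ℝ} {Ω : Set (Coord n)} (hf : ContDiffOn ℝ ∞ f Ω) :
    ContDiffOn ℝ ∞ (fun y => (f y : 𝕜)) Ω :=
  (RCLike.ofRealCLM (K := 𝕜)).contDiff.comp_contDiffOn hf

theorem partialD_ofReal {f : Coord n → ℝ} {y : Coord n} (hf : DifferentiableAt ℝ f y)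
    (k : Fin n) : partialD k (fun y => (f y : 𝕜)) y = ((partialD k f y : ℝ) : 𝕜) :=
  ((hasPartialAt_partialD hf).clm (RCLike.ofRealCLM (K := 𝕜))).2

namespace IsCompleteSeparation

variable {Ω : Set (Coord n)} {T : Fin n → Set ℝ} {C : Set (Fin N → ℝ)}
  {m : Fin n → Fin n → Coord n → ℝ} {h : Fin n → Coord n → ℝ} {w : Coord n → ℝ}
  {u v : Fin n → ℝ → (Fin N → ℝ) → 𝕜}

/-- `partialD_first_order` read through the quotient rule, after returning from `𝕜` to the real
coefficients. -/
theorem partialD_quotient_eq_zero (hm : ∀ i, ContDiffOn ℝ ∞ (m i i) Ω)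
    (hh : ∀ i, ContDiffOn ℝ ∞ (h i) Ω)
    (H : IsCompleteSeparation Ω T C (fun i j y => (m i j y : 𝕜)) (fun i y => (h i y : 𝕜))
      (fun y => (w y : 𝕜)) u v) {y : Coord n} (hy : y ∈ Ω) {k l : Fin n} (hkl : k ≠ l) :
    partialD l (fun y => h k y / m k k y) y = 0 := by
  have hm0 : ∀ y ∈ Ω, m k k y ≠ 0 := fun y hy h0 => H.diag_ne_zero y hy k (by simp [h0])
  have h1 := H.partialD_first_order hy hkl
  have dm := differentiableAt_of_contDiffOn H.isOpen (hm k) hy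
  have dh := differentiableAt_of_contDiffOn H.isOpen (hh k) hy
  rw [partialD_ofReal dm, partialD_ofReal dh] at h1
  norm_cast at h1
  have df : DifferentiableAt ℝ (fun y => h k y / m k k y) y :=
    differentiableAt_of_contDiffOn H.isOpen ((hh k).div (hm k) hm0) hy
  have h2 := ((hasPartialAt_partialD (k := l) df).mul (hasPartialAt_partialD (k := l) dm)).2
  rw [partialD_congr_of_eqOn (g := h k) H.isOpen
    (fun y hy => div_mul_cancel₀ _ (hm0 y hy)) hy] at h2
  have h3 : m k k y * (partialD l (fun y => h k y / m k k y) y * m k k y) = 0 := by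
    have h4 : m k k y * (h k y / m k k y * partialD l (m k k) y) =
        h k y * partialD l (m k k) y := by
      field_simp [hm0 y hy]
    rw [h2, mul_add, h4] at h1
    linarith
  simpa [hm0 y hy] using h3

/-- The common shape of all Stäckel entries used here: functions of y_i combined through the
quotient h_i/m_{ii}, which is itself a function of y_i locally. The real functional `L` takes real
or imaginary parts. -/
theorem hasPartialAt_combination (hm : ∀ i, ContDiffOn ℝ ∞ (m i i) Ω)
    (hh : ∀ i, ContDiffOn ℝ ∞ (h i) Ω)
    (H : IsCompleteSeparation Ω T C (fun i j y => (m i j y : 𝕜)) (fun i y => (h i y : 𝕜))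
      (fun y => (w y : 𝕜)) u v) {a b : ℝ → 𝕜} {i : Fin n} (ha : ContDiffOn ℝ ∞ a (T i))
    (hb : ContDiffOn ℝ ∞ b (T i)) (L : 𝕜 →L[ℝ] ℝ) :
    ContDiffOn ℝ ∞ (fun y => L (a (y i) + ((h i y / m i i y : ℝ) : 𝕜) * b (y i))) Ω ∧
    ∀ k, i ≠ k → ∀ y ∈ Ω,
      partialD k (fun y => L (a (y i) + ((h i y / m i i y : ℝ) : 𝕜) * b (y i))) y = 0 := by
  have hm0 : ∀ y ∈ Ω, m i i y ≠ 0 := fun y hy h0 => H.diag_ne_zero y hy i (by simp [h0])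
  have hmem : ∀ y ∈ Ω, y i ∈ T i := fun y hy => H.coord_mem y hy i
  have hf : ContDiffOn ℝ ∞ (fun y => h i y / m i i y) Ω := (hh i).div (hm i) hm0
  refine ⟨L.contDiff.comp_contDiffOn ((contDiffOn_comp_coord ha hmem).add
    ((contDiffOn_ofReal hf).mul (contDiffOn_comp_coord hb hmem))), fun k hik y hy => ?_⟩
  have df := differentiableAt_of_contDiffOn H.isOpen hf hy
  have da := differentiableAt_of_contDiffOn (H.isOpen_coord i) ha (hmem y hy)
  have db := differentiableAt_of_contDiffOn (H.isOpen_coord i) hb (hmem y hy)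
  have h1 := (((hasPartialAt_coord k i da.hasDerivAt).add
    (((hasPartialAt_partialD (k := k) df).clm (RCLike.ofRealCLM (K := 𝕜))).mul
      (hasPartialAt_coord k i db.hasDerivAt))).clm L).2
  refine h1.trans ?_
  simp [hik, H.partialD_quotient_eq_zero hm hh hy hik]

theorem fderiv_sepForm_single_inl {m : Fin n → Fin n → 𝕜} (hm : ∀ i j, i ≠ j → m i j = 0)
    (h : Fin n → 𝕜) (w : 𝕜) (k : Fin n) (x : Fin n ⊕ Fin n → 𝕜) :
    fderiv 𝕜 (fun x : Fin n ⊕ Fin n → 𝕜 => sepForm m h w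
      (fun i => x (Sum.inl i)) (fun i => x (Sum.inr i))) x (Pi.single (Sum.inl k) 1) = h k := by
  refine fderiv_apply_of_quadratic (differentiable_sepForm m h w) (b := 0) fun s => ?_
  have h3 := sepForm_add_of_diag hm h w (fun i => x (Sum.inl i)) (fun i => x (Sum.inr i))
    (Pi.single k 1) 0 s
  have h4 : ∑ i, m i i * (0 : Fin n → 𝕜) i + ∑ i, h i * (Pi.single k 1 : Fin n → 𝕜) i = h k := by
    simp [Pi.single_apply]
  rw [h4] at h3
  rw [mul_zero, add_zero, ← h3]
  congr 1
  funext i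
  simp [Pi.single_apply]

/-- With the off-diagonal terms gone, the differential of F in (u, v) is the constant covector (h,
m_{ii}). -/
theorem vecMul_paramJacobian {m : Fin n → Fin n → Coord n → 𝕜} {h : Fin n → Coord n → 𝕜}
    {w : Coord n → 𝕜} (H : IsCompleteSeparation Ω T C m h w u v) {y : Coord n} (hy : y ∈ Ω)
    {c : Fin N → ℝ} (hc : c ∈ C) :
    Matrix.vecMul (Sum.elim (fun i => h i y) (fun i => m i i y)) (paramJacobian
      (fun c => Sum.elim (fun i => u i (y i) c) (fun i => v i (y i) c)) c) = 0 := by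
  have h1 := vecMul_paramJacobian_eq_zero H.isOpen_param hc (H.differentiableAt_param hy hc)
    (differentiable_sepForm (fun i j => m i j y) (fun i => h i y) (w y) _)
    (fun c hc => H.eq_zero y hy c hc)
  rw [← h1]
  congr 1
  funext a
  rcases a with i | i
  · exact (fderiv_sepForm_single_inl (m := fun i j => m i j y)
      (fun i j hij => H.offDiag_eq_zero hy hij) (fun i => h i y) (w y) i _).symm
  · exact (fderiv_sepForm_single (fun i j => m i j y) (fun i => h i y) (w y) i _).symm

/-- The real and imaginary parts of `∂vᵢ/∂c_α + (hᵢ/gⁱⁱ) ∂uᵢ/∂c_α`. -/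
def staeckelRow (m : Fin n → Fin n → Coord n → ℝ) (h : Fin n → Coord n → ℝ)
    (u v : Fin n → ℝ → (Fin N → ℝ) → 𝕜) (c : Fin N → ℝ) (b : Fin N × Bool) (i : Fin n)
    (y : Coord n) : ℝ :=
  (if b.2 then RCLike.reCLM (K := 𝕜) else RCLike.imCLM (K := 𝕜))
    (fderiv ℝ (fun c => v i (y i) c) c (Pi.single b.1 1) +
      ((h i y / m i i y : ℝ) : 𝕜) * fderiv ℝ (fun c => u i (y i) c) c (Pi.single b.1 1))

theorem ofReal_mul_comm_clm (L : 𝕜 →L[ℝ] ℝ) (x : ℝ) (z : 𝕜) : x * L z = L ((x : 𝕜) * z) := by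
  rw [← RCLike.real_smul_eq_coe_mul, map_smul, smul_eq_mul]

/-- The rows are annihilated by `m i i` because (h, m_{ii}) annihilates the Jacobian. Conversely, a
real `x` annihilating all rows extends to a left kernel vector of the Jacobian, and this kernel is a
line. -/
theorem isStaeckelFamily (hm : ∀ i, ContDiffOn ℝ ∞ (m i i) Ω)
    (hh : ∀ i, ContDiffOn ℝ ∞ (h i) Ω)
    (H : IsCompleteSeparation Ω T C (fun i j y => (m i j y : 𝕜)) (fun i y => (h i y : 𝕜))
      (fun y => (w y : 𝕜)) u v) {c : Fin N → ℝ} (hc : c ∈ C) :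
    IsStaeckelFamily Ω (fun i => m i i) (staeckelRow m h u v c) := by
  have hm0 : ∀ y ∈ Ω, ∀ i, m i i y ≠ 0 := fun y hy i h0 => H.diag_ne_zero y hy i (by simp [h0])
  have hcomb := fun (b : Fin N × Bool) (i : Fin n) => H.hasPartialAt_combination hm hh
    (contDiffOn_fderiv_slice_right (H.isOpen_coord i) H.isOpen_param (H.smooth_v i) hc
      (Pi.single b.1 1))
    (contDiffOn_fderiv_slice_right (H.isOpen_coord i) H.isOpen_param (H.smooth_u i) hc
      (Pi.single b.1 1)) (if b.2 then RCLike.reCLM (K := 𝕜) else RCLike.imCLM (K := 𝕜))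
  -- Giving a covector the u-part x_i h_i/m_{ii} and the v-part x_i collapses its pairing with the
  -- Jacobian to the pairing of `x` with the combined rows.
  have hvec : ∀ y (x : Fin n → 𝕜) α, Matrix.vecMul
      (Sum.elim (fun i => x i * ((h i y / m i i y : ℝ) : 𝕜)) x) (paramJacobian
      (fun c => Sum.elim (fun i => u i (y i) c) (fun i => v i (y i) c)) c) α =
      ∑ i, x i * (fderiv ℝ (fun c => v i (y i) c) c (Pi.single α 1) +
      ((h i y / m i i y : ℝ) : 𝕜) * fderiv ℝ (fun c => u i (y i) c) c (Pi.single α 1)) := by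
    intro y x α
    simp only [Matrix.vecMul, dotProduct, Fintype.sum_sum_type, Sum.elim_inl, Sum.elim_inr,
      paramJacobian, Matrix.of_apply, ← Finset.sum_add_distrib]
    exact Finset.sum_congr rfl fun i _ => by ring
  have hhm : ∀ y ∈ Ω, (Sum.elim (fun i => ((m i i y : ℝ) : 𝕜) * ((h i y / m i i y : ℝ) : 𝕜))
      (fun i => ((m i i y : ℝ) : 𝕜)) : Fin n ⊕ Fin n → 𝕜) =
      Sum.elim (fun i => ((h i y : ℝ) : 𝕜)) (fun i => ((m i i y : ℝ) : 𝕜)) := by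
    intro y hy
    congr 1
    funext i
    rw [← RCLike.ofReal_mul, mul_div_cancel₀ _ (hm0 y hy i)]
  refine ⟨H.isOpen, hm, hm0, fun b i => (hcomb b i).1, fun b i => (hcomb b i).2,
    fun b y hy => ?_, fun y hy x hx => ?_⟩
  · have h1 := congrFun (H.vecMul_paramJacobian hy hc) b.1
    rw [← hhm y hy, hvec] at h1
    simp only [staeckelRow, ofReal_mul_comm_clm, ← map_sum]
    rw [h1]
    simp
  · by_cases hn : Nonempty (Fin n)
    swap
    · exact ⟨0, fun i => (hn ⟨i⟩).elim⟩
    obtain ⟨i₀⟩ := hn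
    have h1 : Matrix.vecMul (Sum.elim (fun i => (x i : 𝕜) * ((h i y / m i i y : ℝ) : 𝕜))
        (fun i => (x i : 𝕜))) (paramJacobian
        (fun c => Sum.elim (fun i => u i (y i) c) (fun i => v i (y i) c)) c) = 0 := by
      funext α
      rw [hvec]
      have hre := hx (α, true)
      have him := hx (α, false)
      simp only [staeckelRow, ofReal_mul_comm_clm, ← map_sum] at hre him
      exact RCLike.ext (by simpa using hre) (by simpa using him)
    obtain ⟨t, ht⟩ := exists_smul_eq_of_vecMul_eq_zero _ (by simpa using H.rank y hy c hc) h1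
      (H.vecMul_paramJacobian hy hc) (fun h0 => H.diag_ne_zero y hy i₀ (by
        simpa using congrFun h0 (Sum.inr i₀)))
    -- The factor lies in `𝕜`, but `x` and the metric coefficients are real, so its real part does.
    refine ⟨RCLike.re t, fun i => ?_⟩
    have h2 := congrArg RCLike.re (congrFun ht (Sum.inr i))
    simpa using h2

/-- The free term of the separated equation is a combination of the metric coefficients with
coefficients of Stäckel type. -/
theorem exists_staeckel_row_of_free_term (hm : ∀ i, ContDiffOn ℝ ∞ (m i i) Ω)
    (hh : ∀ i, ContDiffOn ℝ ∞ (h i) Ω)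
    (H : IsCompleteSeparation Ω T C (fun i j y => (m i j y : 𝕜)) (fun i y => (h i y : 𝕜))
      (fun y => (w y : 𝕜)) u v) :
    ∃ θ : Fin n → Coord n → ℝ, (∀ i, ContDiffOn ℝ ∞ (θ i) Ω) ∧
      (∀ i k, i ≠ k → ∀ y ∈ Ω, partialD k (θ i) y = 0) ∧
      ∀ y ∈ Ω, ∑ i, m i i y * θ i y = w y := by
  obtain ⟨c, hc⟩ := H.param_nonempty
  -- At a fixed parameter the equation reads ∑ m_{ii} (v_i + (h_i/m_{ii}) u_i) = −w, so θ_i is minus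
  -- the real part of the bracket.
  have hcomb := fun i => H.hasPartialAt_combination hm hh (contDiffOn_slice_left (H.smooth_v i) hc)
    (contDiffOn_slice_left (H.smooth_u i) hc) (-RCLike.reCLM (K := 𝕜))
  refine ⟨_, fun i => (hcomb i).1, fun i => (hcomb i).2, fun y hy => ?_⟩
  have h1 := H.eq_zero y hy c hc
  rw [sepForm_of_diag (fun i j hij => H.offDiag_eq_zero hy hij)] at h1
  simp only [ofReal_mul_comm_clm, ← map_sum]
  have h2 : ∑ i, ((m i i y : ℝ) : 𝕜) * (v i (y i) c + ((h i y / m i i y : ℝ) : 𝕜) * u i (y i) c) =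
      -(w y : 𝕜) := by
    rw [← add_eq_zero_iff_eq_neg, ← h1, ← Finset.sum_add_distrib]
    congr 1
    refine Finset.sum_congr rfl fun i _ => ?_
    have hm0 : m i i y ≠ 0 := fun h0 => H.diag_ne_zero y hy i (by simp [h0])
    rw [mul_add, ← mul_assoc, ← RCLike.ofReal_mul, mul_div_cancel₀ _ hm0]
  rw [h2]
  simp

end IsCompleteSeparation

end FER

/-! ### Propagation of Stäckel rows over connected sets. -/

namespace FER

variable {n : ℕ}

section Rows

variable {Ω : Set (Coord n)} {g s : Fin n → Coord n → ℝ}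

/-- In the derivative of ∑ g_i s_i = 0 only s_k is differentiated. Together with `hpart` this gives
a closed linear first-order system for the row. -/
theorem mul_partialD_staeckel_row (hΩ : IsOpen Ω) (hg : ∀ i, ContDiffOn ℝ ∞ (g i) Ω)
    (hs : ∀ i, ContDiffOn ℝ ∞ (s i) Ω)
    (hpart : ∀ i k, i ≠ k → ∀ y ∈ Ω, partialD k (s i) y = 0)
    (hsum : ∀ y ∈ Ω, ∑ i, g i y * s i y = 0) {y : Coord n} (hy : y ∈ Ω) (k : Fin n) :
    g k y * partialD k (s k) y = -∑ i, partialD k (g i) y * s i y := by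
  have h1 := (HasPartialAt.sum (s := Finset.univ) fun i _ =>
    (hasPartialAt_partialD (k := k) (differentiableAt_of_contDiffOn hΩ (hg i) hy)).mul
    (hasPartialAt_partialD (k := k) (differentiableAt_of_contDiffOn hΩ (hs i) hy))).2
  rw [partialD_congr_of_eqOn (g := fun _ => 0) hΩ hsum hy, partialD_const,
    Finset.sum_add_distrib] at h1
  have h2 : ∑ i, g i y * partialD k (s i) y = g k y * partialD k (s k) y :=
    Finset.sum_eq_single k (fun i _ hik => by rw [hpart i k hik y hy, mul_zero]) (by simp)
  rw [h2] at h1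
  linarith

/-- Along a segment from `y₁` the row satisfies a linear ordinary differential equation with bounded
coefficients and zero initial value, so it vanishes by Grönwall's inequality. -/
theorem eventually_staeckel_row_eq_zero (hΩ : IsOpen Ω) (hg : ∀ i, ContDiffOn ℝ ∞ (g i) Ω)
    (hg0 : ∀ y ∈ Ω, ∀ i, g i y ≠ 0) (hs : ∀ i, ContDiffOn ℝ ∞ (s i) Ω)
    (hpart : ∀ i k, i ≠ k → ∀ y ∈ Ω, partialD k (s i) y = 0)
    (hsum : ∀ y ∈ Ω, ∑ i, g i y * s i y = 0) {y₁ : Coord n} (hy₁ : y₁ ∈ Ω)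
    (h0 : ∀ i, s i y₁ = 0) : ∀ᶠ y in nhds y₁, ∀ i, s i y = 0 := by
  set a : Fin n → Fin n → Coord n → ℝ := fun k i y => partialD k (g i) y / g k y with ha
  have hcont : ∀ k i, ContinuousAt (fun y => |a k i y|) y₁ := fun k i =>
    (((contDiffOn_partialD hΩ (hg i) k).continuousOn.continuousAt (hΩ.mem_nhds hy₁)).div
      ((hg k).continuousOn.continuousAt (hΩ.mem_nhds hy₁)) (hg0 _ hy₁ k)).abs
  -- A ball on which the coefficients exceed their absolute values at the centre by less than 1;
  -- this provides the uniform Grönwall constant.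
  have hbd : ∀ᶠ y in nhds y₁, y ∈ Ω ∧ ∀ k i, |a k i y| < |a k i y₁| + 1 :=
    (hΩ.eventually_mem hy₁).and (Filter.eventually_all.2 fun k => Filter.eventually_all.2 fun i =>
      (hcont k i).eventually_lt_const (by linarith))
  obtain ⟨r, hr, hball⟩ := Metric.eventually_nhds_iff_ball.1 hbd
  refine Metric.eventually_nhds_iff_ball.2 ⟨r, hr, fun y hy => ?_⟩
  set γ : ℝ → Coord n := fun t => y₁ + t • (y - y₁) with hγ
  have hγd : ∀ t, HasDerivAt γ (y - y₁) t := fun t => by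
    have h1 : HasDerivAt γ _ t := ((hasDerivAt_id t).smul_const (y - y₁)).const_add y₁
    exact h1.congr_deriv (one_smul _ _)
  have hγmem : ∀ t ∈ Set.Icc (0 : ℝ) 1, γ t ∈ Metric.ball y₁ r := fun t ht =>
    (convex_ball y₁ r).add_smul_sub_mem (Metric.mem_ball_self hr) hy ht
  set M : ℝ := ∑ k, ∑ i, (|a k i y₁| + 1) with hM
  set f : ℝ → Fin n → ℝ := fun t k => s k (γ t) with hf
  have hM0 : 0 ≤ M := Finset.sum_nonneg fun k _ => Finset.sum_nonneg fun i _ => by positivity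
  have hfd : ∀ t ∈ Set.Icc (0 : ℝ) 1, HasDerivAt f
      (fun k => (y - y₁) k * -∑ i, a k i (γ t) * s i (γ t)) t := by
    intro t ht
    have hΩt : γ t ∈ Ω := (hball _ (hγmem t ht)).1
    rw [hasDerivAt_pi]
    intro k
    have h1 : HasDerivAt (fun t => s k (γ t)) _ t :=
      (differentiableAt_of_contDiffOn hΩ (hs k) hΩt).hasFDerivAt.comp_hasDerivAt t (hγd t)
    refine h1.congr_deriv ?_
    rw [fderiv_apply_eq_sum_partialD, Finset.sum_eq_single k
      (fun l _ hlk => by rw [hpart k l (Ne.symm hlk) _ hΩt, smul_zero]) (by simp), smul_eq_mul]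
    congr 1
    have h2 := mul_partialD_staeckel_row hΩ hg hs hpart hsum hΩt k
    have h3 : ∑ i, a k i (γ t) * s i (γ t) = (∑ i, partialD k (g i) (γ t) * s i (γ t)) /
        g k (γ t) := by
      rw [Finset.sum_div]
      exact Finset.sum_congr rfl fun i _ => by simp only [ha]; ring
    rw [h3, ← neg_div, ← h2, mul_div_cancel_left₀ _ (hg0 _ hΩt k)]
  have hbound : ∀ t ∈ Set.Ico (0 : ℝ) 1,
      ‖fun k => (y - y₁) k * -∑ i, a k i (γ t) * s i (γ t)‖ ≤ (‖y - y₁‖ * M) * ‖f t‖ := by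
    intro t ht
    refine (pi_norm_le_iff_of_nonneg (by positivity)).2 fun k => ?_
    rw [norm_mul, norm_neg, mul_assoc]
    refine mul_le_mul (PiLp.norm_apply_le _ k) ?_ (norm_nonneg _) (norm_nonneg _)
    calc ‖∑ i, a k i (γ t) * s i (γ t)‖ ≤ ∑ i, ‖a k i (γ t) * s i (γ t)‖ := norm_sum_le _ _
      _ ≤ ∑ i, (|a k i y₁| + 1) * ‖f t‖ := Finset.sum_le_sum fun i _ => by
          rw [norm_mul]
          exact mul_le_mul ((hball _ (hγmem t ⟨ht.1, ht.2.le⟩)).2 k i).le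
            (norm_le_pi_norm (f t) i) (norm_nonneg _) (by positivity)
      _ = (∑ i, (|a k i y₁| + 1)) * ‖f t‖ := by rw [Finset.sum_mul]
      _ ≤ M * ‖f t‖ := by
          refine mul_le_mul_of_nonneg_right ?_ (norm_nonneg _)
          exact Finset.single_le_sum (f := fun k => ∑ i, (|a k i y₁| + 1))
            (fun k _ => Finset.sum_nonneg fun i _ => by positivity) (Finset.mem_univ k)
  have h1 := eq_zero_of_abs_deriv_le_mul_abs_self_of_eq_zero_right (f := f)
    (fun t ht => (hfd t ht).continuousAt.continuousWithinAt)
    (fun t ht => (hfd t ⟨ht.1, ht.2.le⟩).hasDerivWithinAt)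
    (by funext k; simp [hf, hγ, h0]) hbound 1 ⟨zero_le_one, le_rfl⟩
  intro i
  simpa [hf, hγ] using congrFun h1 i

/-- A row of Stäckel type annihilated by `g` that vanishes at a point vanishes on each preconnected
set containing this point. -/
theorem staeckel_row_eq_zero (hΩ : IsOpen Ω) (hg : ∀ i, ContDiffOn ℝ ∞ (g i) Ω)
    (hg0 : ∀ y ∈ Ω, ∀ i, g i y ≠ 0) (hs : ∀ i, ContDiffOn ℝ ∞ (s i) Ω)
    (hpart : ∀ i k, i ≠ k → ∀ y ∈ Ω, partialD k (s i) y = 0)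
    (hsum : ∀ y ∈ Ω, ∑ i, g i y * s i y = 0) {Z : Set (Coord n)} (hZ : IsPreconnected Z)
    (hZΩ : Z ⊆ Ω) {y₁ : Coord n} (hy₁ : y₁ ∈ Z) (h0 : ∀ i, s i y₁ = 0) :
    ∀ y ∈ Z, ∀ i, s i y = 0 := by
  -- The zero set of the row is open by the local uniqueness just proved and its complement in Ω is
  -- open by continuity.
  have hU : IsOpen {y | y ∈ Ω ∧ ∀ i, s i y = 0} := by
    rw [isOpen_iff_mem_nhds]
    rintro y ⟨hy, hy0⟩
    exact (hΩ.eventually_mem hy).and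
      (eventually_staeckel_row_eq_zero hΩ hg hg0 hs hpart hsum hy hy0)
  have hV : IsOpen {y | y ∈ Ω ∧ ∃ i, s i y ≠ 0} := by
    rw [isOpen_iff_mem_nhds]
    rintro y ⟨hy, i, hi⟩
    refine (hΩ.eventually_mem hy).and ?_
    filter_upwards [((hs i).continuousOn.continuousAt (hΩ.mem_nhds hy)).eventually_ne hi] with z hz
    exact ⟨i, hz⟩
  have hsub := hZ.subset_left_of_subset_union hU hV
    (Set.disjoint_left.2 fun y h1 h2 => h2.2.elim fun i hi => hi (h1.2 i))
    (fun y hy => by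
      by_cases h : ∀ i, s i y = 0
      · exact Or.inl ⟨hZΩ hy, h⟩
      · exact Or.inr ⟨hZΩ hy, not_forall.1 h⟩)
    ⟨y₁, hy₁, hZΩ hy₁, h0⟩
  exact fun y hy => (hsub hy).2

end Rows

/-! ### The Stäckel matrix and the tensors given by the rows of its inverse. -/

namespace IsStaeckelFamily

variable {B : Type*} {Ω : Set (Coord n)} {g : Fin n → Coord n → ℝ} {s : B → Fin n → Coord n → ℝ}

/-- The common kernel of the rows is the line spanned by `g`, so by rank–nullity they have rank n −
1. -/
theorem exists_linearIndependent [Fintype B] (hn : 1 ≤ n) (H : IsStaeckelFamily Ω g s)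
    {y : Coord n} (hy : y ∈ Ω) :
    ∃ β : Fin (n - 1) → B, LinearIndependent ℝ fun j i => s (β j) i y := by
  set A : Matrix B (Fin n) ℝ := Matrix.of fun b i => s b i y with hA
  have hker : LinearMap.ker A.mulVecLin = Submodule.span ℝ {fun i => g i y} := by
    ext x
    rw [Submodule.mem_span_singleton, LinearMap.mem_ker]
    constructor
    · intro hx
      obtain ⟨t, ht⟩ := H.annihilator y hy x (fun b => by
        simpa [hA, Matrix.mulVec, dotProduct, mul_comm] using congrFun hx b)
      exact ⟨t, funext fun i => (ht i).symm⟩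
    · rintro ⟨t, rfl⟩
      funext b
      have := H.sum_eq_zero b y hy
      simp only [hA, Matrix.mulVecLin_apply, Matrix.mulVec, dotProduct, Matrix.of_apply,
        Pi.smul_apply, smul_eq_mul, Pi.zero_apply]
      rw [← mul_zero t, ← this, Finset.mul_sum]
      exact Finset.sum_congr rfl fun i _ => by ring
  have hr := A.mulVecLin.finrank_range_add_finrank_ker
  rw [hker, finrank_span_singleton (v := fun i => g i y)
    (fun h => H.g_ne_zero y hy ⟨0, hn⟩ (congrFun h _)),
    Module.finrank_fintype_fun_eq_card, Fintype.card_fin] at hr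
  have hrank : Module.finrank ℝ (Submodule.span ℝ (Set.range A.row)) = n - 1 := by
    rw [← Matrix.rank_eq_finrank_span_row, Matrix.rank]
    omega
  obtain ⟨f, hf, -, hli⟩ := Submodule.exists_fun_fin_finrank_span_eq ℝ (Set.range A.row)
  choose β hβ using hf
  refine ⟨fun j => β (Fin.cast hrank.symm j), ?_⟩
  have h1 := hli.comp (Fin.cast hrank.symm) (Fin.cast_injective _)
  have h2 : (fun j i => s (β (Fin.cast hrank.symm j)) i y) = f ∘ Fin.cast hrank.symm :=
    funext fun j => hβ _
  rw [h2]
  exact h1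

/-- The coefficients of a linear relation at `y`, kept constant, combine the rows into a single
Stäckel row vanishing at `y`, hence also at `y₀`. -/
theorem linearIndependent_of_isPreconnected (H : IsStaeckelFamily Ω g s) {ι : Type*} [Fintype ι]
    {β : ι → B} {Z : Set (Coord n)} (hZ : IsPreconnected Z) (hZΩ : Z ⊆ Ω) {y₀ y : Coord n}
    (hy₀ : y₀ ∈ Z) (hy : y ∈ Z) (hli : LinearIndependent ℝ fun j i => s (β j) i y₀) :
    LinearIndependent ℝ fun j i => s (β j) i y := by
  rw [Fintype.linearIndependent_iff] at hli ⊢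
  intro c hc
  refine hli c (funext fun i => ?_)
  have h1 := staeckel_row_eq_zero (s := fun i y => ∑ j, c j * s (β j) i y) H.isOpen H.smooth_g
    H.g_ne_zero (fun i => ContDiffOn.sum fun j _ => contDiffOn_const.mul (H.smooth _ i))
    (fun i k hik y hy => by
      have := (HasPartialAt.sum (s := Finset.univ) fun j _ =>
        (hasPartialAt_const k (c j) y).mul (hasPartialAt_partialD (k := k)
          (differentiableAt_of_contDiffOn H.isOpen (H.smooth (β j) i) hy))).2
      rw [this]
      simp [H.partialD_eq_zero _ i k hik y hy])
    (fun y hy => by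
      simp only [Finset.mul_sum, mul_left_comm _ (c _)]
      rw [Finset.sum_comm]
      simp only [← Finset.mul_sum, H.sum_eq_zero _ y hy, mul_zero, Finset.sum_const_zero])
    hZ hZΩ hy (fun i => by simpa using congrFun hc i) y₀ hy₀ i
  simpa using h1

/-- Ω need not be connected, so the n − 1 rows are selected separately on each component; components
of an open set are open, which keeps the selection locally constant. -/
theorem exists_locally_constant_basis [Fintype B] (hn : 1 ≤ n) (H : IsStaeckelFamily Ω g s)
    (hΩ : Ω.Nonempty) :
    ∃ β : Coord n → Fin (n - 1) → B, (∀ y ∈ Ω, ∀ᶠ z in nhds y, β z = β y) ∧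
      ∀ y ∈ Ω, LinearIndependent ℝ fun j i => s (β y j) i y := by
  -- Choosing for each set `Z`, and not for each point, forces the selection to depend on the
  -- component alone.
  have hex : ∀ Z : Set (Coord n), ∃ β : Fin (n - 1) → B, ∀ y₀ ∈ Ω,
      connectedComponentIn Ω y₀ = Z → ∀ y ∈ Z, LinearIndependent ℝ fun j i => s (β j) i y := by
    intro Z
    by_cases hZ : ∃ y₀ ∈ Ω, connectedComponentIn Ω y₀ = Z
    · obtain ⟨y₀, hy₀, rfl⟩ := hZ
      obtain ⟨β, hβ⟩ := H.exists_linearIndependent hn hy₀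
      exact ⟨β, fun _ _ _ y hy => H.linearIndependent_of_isPreconnected
        isPreconnected_connectedComponentIn (connectedComponentIn_subset _ _)
        (mem_connectedComponentIn hy₀) hy hβ⟩
    · obtain ⟨β, -⟩ := H.exists_linearIndependent hn hΩ.some_mem
      exact ⟨β, fun y₀ hy₀ h => absurd ⟨y₀, hy₀, h⟩ hZ⟩
  choose β hβ using hex
  refine ⟨fun y => β (connectedComponentIn Ω y), fun y hy => ?_, fun y hy =>
    hβ _ y hy rfl y (mem_connectedComponentIn hy)⟩
  filter_upwards [H.isOpen.connectedComponentIn.mem_nhds (mem_connectedComponentIn hy)] with z hz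
  rw [connectedComponentIn_eq hz]

/-- The Stäckel matrix with the rows `s (β y j)` and `θ` as columns. -/
def staeckelMatrix (s : B → Fin n → Coord n → ℝ) (θ : Fin n → Coord n → ℝ)
    (e : Fin n ≃ Option (Fin (n - 1))) (β : Coord n → Fin (n - 1) → B) (y : Coord n) :
    Matrix (Fin n) (Fin n) ℝ :=
  Matrix.of fun i j => (e j).elim (θ i y) fun a => s (β y a) i y

variable {θ : Fin n → Coord n → ℝ} {e : Fin n ≃ Option (Fin (n - 1))}
  {β : Coord n → Fin (n - 1) → B}

theorem staeckelMatrix_eventuallyEq {y : Coord n} (hβ : ∀ᶠ z in nhds y, β z = β y) (i j : Fin n) :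
    (fun z => staeckelMatrix s θ e β z i j) =ᶠ[nhds y]
      fun z => (e j).elim (θ i z) fun a => s (β y a) i z := by
  filter_upwards [hβ] with z hz
  simp [staeckelMatrix, hz]

theorem contDiffOn_staeckelMatrix (H : IsStaeckelFamily Ω g s)
    (hθ : ∀ i, ContDiffOn ℝ ∞ (θ i) Ω) (hβ : ∀ y ∈ Ω, ∀ᶠ z in nhds y, β z = β y) (i j : Fin n) :
    ContDiffOn ℝ ∞ (fun y => staeckelMatrix s θ e β y i j) Ω := by
  intro y hy
  refine (ContDiffAt.congr_of_eventuallyEq ?_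
    (staeckelMatrix_eventuallyEq (hβ y hy) i j)).contDiffWithinAt
  rcases e j with - | a
  · exact (hθ i).contDiffAt (H.isOpen.mem_nhds hy)
  · exact (H.smooth _ i).contDiffAt (H.isOpen.mem_nhds hy)

theorem partialD_staeckelMatrix (H : IsStaeckelFamily Ω g s)
    (hpart : ∀ i k, i ≠ k → ∀ y ∈ Ω, partialD k (θ i) y = 0)
    (hβ : ∀ y ∈ Ω, ∀ᶠ z in nhds y, β z = β y) {i k : Fin n} (hik : i ≠ k) (j : Fin n)
    {y : Coord n} (hy : y ∈ Ω) : partialD k (fun y => staeckelMatrix s θ e β y i j) y = 0 := by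
  rw [partialD_congr (staeckelMatrix_eventuallyEq (hβ y hy) i j)]
  rcases e j with - | a
  · exact hpart i k hik y hy
  · exact H.partialD_eq_zero _ i k hik y hy

/-- The independent columns s lie in the hyperplane orthogonal to `g`, while the column θ lies
outside it by `hσ`. -/
theorem isUnit_staeckelMatrix (H : IsStaeckelFamily Ω g s) {y : Coord n} (hy : y ∈ Ω)
    (hσ : ∑ i, g i y * θ i y ≠ 0) (hli : LinearIndependent ℝ fun j i => s (β y j) i y) :
    IsUnit (staeckelMatrix s θ e β y) := by
  rw [← Matrix.linearIndependent_cols_iff_isUnit, ← linearIndependent_equiv e.symm,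
    linearIndependent_option]
  have hcol : ∀ a i, ((staeckelMatrix s θ e β y).col ∘ e.symm) a i =
      a.elim (θ i y) fun j => s (β y j) i y := by
    intro a i
    change staeckelMatrix s θ e β y i (e.symm a) = _
    simp [staeckelMatrix]
  have hsome : (((staeckelMatrix s θ e β y).col ∘ e.symm) ∘ ((↑) : Fin (n - 1) → Option _)) =
      fun j i => s (β y j) i y := by
    funext j i
    exact hcol (some j) i
  rw [hsome]
  refine ⟨hli, fun hmem => hσ ?_⟩
  have hle : Submodule.span ℝ (Set.range fun j i => s (β y j) i y) ≤
      LinearMap.ker (dotProductBilin ℝ ℝ fun i => g i y) := by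
    rw [Submodule.span_le]
    rintro _ ⟨j, rfl⟩
    exact H.sum_eq_zero _ y hy
  have h1 : ∑ i, g i y * ((staeckelMatrix s θ e β y).col ∘ e.symm) none i = 0 := hle hmem
  simpa only [hcol, Option.elim_none] using h1

theorem vecMul_staeckelMatrix (H : IsStaeckelFamily Ω g s) {y : Coord n} (hy : y ∈ Ω) :
    Matrix.vecMul (fun i => g i y) (staeckelMatrix s θ e β y) =
      Pi.single (e.symm none) (∑ i, g i y * θ i y) := by
  funext j
  obtain ⟨a, rfl⟩ := e.symm.surjective j
  rcases a with - | a
  · simp [Matrix.vecMul, dotProduct, staeckelMatrix]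
  · rw [Pi.single_eq_of_ne (by simp)]
    simpa [Matrix.vecMul, dotProduct, staeckelMatrix] using H.sum_eq_zero _ y hy

/-- The diagonal tensors in involution associated with a family of Stäckel rows. -/
theorem exists_involutive_family [Fintype B] (hn : 1 ≤ n) (H : IsStaeckelFamily Ω g s)
    (hθ : ∀ i, ContDiffOn ℝ ∞ (θ i) Ω)
    (hpart : ∀ i k, i ≠ k → ∀ y ∈ Ω, partialD k (θ i) y = 0)
    (hσ : ∀ y ∈ Ω, ∑ i, g i y * θ i y ≠ 0) :
    ∃ κ : Option (Fin (n - 1)) → Fin n → Coord n → ℝ,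
      (∀ a i, ContDiffOn ℝ ∞ (κ a i) Ω) ∧
      (∀ y ∈ Ω, LinearIndependent ℝ fun a i => κ a i y) ∧
      (∀ y ∈ Ω, ∀ i, κ none i y = g i y / ∑ i, g i y * θ i y) ∧
      ∀ y ∈ Ω, ∃ t : Fin n → Fin n → ℝ, ∀ a k i, partialD k (κ a i) y = κ a k y * t k i := by
  by_cases hΩ : Ω.Nonempty
  swap
  · rw [Set.not_nonempty_iff_eq_empty] at hΩ
    subst hΩ
    exact ⟨fun _ _ _ => 0, by simp⟩
  obtain ⟨β, hβ, hli⟩ := H.exists_locally_constant_basis hn hΩ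
  obtain ⟨e⟩ : Nonempty (Fin n ≃ Option (Fin (n - 1))) :=
    Fintype.card_eq.1 (by simp; omega)
  set S := staeckelMatrix s θ e β with hS
  have hSs : ∀ i j, ContDiffOn ℝ ∞ (fun y => S y i j) Ω := H.contDiffOn_staeckelMatrix hθ hβ
  have hu : ∀ y ∈ Ω, IsUnit (S y) := fun y hy => H.isUnit_staeckelMatrix hy (hσ y hy) (hli y hy)
  have hdet : ∀ y ∈ Ω, IsUnit (S y).det := fun y hy => (Matrix.isUnit_iff_isUnit_det _).1 (hu y hy)
  have hinv : ∀ i j, ContDiffOn ℝ ∞ (fun y => (S y)⁻¹ i j) Ω :=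
    contDiffOn_inv_apply hSs fun y hy => (hdet y hy).ne_zero
  refine ⟨fun a i y => (S y)⁻¹ (e.symm a) i, fun a i => hinv _ _, fun y hy => ?_,
    fun y hy i => ?_, fun y hy => ?_⟩
  · have h1 : LinearIndependent ℝ (S y)⁻¹.row :=
      Matrix.linearIndependent_rows_iff_isUnit.2 (Matrix.isUnit_nonsing_inv_iff.2 (hu y hy))
    exact h1.comp e.symm e.symm.injective
  -- The product g S is σ times the basis covector with index `none`, so g is σ times that row of
  -- S⁻¹.
  · have h1 := congrArg (fun x => Matrix.vecMul x (S y)⁻¹)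
      (H.vecMul_staeckelMatrix (θ := θ) (e := e) (β := β) hy)
    simp only [← hS, Matrix.vecMul_vecMul, Matrix.mul_nonsing_inv _ (hdet y hy),
      Matrix.vecMul_one, Matrix.single_vecMul] at h1
    rw [eq_div_iff (hσ y hy), mul_comm]
    exact (congrFun h1 i).symm
  -- From ∂_k S⁻¹ = −S⁻¹ (∂_k S) S⁻¹, where ∂_k S has only its k-th row non-zero: the factor other
  -- than the entry k of row `a` does not involve `a`.
  · refine ⟨fun k l => -∑ j, partialD k (fun y => S y k j) y * (S y)⁻¹ j l, fun a k l => ?_⟩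
    have h1 : ∀ j, ∑ i, partialD k (fun y => (S y)⁻¹ (e.symm a) i) y * S y i j =
        -((S y)⁻¹ (e.symm a) k * partialD k (fun y => S y k j) y) := by
      intro j
      have h2 := (HasPartialAt.sum (s := Finset.univ) fun i _ =>
        (hasPartialAt_partialD (k := k)
          (differentiableAt_of_contDiffOn H.isOpen (hinv (e.symm a) i) hy)).mul
        (hasPartialAt_partialD (k := k) (differentiableAt_of_contDiffOn H.isOpen (hSs i j) hy))).2
      rw [partialD_congr_of_eqOn (g := fun _ => (1 : Matrix (Fin n) (Fin n) ℝ) (e.symm a) j)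
        H.isOpen (fun y hy => by
          rw [← Matrix.nonsing_inv_mul _ (hdet y hy), Matrix.mul_apply]) hy, partialD_const,
        Finset.sum_add_distrib] at h2
      have h3 : ∑ i, (S y)⁻¹ (e.symm a) i * partialD k (fun y => S y i j) y =
          (S y)⁻¹ (e.symm a) k * partialD k (fun y => S y k j) y :=
        Finset.sum_eq_single k (fun i _ hik => by
          rw [H.partialD_staeckelMatrix hpart hβ hik j hy, mul_zero]) (by simp)
      rw [h3] at h2
      linarith
    have h2 : Matrix.vecMul (Matrix.vecMul
        (fun i => partialD k (fun y => (S y)⁻¹ (e.symm a) i) y) (S y)) (S y)⁻¹ l =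
        partialD k (fun y => (S y)⁻¹ (e.symm a) l) y := by
      rw [Matrix.vecMul_vecMul, Matrix.mul_nonsing_inv _ (hdet y hy), Matrix.vecMul_one]
    rw [← h2]
    simp only [Matrix.vecMul, dotProduct] at h1 ⊢
    simp only [h1, neg_mul, mul_neg, Finset.sum_neg_distrib, Finset.mul_sum, mul_assoc]

end IsStaeckelFamily

end FER

/-! ### The canonical Poisson bracket and its invariance under changes of coordinates. -/

namespace FER

section CanonicalBracket

variable {n : ℕ}

/-- The canonical Poisson bracket of functions of `(y, p)`. -/
def canonicalBracket (a b : Coord n → Coord n → ℝ) (y p : Coord n) : ℝ :=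
  ∑ i, (partialD i (fun p' => a y p') p * partialD i (fun y' => b y' p) y
        - partialD i (fun y' => a y' p) y * partialD i (fun p' => b y p') p)

/-- The transpose of the derivative of `χ` at `y`, applied to the momentum `p`. -/
def momentumPullback (χ : Coord n → Coord n) (y p : Coord n) : Coord n :=
  WithLp.toLp 2 fun j => ∑ i, p i * partialD j (fun y => χ y i) y

theorem contDiffOn_apply {χ : Coord n → Coord n} {W : Set (Coord n)} (hχ : ContDiffOn ℝ ∞ χ W)
    (i : Fin n) : ContDiffOn ℝ ∞ (fun y => χ y i) W :=
  (EuclideanSpace.proj (𝕜 := ℝ) i).contDiff.comp_contDiffOn hχ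

theorem partialD_comp {F : Coord n → ℝ} {τ : Coord n → Coord n} {y : Coord n}
    (hF : DifferentiableAt ℝ F (τ y)) (hτ : DifferentiableAt ℝ τ y) (i : Fin n) :
    partialD i (fun y => F (τ y)) y =
      ∑ r, partialD i (fun y => τ y r) y * partialD r F (τ y) := by
  have h1 : HasFDerivAt (fun y => F (τ y)) _ y := hF.hasFDerivAt.comp y hτ.hasFDerivAt
  have h2 : ∀ r, partialD i (fun y => τ y r) y =
      (fderiv ℝ τ y (EuclideanSpace.single i 1)) r := fun r =>
    ((hasPartialAt_partialD hτ).clm (EuclideanSpace.proj (𝕜 := ℝ) r)).2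
  unfold partialD at h2 ⊢
  rw [h1.fderiv, ContinuousLinearMap.comp_apply, fderiv_apply_eq_sum_partialD]
  simp [h2, partialD]

theorem partialD_momentumPullback_snd (χ : Coord n → Coord n) {a : Coord n → ℝ} {y p : Coord n}
    (ha : DifferentiableAt ℝ a (momentumPullback χ y p)) (i : Fin n) :
    partialD i (fun p => a (momentumPullback χ y p)) p =
      ∑ j, partialD j (fun y => χ y i) y * partialD j a (momentumPullback χ y p) := by
  have hd : ∀ j, HasPartialAt i (fun p : Coord n => momentumPullback χ y p j)
      (partialD j (fun y => χ y i) y) p := by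
    intro j
    have h1 := HasPartialAt.sum (s := Finset.univ) fun m _ =>
      (hasPartialAt_coord (y := p) i m (hasDerivAt_id (p m))).mul
      (hasPartialAt_const i (partialD j (fun y => χ y m) y) p)
    exact h1.congr_deriv (by simp)
  rw [partialD_comp ha (differentiableAt_euclidean.2 fun j => (hd j).1)]
  exact Finset.sum_congr rfl fun j _ => by rw [(hd j).2]

/-- The transformed momentum itself depends on `y` through the Jacobian of χ; this produces the
terms with second derivatives of χ. -/
theorem partialD_lift {χ : Coord n → Coord n} {W : Set (Coord n)} (hW : IsOpen W)
    (hχ : ContDiffOn ℝ ∞ χ W) {a : Coord n → Coord n → ℝ} {y p : Coord n} (hy : y ∈ W)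
    (ha : DifferentiableAt ℝ (fun z : Coord n × Coord n => a z.1 z.2)
      (y, momentumPullback χ y p)) (r : Fin n) :
    HasPartialAt r (fun y => a y (momentumPullback χ y p))
      (partialD r (fun y' => a y' (momentumPullback χ y p)) y +
        ∑ k, partialD k (fun p' => a y p') (momentumPullback χ y p) *
          ∑ m, p m * partialD r (partialD k fun y => χ y m) y) y := by
  have hd : ∀ k, HasPartialAt r (fun y : Coord n => momentumPullback χ y p k)
      (∑ m, p m * partialD r (partialD k fun y => χ y m) y) y := by
    intro k
    have h1 := HasPartialAt.sum (s := Finset.univ) fun m _ =>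
      (hasPartialAt_const r (p m) y).mul (hasPartialAt_partialD (k := r)
        (differentiableAt_of_contDiffOn hW
          (contDiffOn_partialD hW (contDiffOn_apply hχ m) k) hy))
    exact h1.congr_deriv (by simp)
  have hpd : DifferentiableAt ℝ (fun y => momentumPullback χ y p) y :=
    differentiableAt_euclidean.2 fun k => (hd k).1
  have hpr : ∀ k, (fderiv ℝ (fun y => momentumPullback χ y p) y (EuclideanSpace.single r 1)) k =
      ∑ m, p m * partialD r (partialD k fun y => χ y m) y := fun k => by
    rw [← (hd k).2]
    exact ((hasPartialAt_partialD hpd).clm (EuclideanSpace.proj (𝕜 := ℝ) k)).2.symm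
  have h1 : HasFDerivAt (fun y => a y (momentumPullback χ y p)) _ y :=
    HasFDerivAt.comp (g := fun z : Coord n × Coord n => a z.1 z.2) y ha.hasFDerivAt
      ((hasFDerivAt_id y).prodMk hpd.hasFDerivAt)
  refine ⟨h1.differentiableAt, ?_⟩
  have h2 : HasFDerivAt (fun y' => a y' (momentumPullback χ y p)) _ y :=
    HasFDerivAt.comp (g := fun z : Coord n × Coord n => a z.1 z.2)
      (f := fun y' => (y', momentumPullback χ y p)) y ha.hasFDerivAt
      (hasFDerivAt_prodMk_left y (momentumPullback χ y p))
  have h3 : HasFDerivAt (fun p' => a y p') _ (momentumPullback χ y p) :=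
    HasFDerivAt.comp (g := fun z : Coord n × Coord n => a z.1 z.2) _ ha.hasFDerivAt
      (hasFDerivAt_prodMk_right y (momentumPullback χ y p))
  have h4 : ∀ v : Coord n, fderiv ℝ (fun z : Coord n × Coord n => a z.1 z.2)
      (y, momentumPullback χ y p) (0, v) =
      ∑ k, v k * partialD k (fun p' => a y p') (momentumPullback χ y p) := by
    intro v
    have h5 := fderiv_apply_eq_sum_partialD (fun p' => a y p') (momentumPullback χ y p) v
    rw [h3.fderiv] at h5
    simpa using h5
  conv_lhs => unfold partialD
  rw [h1.fderiv]
  have h6 : partialD r (fun y' => a y' (momentumPullback χ y p)) y =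
      fderiv ℝ (fun z : Coord n × Coord n => a z.1 z.2) (y, momentumPullback χ y p)
        (EuclideanSpace.single r 1, 0) := by
    unfold partialD
    rw [h2.fderiv]
    simp
  have h7 : ∀ k, partialD k (fun p' => a y p') (momentumPullback χ y p) *
      ∑ m, p m * partialD r (partialD k fun y => χ y m) y =
      (fderiv ℝ (fun y => momentumPullback χ y p) y (EuclideanSpace.single r 1)) k *
      partialD k (fun p' => a y p') (momentumPullback χ y p) := fun k => by
    rw [hpr, mul_comm]
  rw [h6, Finset.sum_congr rfl fun k _ => h7 k, ← h4, ← map_add]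
  simp

/-- `M` and `D` are inverse Jacobians and cancel in each product. The second-derivative terms cancel
between the two halves of the bracket because `S` is symmetric. -/
theorem bracket_sum_identity {M D S : Fin n → Fin n → ℝ} (hS : ∀ r k, S r k = S k r)
    (hMD : ∀ j r, ∑ i, M j i * D i r = if j = r then 1 else 0) (α β x z : Fin n → ℝ) :
    ∑ i, ((∑ j, M j i * α j) * (∑ r, D i r * (z r + ∑ k, β k * S r k)) -
      (∑ r, D i r * (x r + ∑ k, α k * S r k)) * (∑ j, M j i * β j)) =
    ∑ j, (α j * z j - x j * β j) := by
  have key : ∀ f h : Fin n → ℝ, ∑ i, (∑ j, M j i * f j) * (∑ r, D i r * h r) = ∑ j, f j * h j := by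
    intro f h
    simp only [Finset.sum_mul_sum]
    rw [Finset.sum_comm]
    refine Finset.sum_congr rfl fun j _ => ?_
    rw [Finset.sum_comm]
    have : ∀ r, ∑ i, M j i * f j * (D i r * h r) = if j = r then f j * h r else 0 := by
      intro r
      have h1 : ∀ i, M j i * f j * (D i r * h r) = f j * h r * (M j i * D i r) := fun i => by ring
      simp only [h1, ← Finset.mul_sum, hMD]
      simp
    simp [this]
  rw [Finset.sum_sub_distrib, key]
  simp only [mul_comm (∑ r, D _ r * _)]
  rw [key, ← Finset.sum_sub_distrib]
  have h1 : ∀ f h : Fin n → ℝ, ∑ j, f j * ∑ k, h k * S j k = ∑ j, h j * ∑ k, f k * S j k := by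
    intro f h
    simp only [Finset.mul_sum]
    rw [Finset.sum_comm]
    refine Finset.sum_congr rfl fun k _ => Finset.sum_congr rfl fun j _ => ?_
    rw [hS j k]; ring
  have h2 := h1 α β
  simp only [mul_add, Finset.sum_add_distrib, Finset.sum_sub_distrib, h2, mul_comm (x _)]
  ring

/-- The canonical bracket is invariant under the transformations of the momenta that are induced by
changes of coordinates. -/
theorem canonicalBracket_lift {χ τ : Coord n → Coord n} {W W' : Set (Coord n)} (hW : IsOpen W)
    (hW' : IsOpen W') (hχ : ContDiffOn ℝ ∞ χ W) (hτ : ContDiffOn ℝ ∞ τ W')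
    (hτW : ∀ y ∈ W', τ y ∈ W) (hτχ : ∀ y ∈ W, τ (χ y) = y) (hχτ : ∀ y ∈ W', χ (τ y) = y)
    {a b a' b' : Coord n → Coord n → ℝ} {y p : Coord n} (hy : y ∈ W')
    (ha : DifferentiableAt ℝ (fun z : Coord n × Coord n => a z.1 z.2)
      (τ y, momentumPullback χ (τ y) p))
    (hb : DifferentiableAt ℝ (fun z : Coord n × Coord n => b z.1 z.2)
      (τ y, momentumPullback χ (τ y) p))
    (ha' : ∀ y ∈ W', ∀ p, a' y p = a (τ y) (momentumPullback χ (τ y) p))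
    (hb' : ∀ y ∈ W', ∀ p, b' y p = b (τ y) (momentumPullback χ (τ y) p)) :
    canonicalBracket a' b' y p = canonicalBracket a b (τ y) (momentumPullback χ (τ y) p) := by
  have hτd : DifferentiableAt ℝ τ y := differentiableAt_of_contDiffOn hW' hτ hy
  have hχd : DifferentiableAt ℝ χ (τ y) := differentiableAt_of_contDiffOn hW hχ (hτW y hy)
  have hp : ∀ {a a' : Coord n → Coord n → ℝ}, DifferentiableAt ℝ
      (fun z : Coord n × Coord n => a z.1 z.2) (τ y, momentumPullback χ (τ y) p) →
      (∀ y ∈ W', ∀ p, a' y p = a (τ y) (momentumPullback χ (τ y) p)) → ∀ i,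
      partialD i (fun p' => a' y p') p = ∑ j, partialD j (fun y => χ y i) (τ y) *
        partialD j (fun p' => a (τ y) p') (momentumPullback χ (τ y) p) := by
    intro a a' ha ha' i
    rw [show (fun p' => a' y p') = fun p' => a (τ y) (momentumPullback χ (τ y) p') from
      funext fun p' => ha' y hy p']
    exact partialD_momentumPullback_snd χ (a := fun p' => a (τ y) p')
      (ha.comp (momentumPullback χ (τ y) p)
        (f := fun p' => (τ y, p')) (by fun_prop)) i
  have hq : ∀ {a a' : Coord n → Coord n → ℝ}, DifferentiableAt ℝ
      (fun z : Coord n × Coord n => a z.1 z.2) (τ y, momentumPullback χ (τ y) p) →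
      (∀ y ∈ W', ∀ p, a' y p = a (τ y) (momentumPullback χ (τ y) p)) → ∀ i,
      partialD i (fun y' => a' y' p) y = ∑ r, partialD i (fun y => τ y r) y *
        (partialD r (fun y' => a y' (momentumPullback χ (τ y) p)) (τ y) +
        ∑ k, partialD k (fun p' => a (τ y) p') (momentumPullback χ (τ y) p) *
          ∑ m, p m * partialD r (partialD k fun y => χ y m) (τ y)) := by
    intro a a' ha ha' i
    rw [partialD_congr_of_eqOn (g := fun y' => a (τ y') (momentumPullback χ (τ y') p)) hW'
      (fun y' hy' => ha' y' hy' p) hy]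
    have h1 := partialD_lift hW hχ (hτW y hy) ha
    rw [partialD_comp (F := fun y => a y (momentumPullback χ y p)) (h1 i).1 hτd]
    exact Finset.sum_congr rfl fun r _ => by rw [(h1 r).2]
  unfold canonicalBracket
  simp only [hp ha ha', hp hb hb', hq ha ha', hq hb hb']
  refine bracket_sum_identity (M := fun j i => partialD j (fun y => χ y i) (τ y))
    (D := fun i r => partialD i (fun y => τ y r) y)
    (S := fun r k => ∑ m, p m * partialD r (partialD k fun y => χ y m) (τ y))
    (fun r k => Finset.sum_congr rfl fun m _ => by
      rw [partialD_comm hW (contDiffOn_apply hχ m) r k (hτW y hy)]) (fun j r => ?_) _ _ _ _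
  -- The Jacobians are inverse by the chain rule for τ ∘ χ = id.
  have h1 := partialD_comp (F := fun y => τ y r) (τ := χ) (y := τ y)
    (by rw [hχτ y hy]; exact differentiableAt_of_contDiffOn hW' (contDiffOn_apply hτ r) hy) hχd j
  rw [hχτ y hy] at h1
  rw [← h1, partialD_congr_of_eqOn (g := fun y => y r) hW
    (fun y hy => by simp only [hτχ y hy]) (hτW y hy)]
  have h2 := (hasPartialAt_coord (y := τ y) j r (hasDerivAt_id (τ y r))).2
  simp only [id] at h2
  rw [h2]
  simp [eq_comm]

/-- The bracket of two diagonal quadratic forms in the momenta. -/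
theorem canonicalBracket_diag {Ω : Set (Coord n)} (hΩ : IsOpen Ω) {k l : Fin n → Coord n → ℝ}
    (hk : ∀ i, ContDiffOn ℝ ∞ (k i) Ω) (hl : ∀ i, ContDiffOn ℝ ∞ (l i) Ω)
    {a b : Coord n → Coord n → ℝ} (ha : ∀ y ∈ Ω, ∀ p, a y p = ∑ i, k i y * p i ^ 2)
    (hb : ∀ y ∈ Ω, ∀ p, b y p = ∑ i, l i y * p i ^ 2) {y : Coord n} (hy : y ∈ Ω) (p : Coord n) :
    canonicalBracket a b y p = ∑ j, (2 * k j y * p j * ∑ i, partialD j (l i) y * p i ^ 2 -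
      (∑ i, partialD j (k i) y * p i ^ 2) * (2 * l j y * p j)) := by
  have h1 : ∀ {k : Fin n → Coord n → ℝ} {a : Coord n → Coord n → ℝ},
      (∀ y ∈ Ω, ∀ p, a y p = ∑ i, k i y * p i ^ 2) → ∀ j,
      partialD j (fun p' => a y p') p = 2 * k j y * p j := by
    intro k a ha j
    rw [show (fun p' => a y p') = fun p' => ∑ i, k i y * p' i ^ 2 from
      funext fun p' => ha y hy p']
    have h2 := (HasPartialAt.sum (s := Finset.univ) fun i _ => (hasPartialAt_const j (k i y) p).mul
      (hasPartialAt_coord (y := p) j i ((hasDerivAt_id (p i)).pow 2))).2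
    refine h2.trans ?_
    simp
    ring
  have h2 : ∀ {k : Fin n → Coord n → ℝ} {a : Coord n → Coord n → ℝ},
      (∀ i, ContDiffOn ℝ ∞ (k i) Ω) →
      (∀ y ∈ Ω, ∀ p, a y p = ∑ i, k i y * p i ^ 2) → ∀ j,
      partialD j (fun y' => a y' p) y = ∑ i, partialD j (k i) y * p i ^ 2 := by
    intro k a hk ha j
    rw [partialD_congr_of_eqOn (g := fun y' => ∑ i, k i y' * p i ^ 2) hΩ
      (fun y' hy' => ha y' hy' p) hy]
    have h3 := (HasPartialAt.sum (s := Finset.univ) fun i _ => (hasPartialAt_partialD (k := j)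
      (differentiableAt_of_contDiffOn hΩ (hk i) hy)).mul (hasPartialAt_const j (p i ^ 2) y)).2
    refine h3.trans ?_
    simp
  unfold canonicalBracket
  simp only [h1 ha, h1 hb, h2 hk ha, h2 hl hb]

end CanonicalBracket

end FER

/-! ### Coordinate forms and vectors, and their behaviour under a change of chart. -/

namespace FER

variable {n : ℕ} {Q : Type*} [TopologicalSpace Q] [ChartedSpace (Coord n) Q]

/-- The coordinate vector `∂/∂qʲ` at `x`. -/
def coordVec (q : OpenPartialHomeomorph Q (Coord n)) (j : Fin n) (x : Q) : TangentSpace (𝓡 n) x :=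
  id (α := Coord n) (mfderiv (𝓡 n) (𝓡 n) q.symm (q x) (EuclideanSpace.single j (1 : ℝ)))

theorem mdifferentiableAt_coord {q : OpenPartialHomeomorph Q (Coord n)}
    (hq : IsCoordinateSystem q) {x : Q} (hx : x ∈ q.source) :
    MDifferentiableAt (𝓡 n) (𝓡 n) q x :=
  ((contMDiffOn_of_mem_maximalAtlas hq).contMDiffAt (q.open_source.mem_nhds hx)).mdifferentiableAt
    (by simp)

theorem mdifferentiableAt_coord_symm {q : OpenPartialHomeomorph Q (Coord n)}
    (hq : IsCoordinateSystem q) {y : Coord n} (hy : y ∈ q.target) :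
    MDifferentiableAt (𝓡 n) (𝓡 n) q.symm y :=
  ((contMDiffOn_symm_of_mem_maximalAtlas hq).contMDiffAt
    (q.open_target.mem_nhds hy)).mdifferentiableAt (by simp)

theorem coordForm_apply {q : OpenPartialHomeomorph Q (Coord n)}
    (hq : IsCoordinateSystem q) {x : Q} (hx : x ∈ q.source) (i : Fin n)
    (v : TangentSpace (𝓡 n) x) :
    coordForm q i x v = EuclideanSpace.proj (𝕜 := ℝ) i (mfderiv (𝓡 n) (𝓡 n) q x v) := by
  have h1 : HasMFDerivAt (𝓡 n) 𝓘(ℝ, ℝ) (fun z : Q => q z i) x _ :=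
    ((EuclideanSpace.proj (𝕜 := ℝ) i).hasMFDerivAt (x := q x)).comp x
      (mdifferentiableAt_coord hq hx).hasMFDerivAt
  unfold coordForm
  rw [h1.mfderiv]
  rfl

theorem contDiffOn_transition {q q' : OpenPartialHomeomorph Q (Coord n)}
    (hq : IsCoordinateSystem q) (hq' : IsCoordinateSystem q') :
    ContDiffOn ℝ ∞ (fun y => q' (q.symm y)) (q.target ∩ q.symm ⁻¹' q'.source) := by
  have h1 : ContMDiffOn (𝓡 n) (𝓡 n) ∞ (q' ∘ q.symm) (q.target ∩ q.symm ⁻¹' q'.source) :=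
    (contMDiffOn_of_mem_maximalAtlas hq').comp
      ((contMDiffOn_symm_of_mem_maximalAtlas hq).mono Set.inter_subset_left)
      Set.inter_subset_right
  exact contMDiffOn_iff_contDiffOn.1 h1

theorem mfderiv_coord_symm {q q' : OpenPartialHomeomorph Q (Coord n)}
    (hq : IsCoordinateSystem q) (hq' : IsCoordinateSystem q') {y : Coord n} (hy : y ∈ q.target)
    (hy' : q.symm y ∈ q'.source) (j i : Fin n) :
    coordForm q' i (q.symm y) (mfderiv (𝓡 n) (𝓡 n) q.symm y (EuclideanSpace.single j (1 : ℝ))) =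
      partialD j (fun y => q' (q.symm y) i) y := by
  rw [coordForm_apply hq' hy']
  have h1 : HasMFDerivAt (𝓡 n) (𝓡 n) (q' ∘ q.symm) y _ :=
    (mdifferentiableAt_coord hq' hy').hasMFDerivAt.comp y
      (mdifferentiableAt_coord_symm hq hy).hasMFDerivAt
  have hd : DifferentiableAt ℝ (fun y => q' (q.symm y)) y :=
    differentiableAt_of_contDiffOn (q.isOpen_inter_preimage_symm q'.open_source)
      (contDiffOn_transition hq hq') ⟨hy, hy'⟩
  have h3 := ((hasPartialAt_partialD (k := j) hd).clm (EuclideanSpace.proj (𝕜 := ℝ) i)).2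
  refine Eq.trans ?_ h3.symm
  refine congrArg (EuclideanSpace.proj (𝕜 := ℝ) i) ?_
  have h4 : fderiv ℝ (q' ∘ q.symm) y = mfderiv (𝓡 n) (𝓡 n) (q' ∘ q.symm) y :=
    mfderiv_eq_fderiv.symm
  rw [h1.mfderiv] at h4
  exact (congrArg (fun L : Coord n →L[ℝ] Coord n => L (EuclideanSpace.single j 1)) h4).symm

theorem coordForm_coordVec {q q' : OpenPartialHomeomorph Q (Coord n)}
    (hq : IsCoordinateSystem q) (hq' : IsCoordinateSystem q') {x : Q} (hx : x ∈ q.source)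
    (hx' : x ∈ q'.source) (j i : Fin n) :
    coordForm q' i x (coordVec q j x) = partialD j (fun y => q' (q.symm y) i) (q x) := by
  have h1 := mfderiv_coord_symm hq hq' (q.map_source hx) (by rwa [q.left_inv hx]) j i
  rw [← h1]
  have h2 : ∀ z, z = x → ∀ w : Coord n, coordForm q' i x w = coordForm q' i z w := by
    rintro z rfl w
    rfl
  exact h2 _ (q.left_inv hx) _

theorem coordForm_coordVec_self {q : OpenPartialHomeomorph Q (Coord n)}
    (hq : IsCoordinateSystem q) {x : Q} (hx : x ∈ q.source) (j i : Fin n) :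
    coordForm q i x (coordVec q j x) = if i = j then 1 else 0 := by
  rw [coordForm_coordVec hq hq hx hx, partialD_congr_of_eqOn (g := fun y => y i) q.open_target
    (fun y hy => by simp only [q.right_inv hy]) (q.map_source hx)]
  exact (hasPartialAt_coord (y := q x) j i (hasDerivAt_id (q x i))).2

theorem exists_coordBasis {q : OpenPartialHomeomorph Q (Coord n)}
    (hq : IsCoordinateSystem q) {x : Q} (hx : x ∈ q.source) :
    ∃ b : Module.Basis (Fin n) ℝ (TangentSpace (𝓡 n) x), (∀ j, b j = coordVec q j x) ∧
      IsCoordBasis q x b := by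
  have hli : LinearIndependent ℝ fun j => coordVec q j x := by
    rw [Fintype.linearIndependent_iff]
    intro c hc i
    have h1 := congrArg (coordForm q i x) hc
    simpa [coordForm_coordVec_self hq hx] using h1
  have hfin : FiniteDimensional ℝ (TangentSpace (𝓡 n) x) :=
    inferInstanceAs (FiniteDimensional ℝ (Coord n))
  have hcard : Fintype.card (Fin n) = Module.finrank ℝ (TangentSpace (𝓡 n) x) :=
    (finrank_euclideanSpace (𝕜 := ℝ) (ι := Fin n)).symm
  have hb : ∀ j, basisOfLinearIndependentOfCardEqFinrank' _ hli hcard j = coordVec q j x :=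
    fun j => by simp
  refine ⟨basisOfLinearIndependentOfCardEqFinrank' _ hli hcard, hb, fun i j => ?_⟩
  rw [hb, coordForm_coordVec_self hq hx]

theorem cotangent_expansion {q : OpenPartialHomeomorph Q (Coord n)}
    (hq : IsCoordinateSystem q) {x : Q} (hx : x ∈ q.source) (α : Cotangent n x) :
    α = ∑ j, α (coordVec q j x) • coordForm q j x := by
  obtain ⟨b, hb, -⟩ := exists_coordBasis hq hx
  refine ContinuousLinearMap.coe_injective (b.ext fun j => ?_)
  rw [hb]
  simp [coordForm_coordVec_self hq hx]

theorem coordForm_transition {q q' : OpenPartialHomeomorph Q (Coord n)}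
    (hq : IsCoordinateSystem q) (hq' : IsCoordinateSystem q') {x : Q} (hx : x ∈ q.source)
    (hx' : x ∈ q'.source) (i : Fin n) :
    coordForm q' i x = ∑ j, partialD j (fun y => q' (q.symm y) i) (q x) • coordForm q j x := by
  conv_lhs => rw [cotangent_expansion hq hx (coordForm q' i x)]
  simp only [coordForm_coordVec hq hq' hx hx']

/-- A kernel vector v of the component matrix would make ∑ v_j dq^j a non-zero covector in the
radical of G. -/
theorem det_comp_ne_zero {q : OpenPartialHomeomorph Q (Coord n)}
    (hq : IsCoordinateSystem q) {G : TensorField n Q} (hG : IsMetric G) {y : Coord n}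
    (hy : y ∈ q.target) : (comp q G y).det ≠ 0 := by
  intro h0
  have hx := q.map_target hy
  obtain ⟨v, hv, hv0⟩ := Matrix.exists_mulVec_eq_zero_iff.2 h0
  have h1 : (∑ j, v j • coordForm q j (q.symm y)) = 0 := by
    refine hG.nondegenerate _ _ fun β => ?_
    rw [hG.symm, cotangent_expansion hq hx β]
    simp only [map_sum, map_smul, LinearMap.smul_apply, LinearMap.sum_apply, smul_eq_mul,
      Finset.mul_sum]
    rw [Finset.sum_comm]
    refine Finset.sum_eq_zero fun i _ => ?_
    have h2 := congrFun hv0 i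
    simp only [Matrix.mulVec, dotProduct, comp, Matrix.of_apply, Pi.zero_apply] at h2
    rw [← mul_zero (β (coordVec q i (q.symm y))), ← h2, Finset.mul_sum]
    exact Finset.sum_congr rfl fun j _ => by ring
  refine hv (funext fun i => ?_)
  have h2 := congrArg (fun L : Cotangent n (q.symm y) => L (coordVec q i (q.symm y))) h1
  simpa [coordForm_coordVec_self hq hx] using h2

end FER

/-! ### Diagonal tensors: smoothness, brackets, conformal Killing property, eigenvectors. -/

namespace FER

variable {n : ℕ} {Q : Type*} [TopologicalSpace Q] [ChartedSpace (Coord n) Q]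

theorem inCanonical_coord (q : OpenPartialHomeomorph Q (Coord n)) (A : CotangentFunction n Q)
    {x : Q} (hx : x ∈ q.source) (p : Coord n) :
    inCanonical q A (q x) p = A x (∑ i, p i • coordForm q i x) := by
  have h : ∀ z, z = x → A z (∑ i, p i • coordForm q i z) = A x (∑ i, p i • coordForm q i x) := by
    rintro z rfl
    rfl
  exact h _ (q.left_inv hx)

theorem sum_smul_coordForm_apply {q : OpenPartialHomeomorph Q (Coord n)}
    (hq : IsCoordinateSystem q) {x : Q} (hx : x ∈ q.source) (p : Fin n → ℝ) (j : Fin n) :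
    (∑ i, p i • coordForm q i x) (coordVec q j x) = p j := by
  simp [coordForm_coordVec_self hq hx]

theorem inCanonical_transition {q q' : OpenPartialHomeomorph Q (Coord n)}
    (hq : IsCoordinateSystem q) (hq' : IsCoordinateSystem q') (A : CotangentFunction n Q)
    {y : Coord n} (hy : y ∈ q'.target) (hy' : q'.symm y ∈ q.source) (p : Coord n) :
    inCanonical q' A y p = inCanonical q A (q (q'.symm y))
      (momentumPullback (fun y => q' (q.symm y)) (q (q'.symm y)) p) := by
  rw [inCanonical_coord q A hy']
  unfold inCanonical
  congr 1
  simp only [coordForm_transition hq hq' hy' (q'.map_target hy), Finset.smul_sum]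
  rw [Finset.sum_comm]
  refine Finset.sum_congr rfl fun j _ => ?_
  simp only [momentumPullback, Finset.sum_smul, smul_smul]

/-- Involution and the conformal Killing equation are required in every chart; this reduces them to
the separable one. -/
theorem poissonBracket_transition {q q' : OpenPartialHomeomorph Q (Coord n)}
    (hq : IsCoordinateSystem q) (hq' : IsCoordinateSystem q') {A B : CotangentFunction n Q}
    {y : Coord n} (hy : y ∈ q'.target) (hy' : q'.symm y ∈ q.source)
    (hA : ∀ p, DifferentiableAt ℝ (fun z : Coord n × Coord n => inCanonical q A z.1 z.2)
      (q (q'.symm y), p))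
    (hB : ∀ p, DifferentiableAt ℝ (fun z : Coord n × Coord n => inCanonical q B z.1 z.2)
      (q (q'.symm y), p)) (p : Coord n) :
    poissonBracket q' A B y p = poissonBracket q A B (q (q'.symm y))
      (momentumPullback (fun y => q' (q.symm y)) (q (q'.symm y)) p) :=
  canonicalBracket_lift (W := q.target ∩ q.symm ⁻¹' q'.source)
    (W' := q'.target ∩ q'.symm ⁻¹' q.source) (q.isOpen_inter_preimage_symm q'.open_source)
    (q'.isOpen_inter_preimage_symm q.open_source) (contDiffOn_transition hq hq')
    (contDiffOn_transition hq' hq)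
    (fun z hz => ⟨q.map_source hz.2, by
      simpa [q.left_inv hz.2] using q'.map_target hz.1⟩)
    (fun z hz => by
      have h2 : q.symm z ∈ q'.source := hz.2
      simp only [q'.left_inv h2, q.right_inv hz.1])
    (fun z hz => by
      have h2 : q'.symm z ∈ q.source := hz.2
      simp only [q.left_inv h2, q'.right_inv hz.1])
    ⟨hy, hy'⟩ (hA _) (hB _) (fun _ hz _ => inCanonical_transition hq hq' A hz.1 hz.2 _)
    (fun _ hz _ => inCanonical_transition hq hq' B hz.1 hz.2 _)

/-- `K` is diagonal in the coordinates `q`, with the components `k`. -/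
def IsDiagonal (q : OpenPartialHomeomorph Q (Coord n)) (K : TensorField n Q)
    (k : Fin n → Coord n → ℝ) : Prop :=
  ∀ x ∈ q.source, ∀ α β : Cotangent n x,
    K x α β = ∑ i, k i (q x) * (α (coordVec q i x) * β (coordVec q i x))

/-- The tensor field with the diagonal components `k` in the coordinates `q`. -/
def diagonalTensor (q : OpenPartialHomeomorph Q (Coord n)) (k : Fin n → Coord n → ℝ) :
    TensorField n Q := fun x =>
  ∑ i, k i (q x) • LinearMap.mk₂ ℝ
    (fun α β : Cotangent n x => α (coordVec q i x) * β (coordVec q i x))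
    (fun _ _ _ => by simp [add_mul]) (fun _ _ _ => by simp [mul_assoc])
    (fun _ _ _ => by simp [mul_add]) (fun _ _ _ => by simp [mul_left_comm])

theorem isDiagonal_diagonalTensor (q : OpenPartialHomeomorph Q (Coord n))
    (k : Fin n → Coord n → ℝ) : IsDiagonal q (diagonalTensor q k) k := fun x _ α β => by
  simp [diagonalTensor]

theorem isDiagonal_of_comp {q : OpenPartialHomeomorph Q (Coord n)} (hq : IsCoordinateSystem q)
    {G : TensorField n Q} (h : ∀ y ∈ q.target, ∀ i j, i ≠ j → comp q G y i j = 0) :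
    IsDiagonal q G fun i y => comp q G y i i := by
  intro x hx α β
  have h1 : ∀ i j, comp q G (q x) i j = G x (coordForm q i x) (coordForm q j x) := by
    intro i j
    have h2 : ∀ z, z = x → G z (coordForm q i z) (coordForm q j z) =
        G x (coordForm q i x) (coordForm q j x) := by
      rintro z rfl
      rfl
    exact h2 _ (q.left_inv hx)
  conv_lhs => rw [cotangent_expansion hq hx α, cotangent_expansion hq hx β]
  simp only [map_sum, map_smul, LinearMap.smul_apply, LinearMap.sum_apply, smul_eq_mul, ← h1]
  refine Finset.sum_congr rfl fun i _ => ?_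
  rw [Finset.sum_eq_single i (fun j _ hji => by
    rw [h _ (q.map_source hx) _ _ (by tauto)]; simp) (by simp)]
  ring

namespace IsDiagonal

variable {q : OpenPartialHomeomorph Q (Coord n)} {K L : TensorField n Q}
  {k l : Fin n → Coord n → ℝ}

theorem isSmoothOn (H : IsDiagonal q K k) (hq : IsCoordinateSystem q)
    (hk : ∀ i, ContDiffOn ℝ ∞ (k i) q.target) : IsSmoothOn K q.source := by
  intro q' hq' i j
  set χ : Coord n → Coord n := fun y => q' (q.symm y)
  have hτ := contDiffOn_transition hq' hq
  have hχ : ∀ i l, ContDiffOn ℝ ∞ (partialD l fun y => χ y i) (q.target ∩ q.symm ⁻¹' q'.source) :=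
    fun i l => contDiffOn_partialD (q.isOpen_inter_preimage_symm q'.open_source)
      (contDiffOn_apply (contDiffOn_transition hq hq') i) l
  have hmaps : Set.MapsTo (fun y => q (q'.symm y)) (q'.target ∩ q'.symm ⁻¹' q.source)
      (q.target ∩ q.symm ⁻¹' q'.source) := fun z hz => ⟨q.map_source hz.2, by
      have h2 : q'.symm z ∈ q.source := hz.2
      simpa [q.left_inv h2] using q'.map_target hz.1⟩
  have h1 : ContDiffOn ℝ ∞ (fun y => ∑ m, k m (q (q'.symm y)) *
      (partialD m (fun y => χ y i) (q (q'.symm y)) * partialD m (fun y => χ y j) (q (q'.symm y))))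
      (q'.target ∩ q'.symm ⁻¹' q.source) :=
    ContDiffOn.sum fun m _ => ((hk m).comp hτ fun z hz => (hmaps hz).1).mul
      (((hχ i m).comp hτ hmaps).mul ((hχ j m).comp hτ hmaps))
  refine h1.congr fun y hy => ?_
  have hx' := q'.map_target hy.1
  simp only [comp, Matrix.of_apply, H _ hy.2, coordForm_coordVec hq hq' hy.2 hx']
  rfl

theorem symm_apply (H : IsDiagonal q K k) {x : Q} (hx : x ∈ q.source) (α β : Cotangent n x) :
    K x α β = K x β α := by
  rw [H x hx, H x hx]
  exact Finset.sum_congr rfl fun i _ => by ring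

theorem inCanonical_eq (H : IsDiagonal q K k) (hq : IsCoordinateSystem q) {y : Coord n}
    (hy : y ∈ q.target) (p : Coord n) :
    inCanonical q (momentumPoly K) y p = ∑ i, k i y * p i ^ 2 := by
  unfold inCanonical momentumPoly
  rw [H _ (q.map_target hy), q.right_inv hy]
  simp only [sum_smul_coordForm_apply hq (q.map_target hy), sq]

theorem differentiableAt_inCanonical (H : IsDiagonal q K k) (hq : IsCoordinateSystem q)
    (hk : ∀ i, ContDiffOn ℝ ∞ (k i) q.target) {y : Coord n} (hy : y ∈ q.target) (p : Coord n) :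
    DifferentiableAt ℝ (fun z : Coord n × Coord n => inCanonical q (momentumPoly K) z.1 z.2)
      (y, p) := by
  have h1 : (fun z : Coord n × Coord n => inCanonical q (momentumPoly K) z.1 z.2) =ᶠ[nhds (y, p)]
      fun z => ∑ i, k i z.1 * z.2 i ^ 2 := by
    filter_upwards [(q.open_target.prod isOpen_univ).mem_nhds
      (show (y, p) ∈ q.target ×ˢ Set.univ from ⟨hy, trivial⟩)] with z hz
    exact H.inCanonical_eq hq hz.1 z.2
  refine DifferentiableAt.congr_of_eventuallyEq ?_ h1
  have h2 : ∀ i, DifferentiableAt ℝ (fun z : Coord n × Coord n => k i z.1) (y, p) := fun i =>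
    (differentiableAt_of_contDiffOn q.open_target (hk i) hy).comp (y, p) differentiableAt_fst
  have h3 : ∀ i, DifferentiableAt ℝ (fun z : Coord n × Coord n => z.2 i) (y, p) := fun i =>
    (EuclideanSpace.proj (𝕜 := ℝ) i).differentiableAt.comp (y, p) differentiableAt_snd
  exact DifferentiableAt.fun_sum fun i _ => (h2 i).mul ((h3 i).pow 2)

theorem poissonBracket_eq (HK : IsDiagonal q K k) (HL : IsDiagonal q L l)
    (hq : IsCoordinateSystem q) (hk : ∀ i, ContDiffOn ℝ ∞ (k i) q.target)
    (hl : ∀ i, ContDiffOn ℝ ∞ (l i) q.target) {y : Coord n} (hy : y ∈ q.target) (p : Coord n) :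
    poissonBracket q (momentumPoly K) (momentumPoly L) y p =
      ∑ j, (2 * k j y * p j * ∑ i, partialD j (l i) y * p i ^ 2 -
      (∑ i, partialD j (k i) y * p i ^ 2) * (2 * l j y * p j)) :=
  canonicalBracket_diag q.open_target hk hl (fun _ hy p => HK.inCanonical_eq hq hy p)
    (fun _ hy p => HL.inCanonical_eq hq hy p) hy p

theorem poissonBracket_transition (HK : IsDiagonal q K k) (HL : IsDiagonal q L l)
    (hq : IsCoordinateSystem q) (hk : ∀ i, ContDiffOn ℝ ∞ (k i) q.target)
    (hl : ∀ i, ContDiffOn ℝ ∞ (l i) q.target) {q' : OpenPartialHomeomorph Q (Coord n)}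
    (hq' : IsCoordinateSystem q') {y : Coord n} (hy : y ∈ q'.target)
    (hy' : q'.symm y ∈ q.source) (p : Coord n) :
    poissonBracket q' (momentumPoly K) (momentumPoly L) y p =
      poissonBracket q (momentumPoly K) (momentumPoly L) (q (q'.symm y))
        (momentumPullback (fun y => q' (q.symm y)) (q (q'.symm y)) p) :=
  FER.poissonBracket_transition hq hq' hy hy'
    (HK.differentiableAt_inCanonical hq hk (q.map_source hy'))
    (HL.differentiableAt_inCanonical hq hl (q.map_source hy')) p

/-- Diagonal tensors whose components satisfy the equations `∂ⱼkᵢ = kⱼ tⱼᵢ` with the same `t` are in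
involution. -/
theorem poissonCommuteOn (HK : IsDiagonal q K k) (HL : IsDiagonal q L l)
    (hq : IsCoordinateSystem q) (hk : ∀ i, ContDiffOn ℝ ∞ (k i) q.target)
    (hl : ∀ i, ContDiffOn ℝ ∞ (l i) q.target)
    (ht : ∀ y ∈ q.target, ∃ t : Fin n → Fin n → ℝ, ∀ j i,
      partialD j (k i) y = k j y * t j i ∧ partialD j (l i) y = l j y * t j i) :
    PoissonCommuteOn q.source (momentumPoly K) (momentumPoly L) := by
  intro q' hq' y hy hy' p
  rw [HK.poissonBracket_transition HL hq hk hl hq' hy hy',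
    HK.poissonBracket_eq HL hq hk hl (q.map_source hy')]
  obtain ⟨t, ht⟩ := ht _ (q.map_source hy')
  refine Finset.sum_eq_zero fun j _ => ?_
  -- Both products become 2 k_j l_j p_j ∑ t_{ji} p_i².
  simp only [fun i => (ht j i).1, fun i => (ht j i).2, mul_assoc, ← Finset.mul_sum]
  ring

/-- A diagonal tensor in involution with `G / σ` is a conformal Killing tensor of `G`. -/
theorem isConformalKillingOn (HK : IsDiagonal q K k) {G : TensorField n Q}
    {g : Fin n → Coord n → ℝ} (HG : IsDiagonal q G g) (hq : IsCoordinateSystem q)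
    (hk : ∀ i, ContDiffOn ℝ ∞ (k i) q.target) (hl : ∀ i, ContDiffOn ℝ ∞ (l i) q.target)
    (ht : ∀ y ∈ q.target, ∃ t : Fin n → Fin n → ℝ, ∀ j i,
      partialD j (k i) y = k j y * t j i ∧ partialD j (l i) y = l j y * t j i)
    {σ : Coord n → ℝ} (hσ : ContDiffOn ℝ ∞ σ q.target) (hσ0 : ∀ y ∈ q.target, σ y ≠ 0)
    (hlσ : ∀ y ∈ q.target, ∀ i, l i y = g i y / σ y) :
    IsConformalKillingOn G q.source K := by
  have hgl : ∀ i, Set.EqOn (g i) (fun y => σ y * l i y) q.target := fun i y hy => by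
    simp only [hlσ y hy i]
    rw [mul_div_cancel₀ _ (hσ0 y hy)]
  have hg : ∀ i, ContDiffOn ℝ ∞ (g i) q.target := fun i => (hσ.mul (hl i)).congr (hgl i)
  -- As P_G = σ P_L on the chart and {P_K, P_L} = 0, the bracket {P_K, P_G} equals {P_K, σ} P_G / σ.
  -- The vector field is therefore the one with P_X = {P_K, σ}/σ.
  refine ⟨HK.isSmoothOn hq hk, fun x hx α β => HK.symm_apply hx α β,
    fun x => ∑ j, (2 * k j (q x) * partialD j σ (q x) / σ (q x)) • coordVec q j x, ?_⟩
  intro q' hq' y hy hy' p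
  rw [inCanonical_transition hq hq' (momentumPoly G) hy hy',
    inCanonical_transition hq hq' _ hy hy', HK.poissonBracket_transition HG hq hk hg hq' hy hy',
    HK.poissonBracket_eq HG hq hk hg (q.map_source hy'), HG.inCanonical_eq hq (q.map_source hy'),
    inCanonical_coord q _ hy']
  set P := momentumPullback (fun y => q' (q.symm y)) (q (q'.symm y)) p
  set x := q'.symm y
  have hx : q x ∈ q.target := q.map_source hy'
  obtain ⟨t, ht⟩ := ht _ hx
  have hdg : ∀ j i, partialD j (g i) (q x) =
      partialD j σ (q x) * l i (q x) + σ (q x) * (l j (q x) * t j i) := by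
    intro j i
    rw [partialD_congr_of_eqOn q.open_target (hgl i) hx, ← (ht j i).2]
    exact ((hasPartialAt_partialD (differentiableAt_of_contDiffOn q.open_target hσ hx)).mul
      (hasPartialAt_partialD (differentiableAt_of_contDiffOn q.open_target (hl i) hx))).2
  rw [map_sum, Finset.sum_mul]
  refine Finset.sum_congr rfl fun j _ => ?_
  rw [map_smul, sum_smul_coordForm_apply hq hy', smul_eq_mul]
  have h1 : ∑ i, partialD j (g i) (q x) * P i ^ 2 =
      partialD j σ (q x) * (∑ i, l i (q x) * P i ^ 2) +
        σ (q x) * l j (q x) * ∑ i, t j i * P i ^ 2 := by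
    rw [Finset.mul_sum, Finset.mul_sum, ← Finset.sum_add_distrib]
    exact Finset.sum_congr rfl fun i _ => by rw [hdg]; ring
  have h2 : ∑ i, partialD j (k i) (q x) * P i ^ 2 = k j (q x) * ∑ i, t j i * P i ^ 2 := by
    rw [Finset.mul_sum]
    exact Finset.sum_congr rfl fun i _ => by rw [(ht j i).1]; ring
  have h3 : ∑ i, g i (q x) * P i ^ 2 = σ (q x) * ∑ i, l i (q x) * P i ^ 2 := by
    rw [Finset.mul_sum]
    exact Finset.sum_congr rfl fun i _ => by rw [hgl i hx]; ring
  rw [h1, h2, h3, hgl j hx]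
  field_simp [hσ0 _ hx]
  ring

theorem isEigenvectorAt (HK : IsDiagonal q K k) {G : TensorField n Q} {g : Fin n → Coord n → ℝ}
    (HG : IsDiagonal q G g) (hq : IsCoordinateSystem q) {x : Q} (hx : x ∈ q.source) (i : Fin n)
    (hg : g i (q x) ≠ 0) : IsEigenvectorAt G K x (coordVec q i x) := by
  -- The form metrically dual to ∂/∂q^i is dq^i / g^{ii}, because the metric is diagonal.
  refine ⟨fun h0 => ?_, (g i (q x))⁻¹ • coordForm q i x, k i (q x) / g i (q x), fun β => ?_,
    fun β => ?_⟩
  · have h1 := coordForm_coordVec_self hq hx i i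
    rw [h0] at h1
    simp at h1
  · rw [HG x hx]
    simp [coordForm_coordVec_self hq hx, hg]
  · rw [HK x hx]
    simp [coordForm_coordVec_self hq hx]
    ring

end IsDiagonal

end FER

/-! ### From the Schrödinger equation to the equation for u and v. -/

namespace FER

section ProductSolutions

variable {n N : ℕ} {𝕜 : Type*} [RCLike 𝕜]

theorem contDiffOn_deriv_slice_left {f : ℝ → (Fin N → ℝ) → 𝕜} {T : Set ℝ}
    {C : Set (Fin N → ℝ)} (hT : IsOpen T) (hC : IsOpen C)
    (hf : ContDiffOn ℝ ∞ (fun z : ℝ × (Fin N → ℝ) => f z.1 z.2) (T ×ˢ C)) :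
    ContDiffOn ℝ ∞ (fun z : ℝ × (Fin N → ℝ) => deriv (fun t => f t z.2) z.1) (T ×ˢ C) := by
  have hTC : IsOpen (T ×ˢ C) := hT.prod hC
  have h1 : ContDiffOn ℝ ∞ (fun z => fderiv ℝ (fun z : ℝ × (Fin N → ℝ) => f z.1 z.2) z (1, 0))
      (T ×ˢ C) := (hf.fderiv_of_isOpen hTC (by simp)).clm_apply contDiffOn_const
  refine h1.congr fun z hz => ?_
  have h3 := (differentiableAt_of_contDiffOn hTC hf (y := z) hz).hasFDerivAt
  have h4 : HasDerivAt (fun t => f t z.2) _ z.1 :=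
    (HasFDerivAt.comp (f := fun t => (t, z.2)) z.1 h3
      (hasFDerivAt_prodMk_left z.1 z.2)).hasDerivAt
  rw [h4.deriv]
  simp

theorem hasPartialAt_prod {ι : Type*} (s : Finset ι) {f : ι → Coord n → 𝕜} {a : ι → 𝕜}
    {y : Coord n} {k : Fin n} (hf : ∀ i, HasPartialAt k (f i) (a i) y) (h0 : ∀ i, f i y ≠ 0) :
    HasPartialAt k (fun y => ∏ i ∈ s, f i y) ((∑ i ∈ s, a i / f i y) * ∏ i ∈ s, f i y) y := by
  classical
  induction s using Finset.induction_on with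
  | empty => simpa using hasPartialAt_const k (1 : 𝕜) y
  | insert i s hi ih =>
    simp only [Finset.prod_insert hi, Finset.sum_insert hi]
    refine ((hf i).mul ih).congr_deriv ?_
    field_simp [h0 i]

theorem hasPartialAt_prod_coord {φ : Fin n → ℝ → 𝕜} {y : Coord n} (k : Fin n)
    (hd : ∀ i, DifferentiableAt ℝ (φ i) (y i)) (h0 : ∀ i, φ i (y i) ≠ 0) :
    HasPartialAt k (fun y => ∏ i, φ i (y i))
      (deriv (φ k) (y k) / φ k (y k) * ∏ i, φ i (y i)) y := by
  refine (hasPartialAt_prod Finset.univ (f := fun i y => φ i (y i))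
    (fun i => hasPartialAt_coord k i (hd i).hasDerivAt) h0).congr_deriv ?_
  congr 1
  rw [Finset.sum_eq_single k (fun i _ hik => by simp [hik]) (by simp)]
  simp

/-- The product rule for Δ(rP) with ∂_i P = u_i P. The two mixed terms agree by the symmetry of `m`,
which gives the factor 2 in the coefficient of u_i. -/
theorem laplacian_product_algebra {m : Fin n → Fin n → 𝕜} (hm : ∀ i j, m i j = m j i)
    {r : 𝕜} (hr : r ≠ 0) (dr Γ : Fin n → 𝕜) (ddr : Fin n → Fin n → 𝕜) (u v : Fin n → 𝕜) (P : 𝕜) :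
    ∑ i, ∑ j, m i j * (ddr i j * P + dr j * (u i * P) +
        (dr i * (u j * P) + r * ((if i = j then v i else u i * u j) * P))) -
      ∑ l, Γ l * (dr l * P + r * (u l * P)) =
    r * P * sepForm m (fun i => 2 * (∑ j, m i j * (dr j / r)) - Γ i)
      ((∑ i, ∑ j, m i j * ddr i j - ∑ l, Γ l * dr l) / r) u v := by
  have hsw : ∑ i, ∑ j, m i j * (dr i * (u j * P)) = ∑ i, ∑ j, m i j * (dr j * (u i * P)) := by
    rw [Finset.sum_comm]
    exact Finset.sum_congr rfl fun i _ => Finset.sum_congr rfl fun j _ => by rw [hm]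
  have h1 : r * P * ∑ i, (2 * (∑ j, m i j * (dr j / r)) - Γ i) * u i =
      2 * ∑ i, ∑ j, m i j * (dr j * (u i * P)) - ∑ i, Γ i * (r * (u i * P)) := by
    rw [Finset.mul_sum, Finset.mul_sum, ← Finset.sum_sub_distrib]
    refine Finset.sum_congr rfl fun i _ => ?_
    have h2 : ∑ j, m i j * (dr j * (u i * P)) = r * (u i * P) * ∑ j, m i j * (dr j / r) := by
      rw [Finset.mul_sum]
      exact Finset.sum_congr rfl fun j _ => by field_simp
    rw [h2]; ring
  have h2 : r * P * ((∑ i, ∑ j, m i j * ddr i j - ∑ l, Γ l * dr l) / r) =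
      ∑ i, ∑ j, m i j * (ddr i j * P) - ∑ l, Γ l * (dr l * P) := by
    simp only [← mul_assoc, ← Finset.sum_mul]
    field_simp
  have h3 : r * P * ∑ i, ∑ j, m i j * (if i = j then v i else u i * u j) =
      ∑ i, ∑ j, m i j * (r * ((if i = j then v i else u i * u j) * P)) := by
    simp only [Finset.mul_sum]
    exact Finset.sum_congr rfl fun i _ => Finset.sum_congr rfl fun j _ => by ring
  rw [sepForm, mul_add, mul_add, h1, h2, h3]
  simp only [mul_add, Finset.sum_add_distrib, hsw]
  ring

end ProductSolutions

section Schrodinger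

theorem isOpen_coordRange {n : ℕ} {Q : Type*} [TopologicalSpace Q]
    (q : OpenPartialHomeomorph Q (Coord n)) (i : Fin n) :
    IsOpen (coordRange q i) :=
  (EuclideanSpace.proj (𝕜 := ℝ) (ι := Fin n) i).isOpenMap
    (fun t => ⟨EuclideanSpace.single i t, by simp⟩) _ q.open_target

variable {n : ℕ} {Q : Type*} [TopologicalSpace Q] [ChartedSpace (Coord n) Q]

theorem contDiffOn_comp {q : OpenPartialHomeomorph Q (Coord n)} (hq : IsCoordinateSystem q)
    {G : TensorField n Q} (hG : IsMetric G) (i j : Fin n) :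
    ContDiffOn ℝ ∞ (fun y => comp q G y i j) q.target :=
  (hG.smooth q hq i j).mono fun _ hy => ⟨hy, trivial⟩

theorem contDiffOn_contractedChristoffel {q : OpenPartialHomeomorph Q (Coord n)}
    (hq : IsCoordinateSystem q) {G : TensorField n Q} (hG : IsMetric G) (h : Fin n) :
    ContDiffOn ℝ ∞ (contractedChristoffel q G h) q.target := by
  have h1 : ∀ k i j, ContDiffOn ℝ ∞ (partialD k fun y => compDown q G y i j) q.target :=
    fun k i j => contDiffOn_partialD q.open_target
      (contDiffOn_inv_apply (contDiffOn_comp hq hG) (fun y hy => det_comp_ne_zero hq hG hy) i j) k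
  exact ContDiffOn.sum fun i _ => ContDiffOn.sum fun j _ => (contDiffOn_comp hq hG i j).mul
    (contDiffOn_const.mul (ContDiffOn.sum fun k _ => (contDiffOn_comp hq hG h k).mul
      (((h1 i k j).add (h1 j k i)).sub (h1 k i j))))

/-- The coefficient `2 gⁱʲ ∂ⱼR / R - Γⁱ` of `uᵢ` in the Schrödinger equation for
`R ∏ φᵢ`. -/
def firstOrderCoeff (q : OpenPartialHomeomorph Q (Coord n)) (G : TensorField n Q) (R : Q → ℝ)
    (i : Fin n) (y : Coord n) : ℝ :=
  2 * (∑ j, comp q G y i j * (partialD j (fun y => R (q.symm y)) y / R (q.symm y)))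
    - contractedChristoffel q G i y

theorem contDiffOn_firstOrderCoeff {q : OpenPartialHomeomorph Q (Coord n)}
    (hq : IsCoordinateSystem q) {G : TensorField n Q} (hG : IsMetric G) {R : Q → ℝ}
    (hR : ContDiffOn ℝ ∞ (fun y => R (q.symm y)) q.target) (hR0 : ∀ x ∈ q.source, R x ≠ 0)
    (i : Fin n) : ContDiffOn ℝ ∞ (firstOrderCoeff q G R i) q.target :=
  (contDiffOn_const.mul (ContDiffOn.sum fun j _ => (contDiffOn_comp hq hG i j).mul
    ((contDiffOn_partialD q.open_target hR j).div hR fun _ hy => hR0 _ (q.map_target hy)))).sub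
    (contDiffOn_contractedChristoffel hq hG i)

variable {𝕜 : Type*} [RCLike 𝕜]

/-- The Schrödinger equation for a product, divided by the product. -/
theorem sepForm_eq_zero_of_solves {q : OpenPartialHomeomorph Q (Coord n)}
    {G : TensorField n Q} (hG : IsMetric G) {V : Q → ℝ} {hbar : ℝ}
    (hhbar : 0 < hbar) {E : ℝ} {R : Q → ℝ}
    (hR : ContDiffOn ℝ ∞ (fun y => R (q.symm y)) q.target) (hR0 : ∀ x ∈ q.source, R x ≠ 0)
    {φ : Fin n → ℝ → 𝕜} (hφ : ∀ i, ContDiffOn ℝ ∞ (φ i) (coordRange q i))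
    (hφ0 : ∀ i, ∀ t ∈ coordRange q i, φ i t ≠ 0)
    (hsol : SolvesSchrodinger G V hbar E q fun y => R (q.symm y) • ∏ i, φ i (y i))
    {y : Coord n} (hy : y ∈ q.target) :
    sepForm (fun i j => (comp q G y i j : 𝕜)) (fun i => (firstOrderCoeff q G R i y : 𝕜))
      (modifiedFactor G V hbar q E R (q.symm y) : 𝕜)
      (fun i => deriv (φ i) (y i) / φ i (y i)) (fun i => deriv (deriv (φ i)) (y i) / φ i (y i)) =
      0 := by
  have hT := isOpen_coordRange q
  have hmem : ∀ y ∈ q.target, ∀ i, y i ∈ coordRange q i := fun y hy _ => ⟨y, hy, rfl⟩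
  have hφ' : ∀ i, ContDiffOn ℝ ∞ (deriv (φ i)) (coordRange q i) := fun i =>
    (hφ i).deriv_of_isOpen (hT i) (by simp)
  have hφd : ∀ y ∈ q.target, ∀ i, DifferentiableAt ℝ (φ i) (y i) := fun _ hy i =>
    differentiableAt_of_contDiffOn (hT i) (hφ i) (hmem _ hy i)
  have hφne : ∀ y ∈ q.target, ∀ i, φ i (y i) ≠ 0 := fun y hy i => hφ0 i _ (hmem y hy i)
  set P : Coord n → 𝕜 := fun y => ∏ i, φ i (y i) with hP
  set r : Coord n → ℝ := fun y => R (q.symm y) with hr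
  have hP1 : ∀ y ∈ q.target, ∀ k, HasPartialAt k P (deriv (φ k) (y k) / φ k (y k) * P y) y :=
    fun y hy k => hasPartialAt_prod_coord k (hφd y hy) (hφne y hy)
  have hrd : ∀ y ∈ q.target, DifferentiableAt ℝ r y := fun y hy =>
    differentiableAt_of_contDiffOn q.open_target hR hy
  have hψ1 : ∀ j, Set.EqOn (partialD j fun y => r y • P y) (fun y => partialD j r y • P y +
      r y • (deriv (φ j) (y j) / φ j (y j) * P y)) q.target := fun j y hy =>
    ((hasPartialAt_partialD (hrd y hy)).smul (hP1 y hy j)).2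
  -- Uses u_i' + u_i² = v_i when i = j.
  have hu : ∀ i j, HasPartialAt i (fun y => deriv (φ j) (y j) / φ j (y j) * P y)
      ((if i = j then deriv (deriv (φ i)) (y i) / φ i (y i) else
        deriv (φ i) (y i) / φ i (y i) * (deriv (φ j) (y j) / φ j (y j))) * P y) y := by
    intro i j
    have h1 : HasDerivAt (fun t => deriv (φ j) t / φ j t) _ (y j) :=
      (differentiableAt_of_contDiffOn (hT j) (hφ' j) (hmem y hy j)).hasDerivAt.div
        (hφd y hy j).hasDerivAt (hφne y hy j)
    refine ((hasPartialAt_coord i j h1).mul (hP1 y hy i)).congr_deriv ?_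
    by_cases hij : i = j
    · subst hij
      simp only [if_true]
      field_simp [hφne y hy i]
      ring
    · simp only [if_neg hij, if_neg (Ne.symm hij)]
      ring
  have hψ2 : ∀ i j, partialD i (partialD j fun y => r y • P y) y =
      (partialD i (partialD j r) y • P y + partialD j r y • (deriv (φ i) (y i) / φ i (y i) * P y)) +
      (partialD i r y • (deriv (φ j) (y j) / φ j (y j) * P y) +
      r y • ((if i = j then deriv (deriv (φ i)) (y i) / φ i (y i) else
        deriv (φ i) (y i) / φ i (y i) * (deriv (φ j) (y j) / φ j (y j))) * P y)) := by
    intro i j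
    rw [partialD_congr_of_eqOn q.open_target (hψ1 j) hy]
    exact (((hasPartialAt_partialD (differentiableAt_of_contDiffOn q.open_target
      (contDiffOn_partialD q.open_target hR j) hy)).smul (hP1 y hy i)).add
      ((hasPartialAt_partialD (hrd y hy)).smul (hu i j))).2
  have hr0 : r y ≠ 0 := hR0 _ (q.map_target hy)
  have hr0' : (r y : 𝕜) ≠ 0 := by exact_mod_cast hr0
  have hP0 : P y ≠ 0 := Finset.prod_ne_zero_iff.2 fun i _ => hφne y hy i
  have hsymm : ∀ i j, (comp q G y i j : 𝕜) = (comp q G y j i : 𝕜) := fun i j => by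
    congr 1
    exact hG.symm _ _ _
  have hlap : laplacian q G (fun y => r y • P y) y = (r y : 𝕜) * P y *
      sepForm (fun i j => (comp q G y i j : 𝕜)) (fun i => (firstOrderCoeff q G R i y : 𝕜))
      ((laplacian q G r y / r y : ℝ) : 𝕜) (fun i => deriv (φ i) (y i) / φ i (y i))
      (fun i => deriv (deriv (φ i)) (y i) / φ i (y i)) := by
    have h1 := laplacian_product_algebra hsymm hr0' (fun j => ((partialD j r y : ℝ) : 𝕜))
      (fun l => ((contractedChristoffel q G l y : ℝ) : 𝕜))
      (fun i j => ((partialD i (partialD j r) y : ℝ) : 𝕜))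
      (fun i => deriv (φ i) (y i) / φ i (y i))
      (fun i => deriv (deriv (φ i)) (y i) / φ i (y i)) (P y)
    unfold laplacian firstOrderCoeff
    have hψ1y : ∀ j, partialD j (fun y => r y • P y) y = partialD j r y • P y +
      r y • (deriv (φ j) (y j) / φ j (y j) * P y) := fun j => hψ1 j hy
    simp only [hψ2, hψ1y]
    simp only [RCLike.real_smul_eq_coe_mul]
    rw [h1]
    push_cast
    simp [hr]
  have hs := hsol y hy
  rw [hlap] at hs
  have hmf : modifiedFactor G V hbar q E R (q.symm y) =
      laplacian q G r y / r y - 2 / hbar ^ 2 * (V (q.symm y) - E) := by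
    unfold modifiedFactor
    rw [q.right_inv hy]
    ring
  rw [hmf]
  simp only [RCLike.real_smul_eq_coe_mul] at hs
  have hb : (hbar : 𝕜) ≠ 0 := by exact_mod_cast hhbar.ne'
  have key : (r y : 𝕜) * P y * (-((hbar : 𝕜) ^ 2 / 2)) * sepForm (fun i j => (comp q G y i j : 𝕜))
      (fun i => (firstOrderCoeff q G R i y : 𝕜))
      ((laplacian q G r y / r y - 2 / hbar ^ 2 * (V (q.symm y) - E) : ℝ) : 𝕜)
      (fun i => deriv (φ i) (y i) / φ i (y i))
      (fun i => deriv (deriv (φ i)) (y i) / φ i (y i)) = 0 := by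
    rw [← hs]
    unfold sepForm
    push_cast
    field_simp
    ring
  have hcoef : (r y : 𝕜) * P y * (-((hbar : 𝕜) ^ 2 / 2)) ≠ 0 :=
    mul_ne_zero (mul_ne_zero hr0' hP0) (neg_ne_zero.2 (div_ne_zero (pow_ne_zero 2 hb) two_ne_zero))
  exact (mul_eq_zero.1 key).resolve_left hcoef

/-- FER-separable coordinates give a complete separation of the equation for the logarithmic
derivatives. -/
theorem IsFERSeparableWith.exists_isCompleteSeparation {G : TensorField n Q}
    (hn : 1 ≤ n) (hG : IsMetric G) {V : Q → ℝ} {hbar : ℝ} (hhbar : 0 < hbar)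
    {q : OpenPartialHomeomorph Q (Coord n)} (hq : IsCoordinateSystem q)
    (hnull : ∀ y ∈ q.target, ∀ i, comp q G y i i ≠ 0) {E : ℝ} {R : Q → ℝ}
    (hsep : IsFERSeparableWith 𝕜 G V hbar q E R) :
    ∃ (C : Set (Fin (2 * n - 1) → ℝ)) (u v : Fin n → ℝ → (Fin (2 * n - 1) → ℝ) → 𝕜),
      IsCompleteSeparation q.target (coordRange q) C
        (fun i j y => (comp q G y i j : 𝕜)) (fun i y => (firstOrderCoeff q G R i y : 𝕜))
        (fun y => (modifiedFactor G V hbar q E R (q.symm y) : 𝕜)) u v := by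
  obtain ⟨C, φ, hC, hCne, hφ, hφ0, hsol, hrank⟩ := hsep.complete
  have hT := isOpen_coordRange q
  have hmem : ∀ y ∈ q.target, ∀ i, y i ∈ coordRange q i := fun y hy i => ⟨y, hy, rfl⟩
  have hφ1 := fun i => contDiffOn_deriv_slice_left (hT i) hC (hφ i)
  have hφ2 := fun i => contDiffOn_deriv_slice_left
    (f := fun t c => deriv (fun t => φ i t c) t) (hT i) hC (hφ1 i)
  have hne : ∀ i, ∀ z ∈ coordRange q i ×ˢ C, φ i z.1 z.2 ≠ 0 := fun i z hz =>
    hφ0 i z.1 hz.1 z.2 hz.2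
  have hu : ∀ i, ContDiffOn ℝ ∞ (fun z : ℝ × (Fin (2 * n - 1) → ℝ) =>
      deriv (fun t => φ i t z.2) z.1 / φ i z.1 z.2) (coordRange q i ×ˢ C) := fun i =>
    ((hφ1 i).mul ((hφ i).inv (hne i))).congr fun z _ => div_eq_mul_inv _ _
  have hv : ∀ i, ContDiffOn ℝ ∞ (fun z : ℝ × (Fin (2 * n - 1) → ℝ) =>
      deriv (deriv fun t => φ i t z.2) z.1 / φ i z.1 z.2) (coordRange q i ×ˢ C) := fun i =>
    ((hφ2 i).mul ((hφ i).inv (hne i))).congr fun z _ => div_eq_mul_inv _ _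
  have heq : ∀ y ∈ q.target, ∀ c ∈ C, sepForm (fun i j => (comp q G y i j : 𝕜))
      (fun i => (firstOrderCoeff q G R i y : 𝕜))
      (modifiedFactor G V hbar q E R (q.symm y) : 𝕜)
      (fun i => deriv (fun t => φ i t c) (y i) / φ i (y i) c)
      (fun i => deriv (deriv fun t => φ i t c) (y i) / φ i (y i) c) = 0 := fun y hy c hc =>
    sepForm_eq_zero_of_solves hG hhbar hsep.smooth_R hsep.R_ne_zero
      (fun i => contDiffOn_slice_left (hφ i) hc) (fun i t ht => hφ0 i t ht c hc) (hsol c hc) hy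
  have hm : ∀ i j, ContDiffOn ℝ ∞ (fun y => (comp q G y i j : 𝕜)) q.target := fun i j =>
    contDiffOn_ofReal (contDiffOn_comp hq hG i j)
  have hh : ∀ i, ContDiffOn ℝ ∞ (fun y => (firstOrderCoeff q G R i y : 𝕜)) q.target := fun i =>
    contDiffOn_ofReal (contDiffOn_firstOrderCoeff hq hG hsep.smooth_R hsep.R_ne_zero i)
  refine ⟨C, fun i t c => deriv (fun t => φ i t c) t / φ i t c,
    fun i t c => deriv (deriv fun t => φ i t c) t / φ i t c, ⟨q.open_target, hT, hmem, hC, hCne,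
    hm, hh, ?_, ?_, ?_, hu, hv, ?_, heq, ?_⟩⟩
  -- The potential V is an arbitrary function, so the smoothness of the free term is read off from
  -- the equation: it is minus the remaining terms for any one solution.
  · obtain ⟨c, hc⟩ := hCne
    have hu' : ∀ i, ContDiffOn ℝ ∞ (fun y : Coord n =>
        deriv (fun t => φ i t c) (y i) / φ i (y i) c) q.target := fun i =>
      contDiffOn_comp_coord (contDiffOn_slice_left
        (f := fun t c => deriv (fun t => φ i t c) t / φ i t c) (hu i) hc) fun y hy => hmem y hy i
    have hv' : ∀ i, ContDiffOn ℝ ∞ (fun y : Coord n =>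
        deriv (deriv fun t => φ i t c) (y i) / φ i (y i) c) q.target := fun i =>
      contDiffOn_comp_coord (contDiffOn_slice_left
        (f := fun t c => deriv (deriv fun t => φ i t c) t / φ i t c) (hv i) hc)
        fun y hy => hmem y hy i
    have hU : ∀ i j, ContDiffOn ℝ ∞ (fun y : Coord n => if i = j then
        deriv (deriv fun t => φ i t c) (y i) / φ i (y i) c else
        deriv (fun t => φ i t c) (y i) / φ i (y i) c *
          (deriv (fun t => φ j t c) (y j) / φ j (y j) c)) q.target := by
      intro i j
      split_ifs
      · exact hv' i
      · exact (hu' i).mul (hu' j)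
    have hw := (((ContDiffOn.sum (s := Finset.univ) fun i _ =>
      ContDiffOn.sum (s := Finset.univ) fun j _ => (hm i j).mul (hU i j)).add
      (ContDiffOn.sum (s := Finset.univ) fun i _ => (hh i).mul (hu' i)))).neg
    refine hw.congr fun y hy => ?_
    have h1 := heq y hy c hc
    unfold sepForm at h1
    exact eq_neg_of_add_eq_zero_right h1
  · intro y _ i j
    congr 1
    exact hG.symm _ _ _
  · intro y hy i
    exact_mod_cast hnull y hy i
  · intro i t ht c hc
    have d1 := differentiableAt_of_contDiffOn (hT i) (contDiffOn_slice_left (hφ i) hc) ht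
    have d2 := differentiableAt_of_contDiffOn (hT i) (contDiffOn_slice_left
      (f := fun t c => deriv (fun t => φ i t c) t) (hφ1 i) hc) ht
    have h0 := hφ0 i t ht c hc
    rw [(d2.hasDerivAt.fun_div d1.hasDerivAt h0).deriv]
    field_simp
  · intro y hy c hc
    have h1 : paramJacobian (fun c => Sum.elim (fun i => deriv (fun t => φ i t c) (y i) / φ i (y i) c)
        (fun i => deriv (deriv fun t => φ i t c) (y i) / φ i (y i) c)) c =
        completenessMatrix φ y c := by
      ext a α
      rcases a with i | i <;> rfl
    rw [h1, hrank y hy c hc]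
    -- With truncated subtraction, 2n − 1 + 1 = 2n needs n ≥ 1.
    omega

end Schrodinger

end FER

/-! ### Assembly of the tensors on the chart domain. -/

namespace FER

section Assembly

variable {n : ℕ} {Q : Type*} [TopologicalSpace Q] [ChartedSpace (Coord n) Q]

theorem IsDiagonal.inv_smul {q : OpenPartialHomeomorph Q (Coord n)} {G : TensorField n Q}
    {g l : Fin n → Coord n → ℝ} (HG : IsDiagonal q G g) {σ : Coord n → ℝ}
    (hlσ : ∀ y ∈ q.target, ∀ i, l i y = g i y / σ y) :
    IsDiagonal q (fun x => (σ (q x))⁻¹ • G x) l := by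
  intro x hx α β
  simp only [LinearMap.smul_apply, HG x hx, smul_eq_mul, Finset.mul_sum,
    hlσ _ (q.map_source hx)]
  exact Finset.sum_congr rfl fun i _ => by ring

/-- Independence is tested on the diagonal components. Those of G are σ times the row `none` of κ,
and rescaling by units preserves independence. -/
theorem linearIndependent_extendFamily {q : OpenPartialHomeomorph Q (Coord n)}
    (hq : IsCoordinateSystem q) {G : TensorField n Q} {g : Fin n → Coord n → ℝ}
    (HG : IsDiagonal q G g) {σ : Coord n → ℝ} {K : Fin (n - 1) → TensorField n Q}
    {κ : Option (Fin (n - 1)) → Fin n → Coord n → ℝ} (HK : ∀ h, IsDiagonal q (K h) (κ (some h)))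
    (hκ : ∀ y ∈ q.target, ∀ i, κ none i y = g i y / σ y) {x : Q} (hx : x ∈ q.source)
    (hσ : σ (q x) ≠ 0) (hli : LinearIndependent ℝ fun a i => κ a i (q x)) :
    LinearIndependent ℝ fun a => extendFamily K G a x := by
  let f : LinearMap.BilinForm ℝ (Cotangent n x) →ₗ[ℝ] Fin n → ℝ :=
    { toFun := fun L i => L (coordForm q i x) (coordForm q i x)
      map_add' := fun _ _ => rfl
      map_smul' := fun _ _ => rfl }
  have hcomp : ∀ {L : TensorField n Q} {l : Fin n → Coord n → ℝ}, IsDiagonal q L l → ∀ i,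
      f (L x) i = l i (q x) := by
    intro L l HL i
    refine (HL x hx _ _).trans ?_
    simp [coordForm_coordVec_self hq hx]
  refine LinearIndependent.of_comp f ?_
  have h1 : f ∘ (fun a => extendFamily K G a x) =
      fun a => (a.elim (Units.mk0 _ hσ) fun _ => 1 : ℝˣ) • fun i => κ a i (q x) := by
    funext a i
    rcases a with - | h
    · refine (hcomp HG i).trans ?_
      simp [hκ _ (q.map_source hx), Units.smul_def, mul_div_cancel₀ _ hσ]
    · refine (hcomp (HK h) i).trans ?_
      simp
  rw [h1]
  exact hli.units_smul _

end Assembly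

end FER

end

open FER in
theorem propositionp {𝕜 : Type*} [RCLike 𝕜] {n : ℕ} (hn : 1 ≤ n)
    {Q : Type*} [TopologicalSpace Q] [ChartedSpace (EuclideanSpace ℝ (Fin n)) Q]
    [IsManifold (𝓡 n) ∞ Q]
    (G : TensorField n Q) (hG : IsMetric G) (V : Q → ℝ) (hbar : ℝ) (hhbar : 0 < hbar)
    (q : OpenPartialHomeomorph Q (EuclideanSpace ℝ (Fin n))) (hq : IsCoordinateSystem q)
    (hnull : ∀ y ∈ q.target, ∀ i, comp q G y i i ≠ 0)
    (E : ℝ) (R : Q → ℝ) (hsep : IsFERSeparableWith 𝕜 G V hbar q E R) :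
    ∃ (K : Fin (n - 1) → TensorField n Q) (σ : Q → ℝ),
      (∀ h, IsConformalKillingOn G q.source (K h)) ∧
      (∀ x ∈ q.source, LinearIndependent ℝ (fun a => extendFamily K G a x)) ∧
      (∀ x ∈ q.source, ∃ b : Module.Basis (Fin n) ℝ (TangentSpace (𝓡 n) x),
        IsCoordBasis q x b ∧ ∀ h i, IsEigenvectorAt G (K h) x (b i)) ∧
      (∀ x ∈ q.source, σ x ≠ 0) ∧
      IsSmoothOn (fun x => (σ x)⁻¹ • G x) q.source ∧
      ((∀ x ∈ q.source, modifiedFactor G V hbar q E R x ≠ 0) →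
        ∀ x ∈ q.source, σ x = modifiedFactor G V hbar q E R x) ∧
      (∀ a b, PoissonCommuteOn q.source
        (momentumPoly (extendFamily K (fun x => (σ x)⁻¹ • G x) a))
        (momentumPoly (extendFamily K (fun x => (σ x)⁻¹ • G x) b))) := by
  obtain ⟨C, u, v, H⟩ := hsep.exists_isCompleteSeparation hn hG hhbar hq hnull
  have hg : ∀ i, ContDiffOn ℝ ∞ (fun y => comp q G y i i) q.target := fun i =>
    contDiffOn_comp hq hG i i
  have hf := contDiffOn_firstOrderCoeff hq hG hsep.smooth_R hsep.R_ne_zero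
  obtain ⟨c, hc⟩ := H.param_nonempty
  have HS := H.isStaeckelFamily (m := fun i j y => comp q G y i j) hg hf hc
  have HG : IsDiagonal q G fun i y => comp q G y i i := isDiagonal_of_comp hq
    fun y hy i j hij => RCLike.ofReal_eq_zero.1 (H.offDiag_eq_zero hy hij)
  obtain ⟨θ, hθ, hθp, hθ0, hθm⟩ : ∃ θ : Fin n → Coord n → ℝ,
      (∀ i, ContDiffOn ℝ ∞ (θ i) q.target) ∧
      (∀ i k, i ≠ k → ∀ y ∈ q.target, partialD k (θ i) y = 0) ∧
      (∀ y ∈ q.target, ∑ i, comp q G y i i * θ i y ≠ 0) ∧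
      ((∀ x ∈ q.source, modifiedFactor G V hbar q E R x ≠ 0) → ∀ y ∈ q.target,
        ∑ i, comp q G y i i * θ i y = modifiedFactor G V hbar q E R (q.symm y)) := by
    -- If the modified factor has no zero, σ must equal it and θ comes from the free term; otherwise
    -- any θ of Stäckel type with σ ≠ 0 will do.
    by_cases hW : ∀ x ∈ q.source, modifiedFactor G V hbar q E R x ≠ 0
    · obtain ⟨θ, h1, h2, h3⟩ := H.exists_staeckel_row_of_free_term
        (m := fun i j y => comp q G y i j) hg hf
      exact ⟨θ, h1, h2, fun y hy => by rw [h3 y hy]; exact hW _ (q.map_target hy), fun _ => h3⟩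
    -- A constant row is trivially of Stäckel type; here σ is the diagonal coefficient of the first
    -- coordinate, non-zero by `hnull`.
    · refine ⟨fun i _ => if i = ⟨0, hn⟩ then 1 else 0, fun i => contDiffOn_const,
        fun i k _ y _ => partialD_const k _ y, fun y hy => ?_, fun h => absurd h hW⟩
      simpa using hnull y hy _
  obtain ⟨κ, hκ, hli, hκn, hκt⟩ := HS.exists_involutive_family hn hθ hθp hθ0
  set σ : Coord n → ℝ := fun y => ∑ i, comp q G y i i * θ i y with hσ
  have hσs : ContDiffOn ℝ ∞ σ q.target := ContDiffOn.sum fun i _ => (hg i).mul (hθ i)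
  have HN : IsDiagonal q (fun x => (σ (q x))⁻¹ • G x) (κ none) := HG.inv_smul hκn
  have HK : ∀ h : Fin (n - 1), IsDiagonal q (diagonalTensor q (κ (some h))) (κ (some h)) :=
    fun h => isDiagonal_diagonalTensor q _
  have HE : ∀ a, IsDiagonal q (extendFamily (fun h => diagonalTensor q (κ (some h)))
      (fun x => (σ (q x))⁻¹ • G x) a) (κ a) := by
    rintro (- | h)
    · exact HN
    · exact HK h
  have ht : ∀ a b, ∀ y ∈ q.target, ∃ t : Fin n → Fin n → ℝ, ∀ j i,
      partialD j (κ a i) y = κ a j y * t j i ∧ partialD j (κ b i) y = κ b j y * t j i := by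
    intro a b y hy
    obtain ⟨t, ht⟩ := hκt y hy
    exact ⟨t, fun j i => ⟨ht a j i, ht b j i⟩⟩
  refine ⟨fun h => diagonalTensor q (κ (some h)), fun x => σ (q x), fun h => ?_, fun x hx => ?_,
    fun x hx => ?_, fun x hx => hθ0 _ (q.map_source hx), HN.isSmoothOn hq (hκ none),
    fun hW x hx => ?_, fun a b => ?_⟩
  · exact (HK h).isConformalKillingOn HG hq (hκ _) (hκ none) (ht _ _) hσs hθ0 hκn
  · exact linearIndependent_extendFamily hq HG HK hκn hx (hθ0 _ (q.map_source hx))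
      (hli _ (q.map_source hx))
  · obtain ⟨b, hb, hbc⟩ := exists_coordBasis hq hx
    refine ⟨b, hbc, fun h i => ?_⟩
    rw [hb]
    exact (HK h).isEigenvectorAt HG hq hx i (hnull _ (q.map_source hx) i)
  · have h1 := hθm hW _ (q.map_source hx)
    rwa [q.left_inv hx] at h1
  · exact (HE a).poissonCommuteOn (HE b) hq (hκ a) (hκ b) (ht a b)
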